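/- Let $\lambda_1,\lambda_2\in\mathbb R$, $\Sigma=\begin{pmatrix}0&\lambda_1\\ \lambda_2&0\end{pmatrix}$ and $\Upsilon=\{(x,y): 0\le y\le x\le 1\}$. For a function $M:\Upsilon\to\mathbb R^{2\times 2}$ let $\bar M=(M_{11},M_{12},M_{21},M_{22})^T$, and consider the Goursat problems on $\Upsilon$ $$\bar K_{xx}-\bar K_{yy}=\Lambda\bar K,\qquad \bar K(x,x)=\left(0,-\tfrac{\lambda_1}{2}x,-\tfrac{\lambda_2}{2}x,0\right)^T,\qquad \bar K_y(x,0)=0,$$ $$\bar L_{xx}-\bar L_{yy}=-\Psi\bar L,\qquad \bar L(x,x)=\left(0,-\tfrac{\lambda_1}{2}x,-\tfrac{\lambda_2}{2}x,0\right)^T,\qquad \bar L_y(x,0)=0,$$ where $$\Lambda=\begin{pmatrix}0&\lambda_2&0&0\\ \lambda_1&0&0&0\\ 0&0&0&\lambda_2\\ 0&0&\lambda_1&0\end{pmatrix},\qquad \Psi=\begin{pmatrix}0&0&\lambda_1&0\\ 0&0&0&\lambda_1\\ \lambda_2&0&0&0\\ 0&\lambda_2&0&0\end{pmatrix}.$$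 **Theorem.** There are constants $\kappa,\varepsilon>0$, independent of $\lambda_1,\lambda_2$, such that the following holds for all real $\lambda_1,\lambda_2$. Each of the two problems has a unique solution in $C^2(\Upsilon)$; call these $K$ and $L$, and let $K_\infty=\max_{\Upsilon}\|K(x,y)\|_2$ and $L_\infty=\max_{\Upsilon}\|L(x,y)\|_2$ (spectral norm). For every $w_0\in L^2((0,1);\mathbb R^2)$ the closed-loop system $$w_t=w_{xx}+\Sigma w,\qquad w_x(0,t)=0,\qquad w(1,t)=U(t)=\int_0^1K(1,y)\,w(y,t)\,dy\qquad(0<x<1,\ t>0),\qquad w(\cdot,0)=w_0,$$ has a unique classical solution, that is, a unique $w\in C^{2,1}((0,1)\times(0,\infty))$ such that $w$ extends continuously to $[0,1]\times(0,\infty)$, $w_x$ extends continuously to $[0,1)\times(0,\infty)$, the equation and the boundary conditions hold pointwise for $t>0$, and $\|w(\cdot,t)-w_0\|_{L^2(0,1)}\to0$ as $t\downarrow0$. Moreover, the origin $w\equiv0$ is exponentially stable in the $L^2$ sense: this solution satisfies $$\|w(\cdot,t)\|_{L^2(0,1)}\le\kappa(1+L_\infty)(1+K_\infty)\,e^{-\varepsilon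 t}\,\|w_0\|_{L^2(0,1)}\qquad(t>0).$$ -/

import Mathlib

open Set Filter Topology MeasureTheory

namespace Backstepping

noncomputable section

/-- The state space of the two components `w = (u, v)`, with the Euclidean norm. -/
abbrev State : Type := EuclideanSpace ℝ (Fin 2)

/-- The coupling matrix `Σ`. -/
def coupling (lam₁ lam₂ : ℝ) : Matrix (Fin 2) (Fin 2) ℝ :=
  !![0, lam₁; lam₂, 0]

/-- A real `2 × 2` matrix acting on a vector of the Euclidean plane; its norm as a continuous
linear map is the spectral norm `‖M‖₂`. -/
abbrev act (M : Matrix (Fin 2) (Fin 2) ℝ) : State →L[ℝ] State :=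
  Matrix.toEuclideanCLM (𝕜 := ℝ) M

/-- The triangle `Υ = {(x, y) | 0 ≤ y ≤ x ≤ 1}`. -/
def triangle : Set (ℝ × ℝ) :=
  {p | 0 ≤ p.2 ∧ p.2 ≤ p.1 ∧ p.1 ≤ 1}

/-- The entries of a `2 × 2` matrix, row by row, as a vector of length 4. -/
def vec (M : Matrix (Fin 2) (Fin 2) ℝ) : Fin 4 → ℝ :=
  ![M 0 0, M 0 1, M 1 0, M 1 1]

/-- The matrix `Λ` of the kernel equations. -/
def bigLambda (lam₁ lam₂ : ℝ) : Matrix (Fin 4) (Fin 4) ℝ :=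
  !![0, lam₂, 0, 0;
     lam₁, 0, 0, 0;
     0, 0, 0, lam₂;
     0, 0, lam₁, 0]

/-- The matrix `Ψ` of the inverse kernel equations. -/
def bigPsi (lam₁ lam₂ : ℝ) : Matrix (Fin 4) (Fin 4) ℝ :=
  !![0, 0, lam₁, 0;
     0, 0, 0, lam₁;
     lam₂, 0, 0, 0;
     0, lam₂, 0, 0]

/-- `K` is a `C²(Υ)` solution of the Goursat problem
`K̄_xx - K̄_yy = A K̄`, `K̄(x,x) = (0, -λ₁x/2, -λ₂x/2, 0)`, `K̄_y(x,0) = 0`.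
The values of `K` outside of the triangle are irrelevant. -/
structure IsGoursatSolution (A : Matrix (Fin 4) (Fin 4) ℝ) (lam₁ lam₂ : ℝ)
    (K : ℝ → ℝ → Matrix (Fin 2) (Fin 2) ℝ) : Prop where
  contDiff : ∀ i, ContDiffOn ℝ 2 (fun p : ℝ × ℝ => vec (K p.1 p.2) i) triangle
  pde : ∀ x y : ℝ, 0 < y → y < x → x < 1 → ∀ i,
    iteratedDeriv 2 (fun x' => vec (K x' y) i) x - iteratedDeriv 2 (fun y' => vec (K x y') i) y
      = (A.mulVec (vec (K x y))) i
  diag : ∀ x ∈ Icc (0 : ℝ) 1, vec (K x x) = ![0, -(lam₁ / 2) * x, -(lam₂ / 2) * x, 0]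
  bottom : ∀ x ∈ Ioc (0 : ℝ) 1, ∀ i,
    HasDerivWithinAt (fun y => vec (K x y) i) 0 (Icc 0 x) 0

/-- The backstepping kernel `K`. -/
def IsKernel (lam₁ lam₂ : ℝ) (K : ℝ → ℝ → Matrix (Fin 2) (Fin 2) ℝ) : Prop :=
  IsGoursatSolution (bigLambda lam₁ lam₂) lam₁ lam₂ K

/-- The kernel `L` of the inverse transformation. -/
def IsInverseKernel (lam₁ lam₂ : ℝ) (L : ℝ → ℝ → Matrix (Fin 2) (Fin 2) ℝ) : Prop :=
  IsGoursatSolution (-bigPsi lam₁ lam₂) lam₁ lam₂ L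

/-- `K_∞`, the maximum over the triangle of the spectral norm of a kernel. -/
def kernelBound (K : ℝ → ℝ → Matrix (Fin 2) (Fin 2) ℝ) : ℝ :=
  sSup ((fun p : ℝ × ℝ => ‖act (K p.1 p.2)‖) '' triangle)

/-- Lebesgue measure on `(0,1)`. -/
abbrev unitMeasure : Measure ℝ := volume.restrict (Ioo (0 : ℝ) 1)

/-- The `L²(0,1)` norm (with value in `[0,∞]`). -/
def l2norm (f : ℝ → State) : ENNReal := eLpNorm f 2 unitMeasure

/-- The state feedback `U(t) = ∫₀¹ K(1,y) w(y,t) dy`. -/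
def feedback (K : ℝ → ℝ → Matrix (Fin 2) (Fin 2) ℝ) (w : ℝ → ℝ → State) (t : ℝ) : State :=
  ∫ y in (0 : ℝ)..1, act (K 1 y) (w y t)

/-- `w = w(x,t)` is a classical solution of the closed loop
`w_t = w_xx + Σ w`, `w_x(0,t) = 0`, `w(1,t) = ∫₀¹ K(1,y) w(y,t) dy`, `w(·,0) = w₀`:
it is of class `C^{2,1}` on `(0,1) × (0,∞)`, `w` and `w_x` are continuous up to those
boundary points at which the boundary conditions (and the feedback) evaluate them, and the initial
value in `L²(0,1)` is attained in the `L²` norm as `t ↓ 0`. -/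
def IsClassicalSolution (lam₁ lam₂ : ℝ) (K : ℝ → ℝ → Matrix (Fin 2) (Fin 2) ℝ)
    (w₀ : ℝ → State) (w : ℝ → ℝ → State) : Prop :=
  ∃ wx wxx wt : ℝ → ℝ → State,
    ContinuousOn (fun p : ℝ × ℝ => w p.1 p.2) (Icc 0 1 ×ˢ Ioi 0) ∧
    ContinuousOn (fun p : ℝ × ℝ => wx p.1 p.2) (Ico 0 1 ×ˢ Ioi 0) ∧
    ContinuousOn (fun p : ℝ × ℝ => wxx p.1 p.2) (Ioo 0 1 ×ˢ Ioi 0) ∧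
    ContinuousOn (fun p : ℝ × ℝ => wt p.1 p.2) (Ioo 0 1 ×ˢ Ioi 0) ∧
    (∀ x ∈ Ico (0 : ℝ) 1, ∀ t > 0, HasDerivWithinAt (fun x' => w x' t) (wx x t) (Icc 0 1) x) ∧
    (∀ x ∈ Ioo (0 : ℝ) 1, ∀ t > 0, HasDerivAt (fun x' => wx x' t) (wxx x t) x) ∧
    (∀ x ∈ Ioo (0 : ℝ) 1, ∀ t > 0, HasDerivAt (fun t' => w x t') (wt x t) t) ∧
    (∀ x ∈ Ioo (0 : ℝ) 1, ∀ t > 0, wt x t = wxx x t + act (coupling lam₁ lam₂) (w x t)) ∧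
    (∀ t > 0, wx 0 t = 0) ∧
    (∀ t > 0, w 1 t = feedback K w t) ∧
    Tendsto (fun t => l2norm (fun x => w x t - w₀ x)) (𝓝[>] 0) (𝓝 0)

end

end Backstepping

/-! Backstepping with an explicit kernel. Row by row, the problem for `K` is the matrix equation
`K_xx - K_yy = K Σ` and the one for `L` is `L_xx - L_yy = -Σ L` (`bigLambda_mulVec`,
`bigPsi_mulVec`). With `k_S(x,y) = (x/2) S ∑ (S (x² - y²))ⁿ / (4ⁿ n! (n+1)!)`, a Bessel series
commuting with `S`, they are solved by `K = -k_Σ` and `L = k_{-Σ}`. Uniqueness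
(`IsGoursatSolution.eqOn`) is Picard iteration along characteristics.

Let `T_S f = f + ∫₀ˣ k_S(x,y) f(y) dy`. The kernel equations amount to the intertwining relation
`(T_S f)'' = T_S (f'' + S f)` for `f'(0) = 0` (`isNeumannC2_transform`). Hence `z = T_Σ w` turns the
closed loop into the heat equation with `z_x(0) = 0` and, by the choice of the feedback, `z(1) = 0`.
The functions `cos ((n + 1/2) π x)` diagonalize this problem and are complete in `L²` (`modeBasis`).

The inverse of `T_S` is `T_{-S}`. No composition of kernels is computed: `T_S T_{-S}` applied to
`cos (μ x) v` solves `h'' = -μ² h`, `h'(0) = 0`, `h(0) = v` by two uses of the intertwining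
relation, so it fixes all cosines and, by density, all of `L²` (`transformLp_comp_neg`).

A classical solution has no derivatives up to `x = 1` and no `w_t` up to the boundary, so `z` cannot
be differentiated naively. Its time averages are `C²` on `[0,1]`, which is enough to show that the
`n`-th cosine coefficient of `z` is `exp (-μₙ² t)` times that of `T_Σ w₀`
(`IsReactionDiffusion.coeff_transform`). This gives uniqueness, and with Parseval the decay `exp
(-(π/2)² t)`; the factors `1 + K_∞` and `1 + L_∞` bound `T_Σ` and its inverse. Existence comes from
`w = T_{-Σ} z` with the cosine series `z` started at `T_Σ w₀` (`exists_isReactionDiffusion`). -/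

open Set Filter Topology MeasureTheory

namespace Backstepping

noncomputable section

set_option linter.unusedSectionVars false

/-! ### The explicit kernel: Bessel series in a Banach algebra. -/

section

variable {𝔸 : Type*} [NormedRing 𝔸] [NormOneClass 𝔸] [NormedAlgebra ℝ 𝔸]

/-- The coefficients of `r ↦ I_j(√r) (√r/2)^(-j)`. -/
def besselCoeff (j n : ℕ) : ℝ := 1 / (4 ^ n * n.factorial * (n + j).factorial)

lemma besselCoeff_nonneg (j n : ℕ) : 0 ≤ besselCoeff j n := by
  unfold besselCoeff; positivity

/-- The factor `n` produced by differentiating a term is absorbed by `4 ^ n`, so the differentiated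
series keeps an exponential majorant. -/
lemma natCast_mul_besselCoeff_le (j n : ℕ) :
    (n : ℝ) * besselCoeff j n ≤ 1 / n.factorial := by
  have h1 : (n : ℝ) ≤ 4 ^ n := by
    exact_mod_cast (Nat.lt_pow_self (by norm_num : 1 < 4)).le
  have h2 : (1 : ℝ) ≤ (n + j).factorial := by exact_mod_cast Nat.one_le_iff_ne_zero.2 (Nat.factorial_ne_zero _)
  have h3 : (0 : ℝ) < n.factorial := by exact_mod_cast Nat.factorial_pos _
  unfold besselCoeff
  rw [mul_one_div, div_le_div_iff₀ (by positivity) h3]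
  nlinarith [mul_le_mul h1 h2 zero_le_one (by positivity)]

lemma besselCoeff_le (j n : ℕ) : besselCoeff j n ≤ 1 / n.factorial := by
  have h1 : (1 : ℝ) ≤ 4 ^ n := one_le_pow₀ (by norm_num)
  have h2 : (1 : ℝ) ≤ (n + j).factorial := by exact_mod_cast Nat.one_le_iff_ne_zero.2 (Nat.factorial_ne_zero _)
  have h3 : (0 : ℝ) < n.factorial := by exact_mod_cast Nat.factorial_pos _
  unfold besselCoeff
  apply one_div_le_one_div_of_le h3
  nlinarith [mul_le_mul h1 h2 zero_le_one (by positivity)]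

lemma besselCoeff_succ (j n : ℕ) :
    besselCoeff j (n + 1) * (n + 1) = 1 / 4 * besselCoeff (j + 1) n := by
  unfold besselCoeff
  rw [show n + 1 + j = n + (j + 1) by ring, Nat.factorial_succ n]
  push_cast
  field_simp
  ring

lemma besselCoeff_rec (j n : ℕ) :
    (n + (j + 1)) * besselCoeff (j + 1) n = besselCoeff j n := by
  unfold besselCoeff
  rw [← add_assoc n j 1, Nat.factorial_succ (n + j)]
  push_cast
  have : (n : ℝ) + j + 1 ≠ 0 := by positivity
  field_simp
  ring

/-- The entire function `r ↦ ∑ rⁿ Sⁿ / (4ⁿ n! (n+j)!)` of the element `S`. -/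
def bessel (S : 𝔸) (j : ℕ) (r : ℝ) : 𝔸 := ∑' n : ℕ, (besselCoeff j n * r ^ n) • S ^ n

/-- One majorant serves the series and its derivative: differentiation lowers the power of `r` but
not that of `S`, whence two exponents `m ≤ n`, and `1 ≤ R` makes up for the difference. -/
lemma norm_bessel_term_le (S : 𝔸) {c r R : ℝ} (n : ℕ) (hc : |c| ≤ 1 / n.factorial)
    {m : ℕ} (hm : m ≤ n) (hr : |r| ≤ R) (hR : 1 ≤ R) :
    ‖(c * r ^ m) • S ^ n‖ ≤ (R * ‖S‖) ^ n / n.factorial := by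
  rw [norm_smul, norm_mul, norm_pow, Real.norm_eq_abs, Real.norm_eq_abs]
  calc |c| * |r| ^ m * ‖S ^ n‖ ≤ 1 / n.factorial * R ^ n * ‖S‖ ^ n := by
        gcongr
        · exact (pow_le_pow_left₀ (abs_nonneg _) hr m).trans (pow_le_pow_right₀ hR hm)
        · exact norm_pow_le _ _
    _ = _ := by rw [mul_pow]; ring

variable [CompleteSpace 𝔸]

lemma summable_bessel (S : 𝔸) (j : ℕ) (r : ℝ) :
    Summable fun n : ℕ => (besselCoeff j n * r ^ n) • S ^ n := by
  refine Summable.of_norm_bounded (Real.summable_pow_div_factorial ((|r| + 1) * ‖S‖)) fun n => ?_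
  refine norm_bessel_term_le S n ?_ le_rfl (by linarith) (by linarith [abs_nonneg r])
  rw [abs_of_nonneg (besselCoeff_nonneg _ _)]
  exact besselCoeff_le _ _

lemma hasDerivAt_bessel (S : 𝔸) (j : ℕ) (r : ℝ) :
    HasDerivAt (bessel S j) ((1 / 4 : ℝ) • (S * bessel S (j + 1) r)) r := by
  set R : ℝ := |r| + 1
  have hR : 1 ≤ R := by simp only [R]; linarith [abs_nonneg r]
  have key := hasDerivAt_tsum_of_isPreconnected (𝕜 := ℝ) (F := 𝔸)
    (g := fun n r => (besselCoeff j n * r ^ n) • S ^ n)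
    (g' := fun n r => (besselCoeff j n * (n * r ^ (n - 1))) • S ^ n)
    (u := fun n : ℕ => (R * ‖S‖) ^ n / n.factorial) (t := Metric.ball 0 R) (y₀ := r) (y := r)
    (Real.summable_pow_div_factorial (R * ‖S‖)) Metric.isOpen_ball
    (convex_ball _ _).isPreconnected ?_ ?_ (by simp [R]) (summable_bessel S j r) (by simp [R])
  · convert! key using 1
    rw [Summable.tsum_eq_zero_add]
    · simp only [Nat.cast_zero, zero_mul, mul_zero, zero_smul, zero_add, add_tsub_cancel_right,
        bessel]
      rw [← (summable_bessel S (j + 1) r).tsum_mul_left, ← Summable.tsum_const_smul]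
      · congr 1
        ext1 n
        rw [mul_smul_comm, smul_smul, ← pow_succ']
        congr 1
        push_cast
        rw [← mul_assoc, ← mul_assoc, besselCoeff_succ]
      · exact (summable_bessel S (j + 1) r).mul_left S
    · refine Summable.of_norm_bounded (Real.summable_pow_div_factorial (R * ‖S‖)) fun n => ?_
      rw [← mul_assoc, mul_comm (besselCoeff j n)]
      refine norm_bessel_term_le S n ?_ (Nat.sub_le _ _) (by simp [R]) hR
      rw [abs_of_nonneg (mul_nonneg (Nat.cast_nonneg _) (besselCoeff_nonneg _ _))]
      exact natCast_mul_besselCoeff_le _ _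
  · intro n y _
    exact ((hasDerivAt_pow n y).const_mul _).smul_const _
  · intro n y hy
    rw [← mul_assoc, mul_comm (besselCoeff j n)]
    refine norm_bessel_term_le S n ?_ (Nat.sub_le _ _) (by simpa using (mem_ball_zero_iff.1 hy).le) hR
    rw [abs_of_nonneg (mul_nonneg (Nat.cast_nonneg _) (besselCoeff_nonneg _ _))]
    exact natCast_mul_besselCoeff_le _ _

lemma continuous_bessel (S : 𝔸) (j : ℕ) : Continuous (bessel S j) :=
  continuous_iff_continuousAt.2 fun r => (hasDerivAt_bessel S j r).continuousAt

lemma contDiff_bessel (S : 𝔸) (k : ℕ) : ∀ j, ContDiff ℝ k (bessel S j) := by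
  induction k with
  | zero => intro j; exact contDiff_zero.2 (continuous_bessel S j)
  | succ k ih =>
    intro j
    have : ((k + 1 : ℕ) : WithTop ℕ∞) = (k : WithTop ℕ∞) + 1 := by norm_cast
    rw [this, contDiff_succ_iff_deriv]
    refine ⟨fun r => (hasDerivAt_bessel S j r).differentiableAt, by simp, ?_⟩
    rw [show deriv (bessel S j) = fun r => (1 / 4 : ℝ) • (S * bessel S (j + 1) r) from
      funext fun r => (hasDerivAt_bessel S j r).deriv]
    exact (contDiff_const.mul (ih (j + 1))).const_smul _

/-- The three-term recurrence of the modified Bessel functions, compared coefficientwise by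
`besselCoeff_rec`; the case `j = 1` is the wave equation for `kernel`. -/
lemma bessel_rec (S : 𝔸) (j : ℕ) (r : ℝ) :
    (r / 4) • (S * bessel S (j + 2) r) + ((j : ℝ) + 1) • bessel S (j + 1) r = bessel S j r := by
  have h1 : HasSum (fun n : ℕ => (besselCoeff (j + 1) n * (n * r ^ n)) • S ^ n)
      ((r / 4) • (S * bessel S (j + 2) r)) := by
    rw [← hasSum_nat_add_iff' 1]
    simp only [Finset.range_one, Finset.sum_singleton, Nat.cast_zero, zero_mul, mul_zero, zero_smul,
      sub_zero]
    convert! (((summable_bessel S (j + 2) r).hasSum).mul_left S).const_smul (r / 4) using 1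
    ext1 n
    rw [mul_smul_comm, smul_smul, ← pow_succ']
    congr 1
    push_cast
    rw [← mul_assoc, besselCoeff_succ]
    ring
  have h2 := h1.add ((summable_bessel S (j + 1) r).hasSum.const_smul ((j : ℝ) + 1))
  refine h2.unique ?_
  convert! (summable_bessel S j r).hasSum using 1
  ext1 n
  rw [smul_smul, ← add_smul, ← besselCoeff_rec j n]
  congr 1
  ring

lemma bessel_zero_right (S : 𝔸) (j : ℕ) :
    bessel S j 0 = (1 / (j.factorial : ℝ)) • (1 : 𝔸) := by
  unfold bessel
  rw [tsum_eq_single 0]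
  · simp [besselCoeff]
  · intro n hn
    simp [hn]

lemma commute_bessel (S : 𝔸) (j : ℕ) (r : ℝ) : Commute S (bessel S j r) := by
  unfold bessel Commute SemiconjBy
  rw [← (summable_bessel S j r).tsum_mul_left, ← (summable_bessel S j r).tsum_mul_right]
  congr 1
  ext1 n
  rw [mul_smul_comm, smul_mul_assoc, ← pow_succ', ← pow_succ]

/-- The kernel `(x/2) S ∑ (S (x² - y²))ⁿ / (4ⁿ n! (n+1)!)`. The backstepping kernel is
`-kernel Σ`, and the kernel of the inverse transformation is `kernel (-Σ)`. -/
def kernel (S : 𝔸) (x y : ℝ) : 𝔸 := (x / 2) • (S * bessel S 1 (x ^ 2 - y ^ 2))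

/-- The derivative of `kernel S x y` in `x`. -/
def kernelX (S : 𝔸) (x y : ℝ) : 𝔸 :=
  (1 / 2 : ℝ) • (S * bessel S 1 (x ^ 2 - y ^ 2))
    + (x ^ 2 / 4) • (S * (S * bessel S 2 (x ^ 2 - y ^ 2)))

/-- The second derivative of `kernel S x y` in `x`. -/
def kernelXX (S : 𝔸) (x y : ℝ) : 𝔸 :=
  (3 * x / 4) • (S * (S * bessel S 2 (x ^ 2 - y ^ 2)))
    + (x ^ 3 / 8) • (S * (S * (S * bessel S 3 (x ^ 2 - y ^ 2))))

/-- The derivative of `kernel S x y` in `y`. -/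
def kernelY (S : 𝔸) (x y : ℝ) : 𝔸 :=
  (-(x * y) / 4) • (S * (S * bessel S 2 (x ^ 2 - y ^ 2)))

/-- The second derivative of `kernel S x y` in `y`. -/
def kernelYY (S : 𝔸) (x y : ℝ) : 𝔸 :=
  (-x / 4) • (S * (S * bessel S 2 (x ^ 2 - y ^ 2)))
    + (x * y ^ 2 / 8) • (S * (S * (S * bessel S 3 (x ^ 2 - y ^ 2))))

lemma hasDerivAt_bessel_left (S : 𝔸) (j : ℕ) (x y : ℝ) :
    HasDerivAt (fun x => bessel S j (x ^ 2 - y ^ 2))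
      ((x / 2) • (S * bessel S (j + 1) (x ^ 2 - y ^ 2))) x := by
  have h : HasDerivAt (fun x : ℝ => x ^ 2 - y ^ 2) (2 * x) x := by
    simpa using (hasDerivAt_pow 2 x).sub_const (y ^ 2)
  convert! (hasDerivAt_bessel S j (x ^ 2 - y ^ 2)).scomp x h using 1
  rw [smul_smul]; congr 1; ring

lemma hasDerivAt_bessel_right (S : 𝔸) (j : ℕ) (x y : ℝ) :
    HasDerivAt (fun y => bessel S j (x ^ 2 - y ^ 2))
      ((-y / 2) • (S * bessel S (j + 1) (x ^ 2 - y ^ 2))) y := by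
  have h : HasDerivAt (fun y : ℝ => x ^ 2 - y ^ 2) (-(2 * y)) y := by
    simpa using (hasDerivAt_pow 2 y).const_sub (x ^ 2)
  convert! (hasDerivAt_bessel S j (x ^ 2 - y ^ 2)).scomp y h using 1
  rw [smul_smul]; congr 1; ring

lemma hasDerivAt_kernel_left (S : 𝔸) (x y : ℝ) :
    HasDerivAt (fun x => kernel S x y) (kernelX S x y) x := by
  have h := ((hasDerivAt_id' x).div_const 2).smul ((hasDerivAt_bessel_left S 1 x y).const_mul S)
  convert! h using 1
  simp only [kernelX, mul_smul_comm, smul_smul]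
  rw [add_comm]
  congr 2
  ring

lemma hasDerivAt_kernelX (S : 𝔸) (x y : ℝ) :
    HasDerivAt (fun x => kernelX S x y) (kernelXX S x y) x := by
  have h1 := ((hasDerivAt_bessel_left S 1 x y).const_mul S).const_smul (1 / 2 : ℝ)
  have h2 := ((hasDerivAt_pow 2 x).div_const 4).smul
    (((hasDerivAt_bessel_left S 2 x y).const_mul S).const_mul S)
  convert! h1.add h2 using 1
  simp only [kernelXX, mul_smul_comm, smul_smul]
  push_cast
  module

lemma hasDerivAt_kernel_right (S : 𝔸) (x y : ℝ) :
    HasDerivAt (fun y => kernel S x y) (kernelY S x y) y := by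
  have h := ((hasDerivAt_bessel_right S 1 x y).const_mul S).const_smul (x / 2)
  convert! h using 1
  simp only [kernelY, mul_smul_comm, smul_smul]
  module

lemma hasDerivAt_kernelY (S : 𝔸) (x y : ℝ) :
    HasDerivAt (fun y => kernelY S x y) (kernelYY S x y) y := by
  have h0 : HasDerivAt (fun y : ℝ => -(x * y) / 4) (-x / 4) y := by
    have := ((hasDerivAt_id' y).const_mul (-x / 4))
    convert! this using 1
    · ext; ring
    · ring
  have h2 := h0.smul (((hasDerivAt_bessel_right S 2 x y).const_mul S).const_mul S)
  convert! h2 using 1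
  simp only [kernelYY, mul_smul_comm, smul_smul]
  module

/-- The difference of second derivatives is `x S² B₂ + (x (x² - y²) / 8) S³ B₃`, where `Bⱼ` is
`bessel S j (x² - y²)`; this is `(x/2) S²` times the left side of `bessel_rec` for `j = 1`. -/
lemma kernelXX_sub_kernelYY (S : 𝔸) (x y : ℝ) :
    kernelXX S x y - kernelYY S x y = S * kernel S x y := by
  have h := congrArg (fun A : 𝔸 => (x / 2) • (S * (S * A))) (bessel_rec S 1 (x ^ 2 - y ^ 2))
  simp only [mul_add, mul_smul_comm, Nat.cast_one, kernelXX, kernelYY, kernel] at h ⊢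
  rw [← h]
  module

lemma continuous_bessel_sq (S : 𝔸) (j : ℕ) :
    Continuous fun p : ℝ × ℝ => bessel S j (p.1 ^ 2 - p.2 ^ 2) :=
  (continuous_bessel S j).comp (by fun_prop)

lemma continuous_kernel (S : 𝔸) : Continuous fun p : ℝ × ℝ => kernel S p.1 p.2 := by
  unfold kernel
  exact (continuous_fst.div_const 2).smul (continuous_const.mul (continuous_bessel_sq S 1))

lemma continuous_kernelX (S : 𝔸) : Continuous fun p : ℝ × ℝ => kernelX S p.1 p.2 := by
  have h1 := continuous_bessel_sq S 1
  have h2 := continuous_bessel_sq S 2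
  unfold kernelX
  fun_prop

lemma continuous_kernelXX (S : 𝔸) : Continuous fun p : ℝ × ℝ => kernelXX S p.1 p.2 := by
  have h1 := continuous_bessel_sq S 2
  have h2 := continuous_bessel_sq S 3
  unfold kernelXX
  fun_prop

lemma continuous_kernelY (S : 𝔸) : Continuous fun p : ℝ × ℝ => kernelY S p.1 p.2 := by
  have h1 := continuous_bessel_sq S 2
  unfold kernelY
  fun_prop

lemma continuous_kernelYY (S : 𝔸) : Continuous fun p : ℝ × ℝ => kernelYY S p.1 p.2 := by
  have h1 := continuous_bessel_sq S 2
  have h2 := continuous_bessel_sq S 3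
  unfold kernelYY
  fun_prop

lemma contDiff_kernel (S : 𝔸) : ContDiff ℝ 2 fun p : ℝ × ℝ => kernel S p.1 p.2 := by
  have h : ContDiff ℝ 2 fun p : ℝ × ℝ => bessel S 1 (p.1 ^ 2 - p.2 ^ 2) :=
    (contDiff_bessel S 2 1).comp (by fun_prop)
  unfold kernel
  exact (contDiff_fst.div_const 2).smul (contDiff_const.mul h)

lemma kernel_diag (S : 𝔸) (x : ℝ) : kernel S x x = (x / 2) • S := by
  simp [kernel, bessel_zero_right]

lemma kernelX_diag (S : 𝔸) (x : ℝ) :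
    kernelX S x x = (1 / 2 : ℝ) • S + (x ^ 2 / 8) • (S * S) := by
  simp only [kernelX, sub_self, bessel_zero_right, Nat.factorial_one, Nat.factorial_two,
    mul_smul_comm, smul_smul, mul_one]
  norm_num
  congr 1; ring

lemma kernelY_diag (S : 𝔸) (x : ℝ) : kernelY S x x = (-(x ^ 2) / 8) • (S * S) := by
  simp only [kernelY, sub_self, bessel_zero_right, Nat.factorial_two,
    mul_smul_comm, smul_smul, mul_one]
  norm_num
  congr 1; ring

lemma kernelY_zero_right (S : 𝔸) (x : ℝ) : kernelY S x 0 = 0 := by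
  simp [kernelY]

lemma commute_kernel (S : 𝔸) (x y : ℝ) : Commute S (kernel S x y) := by
  unfold kernel
  exact ((Commute.refl S).mul_right (commute_bessel S 1 _)).smul_right _

end

/-! ### Parametric integrals and the Volterra transformation. -/

section

section ParametricIntegral

variable {E : Type*} [NormedAddCommGroup E] [NormedSpace ℝ E] [CompleteSpace E]

lemma hasDerivAt_integral_of_continuousOn {U : Set ℝ} (hU : IsOpen U) {a b : ℝ} (hab : a ≤ b)
    {F F' : ℝ → ℝ → E} (hF : ContinuousOn (fun p : ℝ × ℝ => F p.1 p.2) (U ×ˢ Icc a b))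
    (hF' : ContinuousOn (fun p : ℝ × ℝ => F' p.1 p.2) (U ×ˢ Icc a b))
    (h : ∀ x ∈ U, ∀ y ∈ Icc a b, HasDerivAt (fun x => F x y) (F' x y) x) {x₀ : ℝ} (hx₀ : x₀ ∈ U) :
    HasDerivAt (fun x => ∫ y in a..b, F x y) (∫ y in a..b, F' x₀ y) x₀ := by
  obtain ⟨r, hr, hrU⟩ := Metric.nhds_basis_closedBall.mem_iff.1 (hU.mem_nhds hx₀)
  obtain ⟨C, hC⟩ := ((isCompact_closedBall x₀ r).prod (isCompact_Icc (a := a) (b := b))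
    ).exists_bound_of_continuousOn (hF'.mono (prod_mono hrU Subset.rfl))
  have hcont : ∀ {G : ℝ → ℝ → E}, ContinuousOn (fun p : ℝ × ℝ => G p.1 p.2) (U ×ˢ Icc a b) →
      ∀ x ∈ U, ContinuousOn (G x) (Icc a b) := fun hG x hx =>
    hG.comp (f := fun y => (x, y)) (by fun_prop) fun y hy => ⟨hx, hy⟩
  have hmeas : ∀ {g : ℝ → E}, ContinuousOn g (Icc a b) →
      AEStronglyMeasurable g (volume.restrict (uIoc a b)) := fun hg => by
    rw [uIoc_of_le hab]
    exact (hg.mono Ioc_subset_Icc_self).aestronglyMeasurable measurableSet_Ioc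
  refine (intervalIntegral.hasDerivAt_integral_of_dominated_loc_of_deriv_le
    (s := Metric.closedBall x₀ r) (bound := fun _ => C) (Metric.closedBall_mem_nhds _ hr)
    ?_ ?_ (hmeas (hcont hF' x₀ hx₀)) ?_ intervalIntegrable_const ?_).2
  · filter_upwards [hU.mem_nhds hx₀] with x hx using hmeas (hcont hF x hx)
  · exact (hcont hF x₀ hx₀).intervalIntegrable_of_Icc hab
  · refine Eventually.of_forall fun y hy x hx => hC (x, y) ⟨hx, ?_⟩
    rw [uIoc_of_le hab] at hy
    exact Ioc_subset_Icc_self hy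
  · refine Eventually.of_forall fun y hy x hx => h x (hrU hx) y ?_
    rw [uIoc_of_le hab] at hy
    exact Ioc_subset_Icc_self hy

lemma hasDerivAt_clm_apply_const {A : ℝ → (E →L[ℝ] E)} {A' : E →L[ℝ] E} {x : ℝ}
    (h : HasDerivAt A A' x) (v : E) : HasDerivAt (fun x => A x v) (A' v) x := by
  simpa using h.clm_apply (hasDerivAt_const x v)

/-- The Leibniz rule for an integral whose upper limit is the parameter. -/
lemma hasDerivAt_integral_diag {k k' : ℝ → ℝ → E}
    (hk : Continuous fun p : ℝ × ℝ => k p.1 p.2) (hk' : Continuous fun p : ℝ × ℝ => k' p.1 p.2)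
    (h : ∀ x y, HasDerivAt (fun x => k x y) (k' x y) x) (x₀ : ℝ) :
    HasDerivAt (fun x => ∫ y in (0 : ℝ)..x, k x y) (k x₀ x₀ + ∫ y in (0 : ℝ)..x₀, k' x₀ y) x₀ := by
  have hint : ∀ x a b, IntervalIntegrable (k x) volume a b := fun x a b =>
    (hk.comp (by fun_prop : Continuous fun y => (x, y))).intervalIntegrable a b
  have h1 : HasDerivAt (fun x => ∫ y in (0 : ℝ)..x₀, k x y) (∫ y in (0 : ℝ)..x₀, k' x₀ y) x₀ := by
    rcases le_total 0 x₀ with h0 | h0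
    · exact hasDerivAt_integral_of_continuousOn isOpen_univ h0 hk.continuousOn hk'.continuousOn
        (fun x _ y _ => h x y) (mem_univ _)
    · simp_rw [intervalIntegral.integral_symm x₀ 0]
      exact (hasDerivAt_integral_of_continuousOn isOpen_univ h0 hk.continuousOn hk'.continuousOn
        (fun x _ y _ => h x y) (mem_univ _)).neg
  have h2 : HasDerivAt (fun x => ∫ y in x₀..x, k x y) (k x₀ x₀) x₀ := by
    -- The integrand also varies with `x`, so the increment is written as `x - x₀` times an average
    -- over `[0,1]` that is continuous in `x`; the slope then tends to the average at `x₀`.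
    have heq : ∀ x, ∫ y in x₀..x, k x y = (x - x₀) • ∫ θ in (0 : ℝ)..1, k x (x₀ + (x - x₀) * θ) := by
      intro x
      rw [intervalIntegral.smul_integral_comp_add_mul]
      simp
    have hq : Continuous fun x => ∫ θ in (0 : ℝ)..1, k x (x₀ + (x - x₀) * θ) := by
      apply intervalIntegral.continuous_parametric_intervalIntegral_of_continuous'
      exact hk.comp (by fun_prop : Continuous fun p : ℝ × ℝ => (p.1, x₀ + (p.1 - x₀) * p.2))
    rw [hasDerivAt_iff_tendsto_slope]
    have hlim : Tendsto (fun x => ∫ θ in (0 : ℝ)..1, k x (x₀ + (x - x₀) * θ)) (𝓝[≠] x₀)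
        (𝓝 (k x₀ x₀)) := by
      have := (hq.tendsto x₀).mono_left (nhdsWithin_le_nhds (s := {x₀}ᶜ))
      simpa using this
    refine hlim.congr' ?_
    filter_upwards [self_mem_nhdsWithin] with x hx
    have hx' : x - x₀ ≠ 0 := sub_ne_zero.2 hx
    simp only [slope, vsub_eq_sub, intervalIntegral.integral_same, sub_zero]
    rw [heq, smul_smul, inv_mul_cancel₀ hx', one_smul]
  convert! h2.add h1 using 1
  ext x
  rw [Pi.add_apply, add_comm, intervalIntegral.integral_add_adjacent_intervals (hint _ _ _) (hint _ _ _)]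

end ParametricIntegral

variable {E : Type*} [NormedAddCommGroup E] [NormedSpace ℝ E]

/-- `f` is twice continuously differentiable with derivatives `f'` and `f''`, and `f' 0 = 0`. -/
structure IsNeumannC2 (f f' f'' : ℝ → E) : Prop where
  hasDerivAt : ∀ x, HasDerivAt f (f' x) x
  hasDerivAt' : ∀ x, HasDerivAt f' (f'' x) x
  continuous'' : Continuous f''
  zero : f' 0 = 0

namespace IsNeumannC2

variable {f f' f'' : ℝ → E}

lemma continuous (h : IsNeumannC2 f f' f'') : Continuous f :=
  continuous_iff_continuousAt.2 fun x => (h.hasDerivAt x).continuousAt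

lemma continuous' (h : IsNeumannC2 f f' f'') : Continuous f' :=
  continuous_iff_continuousAt.2 fun x => (h.hasDerivAt' x).continuousAt

end IsNeumannC2

variable [CompleteSpace E] [Nontrivial E]

/-- The Volterra transformation of the second kind with the kernel `kernel S`. -/
def transform (S : E →L[ℝ] E) (f : ℝ → E) (x : ℝ) : E :=
  f x + ∫ y in (0 : ℝ)..x, kernel S x y (f y)

lemma continuous_transform (S : E →L[ℝ] E) {X : Type*} [TopologicalSpace X] {f : X → ℝ → E}
    (hf : Continuous fun p : X × ℝ => f p.1 p.2) :
    Continuous fun p : X × ℝ => transform S (f p.1) p.2 := by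
  unfold transform
  refine hf.add ?_
  refine intervalIntegral.continuous_parametric_intervalIntegral_of_continuous
    (f := fun (p : X × ℝ) y => kernel S p.2 y (f p.1 y)) ?_ continuous_snd
  exact ((continuous_kernel S).comp
      (by fun_prop : Continuous fun q : (X × ℝ) × ℝ => (q.1.2, q.2))).clm_apply
    (hf.comp (by fun_prop : Continuous fun q : (X × ℝ) × ℝ => (q.1.1, q.2)))

lemma continuous_transform_apply (S : E →L[ℝ] E) {f : ℝ → E} (hf : Continuous f) :
    Continuous (transform S f) :=
  (continuous_transform S (X := Unit) (f := fun _ => f) (hf.comp continuous_snd)).comp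
    (by fun_prop : Continuous fun x : ℝ => ((), x))

/-- The derivative of `transform S f`, where `f'` is the derivative of `f`. -/
def transformDeriv (S : E →L[ℝ] E) (f f' : ℝ → E) (x : ℝ) : E :=
  f' x + (kernel S x x (f x) + ∫ y in (0 : ℝ)..x, kernelX S x y (f y))

lemma hasDerivAt_transform (S : E →L[ℝ] E) {f f' : ℝ → E} (hf : ∀ x, HasDerivAt f (f' x) x)
    (x : ℝ) : HasDerivAt (transform S f) (transformDeriv S f f' x) x := by
  have hc : Continuous f := continuous_iff_continuousAt.2 fun x => (hf x).continuousAt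
  refine (hf x).add (hasDerivAt_integral_diag (k := fun x y => kernel S x y (f y))
    (k' := fun x y => kernelX S x y (f y)) ((continuous_kernel S).clm_apply (by fun_prop))
    ((continuous_kernelX S).clm_apply (by fun_prop)) (fun x y => ?_) x)
  exact hasDerivAt_clm_apply_const (hasDerivAt_kernel_left S x y) (f y)

/-- The intertwining relation `(T f)'' = T (f'' + S f)`. Two integrations by parts in `y` compare `∫
k f''` with `∫ k_yy f`. The boundary terms at `y = 0` vanish by `f'(0) = 0` and `k_y(x,0) = 0`;
those at `y = x` leave `S f(x)`, half of it from the derivative of `k(x,x) = (x/2) S` and half from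
`k_x + k_y = S/2` on the diagonal. -/
lemma isNeumannC2_transform (S : E →L[ℝ] E) {f f' f'' : ℝ → E} (h : IsNeumannC2 f f' f'') :
    IsNeumannC2 (transform S f) (transformDeriv S f f')
      (transform S fun x => f'' x + S (f x)) := by
  have hc := h.continuous
  have hc' := h.continuous'
  have hc'' := h.continuous''
  refine ⟨hasDerivAt_transform S h.hasDerivAt, fun x => ?_,
    continuous_transform_apply S (by fun_prop), by simp [transformDeriv, h.zero, kernel]⟩
  have cK : ∀ {k : ℝ → ℝ → (E →L[ℝ] E)} (_ : Continuous fun p : ℝ × ℝ => k p.1 p.2) {g : ℝ → E}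
      (_ : Continuous g), Continuous fun y => k x y (g y) := fun hk g hg =>
    (hk.comp (by fun_prop : Continuous fun y : ℝ => (x, y))).clm_apply hg
  have h1 : HasDerivAt (fun x => kernel S x x (f x))
      ((1 / 2 : ℝ) • S (f x) + (x / 2) • S (f' x)) x := by
    have := (((hasDerivAt_id' x).div_const 2).smul_const S).clm_apply (h.hasDerivAt x)
    simp_rw [kernel_diag]
    simpa using this
  have h2 := hasDerivAt_integral_diag (k := fun x y => kernelX S x y (f y))
    (k' := fun x y => kernelXX S x y (f y)) ((continuous_kernelX S).clm_apply (by fun_prop))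
    ((continuous_kernelXX S).clm_apply (by fun_prop))
    (fun x y => hasDerivAt_clm_apply_const (hasDerivAt_kernelX S x y) (f y)) x
  convert! (h.hasDerivAt' x).add (h1.add h2) using 1
  have p1 : ∫ y in (0 : ℝ)..x, (kernelY S x y (f' y) + kernel S x y (f'' y))
      = kernel S x x (f' x) - kernel S x 0 (f' 0) := by
    refine intervalIntegral.integral_eq_sub_of_hasDerivAt
      (f := fun y => kernel S x y (f' y)) (fun y _ => ?_) ?_
    · exact (hasDerivAt_kernel_right S x y).clm_apply (h.hasDerivAt' y)
    · exact ((cK (continuous_kernelY S) hc').add (cK (continuous_kernel S) hc'')).intervalIntegrable _ _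
  have p2 : ∫ y in (0 : ℝ)..x, (kernelYY S x y (f y) + kernelY S x y (f' y))
      = kernelY S x x (f x) - kernelY S x 0 (f 0) := by
    refine intervalIntegral.integral_eq_sub_of_hasDerivAt
      (f := fun y => kernelY S x y (f y)) (fun y _ => ?_) ?_
    · exact (hasDerivAt_kernelY S x y).clm_apply (h.hasDerivAt y)
    · exact ((cK (continuous_kernelYY S) hc).add (cK (continuous_kernelY S) hc')).intervalIntegrable _ _
  rw [intervalIntegral.integral_add ((cK (continuous_kernelY S) hc').intervalIntegrable _ _)
    ((cK (continuous_kernel S) hc'').intervalIntegrable _ _)] at p1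
  rw [intervalIntegral.integral_add ((cK (continuous_kernelYY S) hc).intervalIntegrable _ _)
    ((cK (continuous_kernelY S) hc').intervalIntegrable _ _)] at p2
  -- The wave equation gives `S k`, while `T (S f)` contains `k S`; they agree since `k` is a power
  -- series in `S`.
  have p3 : ∫ y in (0 : ℝ)..x, kernelXX S x y (f y) =
      (∫ y in (0 : ℝ)..x, kernelYY S x y (f y)) + ∫ y in (0 : ℝ)..x, kernel S x y (S (f y)) := by
    rw [← intervalIntegral.integral_add ((cK (continuous_kernelYY S) hc).intervalIntegrable _ _)
      ((cK (continuous_kernel S) (by fun_prop)).intervalIntegrable _ _)]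
    congr 1
    ext y
    have e1 := congrArg (fun A : E →L[ℝ] E => A (f y)) (kernelXX_sub_kernelYY S x y)
    rw [(commute_kernel S x y).eq] at e1
    simp only [sub_apply, mul_apply_eq_comp] at e1
    rw [← e1]; abel
  have p4 : ∫ y in (0 : ℝ)..x, kernel S x y (f'' y + S (f y)) =
      (∫ y in (0 : ℝ)..x, kernel S x y (f'' y)) + ∫ y in (0 : ℝ)..x, kernel S x y (S (f y)) := by
    rw [← intervalIntegral.integral_add ((cK (continuous_kernel S) hc'').intervalIntegrable _ _)
      ((cK (continuous_kernel S) (by fun_prop)).intervalIntegrable _ _)]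
    simp only [map_add]
  rw [h.zero, map_zero, sub_zero, kernel_diag, ← eq_sub_iff_add_eq'] at p1
  rw [kernelY_zero_right, kernelY_diag, zero_apply, sub_zero,
    ← eq_sub_iff_add_eq'] at p2
  simp only [transform]
  rw [p4, p1, p2, p3, kernelX_diag]
  simp only [smul_apply, add_apply,
    mul_apply_eq_comp]
  generalize (∫ y in (0 : ℝ)..x, kernel S x y (S (f y))) = I1
  generalize (∫ y in (0 : ℝ)..x, kernelYY S x y (f y)) = I2
  module

end

/-! ### The cosine basis of `L²(0,1)`. -/

section

open Real in
/-- The frequencies of the eigenfunctions `cos ((n + 1/2) π x)`. -/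
def freq (n : ℕ) : ℝ := (n + 1 / 2) * π

lemma freq_pos (n : ℕ) : 0 < freq n := by unfold freq; positivity

lemma cos_freq (n : ℕ) : Real.cos (freq n) = 0 := by
  rw [Real.cos_eq_zero_iff]
  exact ⟨n, by simp [freq]; ring⟩

open Real in
lemma integral_cos_freq_mul_cos_freq (n m : ℕ) :
    ∫ x in (0 : ℝ)..1, cos (freq n * x) * cos (freq m * x) = if n = m then 1 / 2 else 0 := by
  -- Sums and differences of two half-integer frequencies are integer multiples of `π`, and the sum
  -- is never zero.
  have key : ∀ k : ℤ, ∫ x in (0 : ℝ)..1, cos (k * π * x) = if k = 0 then 1 else 0 := by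
    intro k
    split_ifs with h
    · simp [h]
    · have hk : (k : ℝ) * π ≠ 0 := mul_ne_zero (by exact_mod_cast h) pi_ne_zero
      rw [intervalIntegral.integral_comp_mul_left _ hk]
      simp [integral_cos, Real.sin_int_mul_pi]
  have h1 : ∀ x, cos (freq n * x) * cos (freq m * x)
      = 1 / 2 * cos (((n : ℤ) - (m : ℤ) : ℤ) * π * x) + 1 / 2 * cos (((n : ℤ) + m + 1 : ℤ) * π * x) := by
    intro x
    have e1 : (((n : ℤ) - (m : ℤ) : ℤ) : ℝ) * π * x = freq n * x - freq m * x := by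
      unfold freq; push_cast; ring
    have e2 : (((n : ℤ) + m + 1 : ℤ) : ℝ) * π * x = freq n * x + freq m * x := by
      unfold freq; push_cast; ring
    rw [e1, e2, cos_sub, cos_add]; ring
  simp_rw [h1]
  rw [intervalIntegral.integral_add, intervalIntegral.integral_const_mul,
    intervalIntegral.integral_const_mul, key, key, if_neg (show ¬ ((n : ℤ) + m + 1 = 0) by omega)]
  · by_cases h : n = m
    · simp [h]
    · rw [if_neg h, if_neg (by omega)]; simp
  · exact (by fun_prop : Continuous _).intervalIntegrable _ _
  · exact (by fun_prop : Continuous _).intervalIntegrable _ _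

lemma integral_unitMeasure {E : Type*} [NormedAddCommGroup E] [NormedSpace ℝ E] (f : ℝ → E) :
    ∫ x, f x ∂unitMeasure = ∫ x in (0 : ℝ)..1, f x := by
  rw [intervalIntegral.integral_of_le zero_le_one, integral_Ioc_eq_integral_Ioo]

/-- Total mass one makes the `L¹` norm at most the `L²` norm, so no extra constants enter the
estimates. -/
instance : IsProbabilityMeasure unitMeasure := ⟨by simp [unitMeasure]⟩

variable {E : Type*} [NormedAddCommGroup E] [InnerProductSpace ℝ E] [FiniteDimensional ℝ E]

/-- The coefficient of `f` with respect to `cos ((n + 1/2) π x)`. -/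
def coeff (n : ℕ) (f : ℝ → E) : E := ∫ x, Real.cos (freq n * x) • f x ∂unitMeasure

lemma integrable_bdd_smul {f : ℝ → E} (hf : Integrable f unitMeasure) {g : ℝ → ℝ}
    (hg : Continuous g) {C : ℝ} (hC : ∀ x ∈ Ioo (0 : ℝ) 1, |g x| ≤ C) :
    Integrable (fun x => g x • f x) unitMeasure := by
  refine hf.bdd_smul C hg.aestronglyMeasurable ?_
  exact (ae_restrict_iff' measurableSet_Ioo).2 (Eventually.of_forall hC)

lemma integrable_cos_smul {f : ℝ → E} (hf : Integrable f unitMeasure) (a : ℝ) :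
    Integrable (fun x => Real.cos (a * x) • f x) unitMeasure :=
  integrable_bdd_smul hf (by fun_prop) fun _ _ => Real.abs_cos_le_one _

lemma coeff_congr_ae {n : ℕ} {f g : ℝ → E} (h : f =ᵐ[unitMeasure] g) : coeff n f = coeff n g :=
  integral_congr_ae <| by filter_upwards [h] with x hx using by rw [hx]

lemma coeff_sub {n : ℕ} {f g : ℝ → E} (hf : Integrable f unitMeasure)
    (hg : Integrable g unitMeasure) : coeff n (fun x => f x - g x) = coeff n f - coeff n g := by
  unfold coeff
  simp_rw [smul_sub]
  exact integral_sub (integrable_cos_smul hf _) (integrable_cos_smul hg _)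

lemma norm_coeff_le {n : ℕ} {f : ℝ → E} (hf : MemLp f 2 unitMeasure) :
    ‖coeff n f‖ ≤ (eLpNorm f 2 unitMeasure).toReal := by
  have h1 : ‖coeff n f‖ ≤ ∫ x, ‖f x‖ ∂unitMeasure := by
    refine norm_integral_le_of_norm_le (hf.integrable one_le_two).norm (Eventually.of_forall fun x => ?_)
    rw [norm_smul]
    exact mul_le_of_le_one_left (norm_nonneg _) (Real.abs_cos_le_one _)
  refine h1.trans ?_
  rw [integral_norm_eq_lintegral_enorm hf.1, ← eLpNorm_one_eq_lintegral_enorm]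
  exact ENNReal.toReal_mono hf.2.ne (eLpNorm_le_eLpNorm_of_exponent_le one_le_two hf.1)

open Real in
/-- A function whose coefficients with respect to all the `cos ((n + 1/2) π x)` vanish is zero. -/
lemma ae_eq_zero_of_coeff_eq_zero {f : ℝ → E} (hf : Integrable f unitMeasure)
    (h : ∀ n, coeff n f = 0) : f =ᵐ[unitMeasure] 0 := by
  have h1 : ∀ k n : ℕ, ∫ x, (cos (π * x) ^ k * cos (freq n * x)) • f x ∂unitMeasure = 0 := by
    intro k
    have hint : ∀ k n : ℕ, Integrable (fun x => (cos (π * x) ^ k * cos (freq n * x)) • f x)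
        unitMeasure := fun k n => integrable_bdd_smul hf (by fun_prop) (C := 1) fun x _ => by
      rw [abs_mul, abs_pow]
      exact mul_le_one₀ (pow_le_one₀ (abs_nonneg _) (abs_cos_le_one _)) (abs_nonneg _)
        (abs_cos_le_one _)
    induction k with
    | zero => intro n; simpa [coeff] using h n
    | succ k ih =>
      -- The product formula `2 cos (π x) cos (μₙ x) = cos (μₙ₊₁ x) + cos (μₙ₋₁ x)` trades a power
      -- of `cos (π x)` for neighbouring frequencies. Here `m` is `n - 1`, except that for `n = 0`
      -- it is again `0`, because `cos (-π x / 2) = cos (π x / 2)`.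
      have aux : ∀ n m : ℕ, (∀ x, cos (π * x) * cos (freq n * x) =
          1 / 2 * cos (freq (n + 1) * x) + 1 / 2 * cos (freq m * x)) →
          ∫ x, (cos (π * x) ^ (k + 1) * cos (freq n * x)) • f x ∂unitMeasure = 0 := by
        intro n m hm
        have : ∀ x, (cos (π * x) ^ (k + 1) * cos (freq n * x)) • f x =
            (1 / 2 : ℝ) • ((cos (π * x) ^ k * cos (freq (n + 1) * x)) • f x)
            + (1 / 2 : ℝ) • ((cos (π * x) ^ k * cos (freq m * x)) • f x) := by
          intro x
          rw [pow_succ, mul_assoc, hm, smul_smul, smul_smul, ← add_smul]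
          congr 1; ring
        simp_rw [this]
        have e := integral_add ((hint k (n + 1)).smul (1 / 2 : ℝ)) ((hint k m).smul (1 / 2 : ℝ))
        simp only [Pi.smul_apply] at e
        rw [e, integral_smul, integral_smul, ih, ih]
        simp
      intro n
      rcases n with _ | n
      · refine aux 0 0 fun x => ?_
        have e1 : freq (0 + 1) * x = π * x + freq 0 * x := by simp [freq]; ring
        have e2 : freq 0 * x = π * x - freq 0 * x := by simp [freq]; ring
        have e3 : cos (freq 0 * x) =
            cos (π * x) * cos (freq 0 * x) + sin (π * x) * sin (freq 0 * x) := by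
          rw [← cos_sub, ← e2]
        rw [e1, cos_add]
        linear_combination (-1 / 2) * e3
      · refine aux (n + 1) n fun x => ?_
        have e1 : freq (n + 1 + 1) * x = freq (n + 1) * x + π * x := by simp [freq]; ring
        have e2 : freq n * x = freq (n + 1) * x - π * x := by simp [freq]; ring
        rw [e1, e2, cos_add, cos_sub]; ring
  have h2 : ∀ p : Polynomial ℝ,
      ∫ x, (p.eval (cos (π * x)) * cos (freq 0 * x)) • f x ∂unitMeasure = 0 := by
    intro p
    simp_rw [Polynomial.eval_eq_sum_range, Finset.sum_mul, Finset.sum_smul]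
    rw [integral_finsetSum]
    · refine Finset.sum_eq_zero fun i _ => ?_
      simp_rw [mul_assoc, mul_smul (p.coeff i)]
      rw [integral_smul, h1, smul_zero]
    · intro i _
      simp_rw [mul_assoc, mul_smul (p.coeff i)]
      refine (integrable_bdd_smul hf (g := fun x => cos (π * x) ^ i * cos (freq 0 * x))
        (by fun_prop) (C := 1) fun x _ => ?_).smul (p.coeff i)
      rw [abs_mul, abs_pow]
      exact mul_le_one₀ (pow_le_one₀ (abs_nonneg _) (abs_cos_le_one _)) (abs_nonneg _)
        (abs_cos_le_one _)
  have hg : Integrable (fun x => cos (freq 0 * x) • f x) unitMeasure := integrable_cos_smul hf _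
  have h3 : ∀ φ : ℝ → ℝ, Continuous φ → ∫ x, φ x • cos (freq 0 * x) • f x ∂unitMeasure = 0 := by
    intro φ hφ
    obtain ⟨D, hD⟩ := isCompact_Icc.exists_bound_of_continuousOn (s := Icc (0 : ℝ) 1) hφ.continuousOn
    have hφi : Integrable (fun x => φ x • cos (freq 0 * x) • f x) unitMeasure :=
      integrable_bdd_smul hg hφ fun x hx => hD x (Ioo_subset_Icc_self hx)
    set M := ∫ x, ‖f x‖ ∂unitMeasure
    have hM : 0 ≤ M := integral_nonneg fun _ => norm_nonneg _
    rw [← norm_le_zero_iff]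
    refine le_of_forall_pos_le_add fun ε hε => ?_
    -- Weierstrass in the variable `u = cos (π x)`, which maps `[0,1]` bijectively onto `[-1,1]`:
    -- every continuous `φ` is a uniform limit of polynomials in `cos (π x)`. The denominator `M +
    -- 1` avoids division by zero.
    obtain ⟨p, hp⟩ := exists_polynomial_near_of_continuousOn (-1) 1 (fun u => φ (arccos u / π))
      (by fun_prop) (ε / (M + 1)) (by positivity)
    have hpφ : ∀ x ∈ Ioo (0 : ℝ) 1, |p.eval (cos (π * x)) - φ x| ≤ ε / (M + 1) := by
      intro x hx
      have := (hp (cos (π * x)) ⟨neg_one_le_cos _, cos_le_one _⟩).le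
      rwa [arccos_cos (by have := hx.1; positivity) (by nlinarith [hx.2, pi_pos]),
        mul_div_cancel_left₀ _ pi_ne_zero] at this
    have hpi : Integrable (fun x => (p.eval (cos (π * x))) • cos (freq 0 * x) • f x) unitMeasure := by
      obtain ⟨D', hD'⟩ := isCompact_Icc.exists_bound_of_continuousOn (s := Icc (0 : ℝ) 1)
        (f := fun x => p.eval (cos (π * x))) (by fun_prop)
      exact integrable_bdd_smul hg (by fun_prop) fun x hx => hD' x (Ioo_subset_Icc_self hx)
    have h4 := h2 p
    simp_rw [mul_smul] at h4
    rw [zero_add, ← norm_neg, ← zero_sub, ← h4, ← integral_sub hpi hφi]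
    calc ‖∫ x, ((p.eval (cos (π * x))) • cos (freq 0 * x) • f x - φ x • cos (freq 0 * x) • f x)
          ∂unitMeasure‖ ≤ ∫ x, ε / (M + 1) * ‖f x‖ ∂unitMeasure := by
          refine norm_integral_le_of_norm_le ((hf.norm).const_mul _) ?_
          refine (ae_restrict_iff' measurableSet_Ioo).2 (Eventually.of_forall fun x hx => ?_)
          rw [← sub_smul, norm_smul, norm_smul]
          refine mul_le_mul (hpφ x hx) ?_ (by positivity) (by positivity)
          exact mul_le_of_le_one_left (norm_nonneg _) (abs_cos_le_one _)
      _ = ε / (M + 1) * M := integral_const_mul _ _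
      _ ≤ ε := by
          rw [div_mul_eq_mul_div, div_le_iff₀ (by positivity)]
          nlinarith
  have h4 : ∀ᵐ x ∂unitMeasure, cos (freq 0 * x) • f x = 0 :=
    ae_eq_zero_of_integral_contDiff_smul_eq_zero hg.locallyIntegrable
      fun φ hφ _ => h3 φ hφ.continuous
  -- The weight `cos (π x / 2)` has no zero in `(0,1)` and can be cancelled.
  filter_upwards [h4, ae_restrict_mem measurableSet_Ioo] with x hx hx1
  refine (smul_eq_zero.1 hx).resolve_left (cos_pos_of_mem_Ioo ⟨?_, ?_⟩).ne'
  · have := hx1.1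
    have h5 : 0 < freq 0 * x := mul_pos (freq_pos 0) this
    linarith [pi_pos]
  · have := hx1.2
    simp only [freq, Nat.cast_zero, zero_add]
    nlinarith [pi_pos]

variable (E) in
/-- The normalized eigenfunctions `√2 cos ((n + 1/2) π x) eᵢ`. -/
def mode (k : ℕ × Fin (Module.finrank ℝ E)) (x : ℝ) : E :=
  (√2 * Real.cos (freq k.1 * x)) • stdOrthonormalBasis ℝ E k.2

lemma continuous_mode (k : ℕ × Fin (Module.finrank ℝ E)) : Continuous (mode E k) := by
  unfold mode; fun_prop

lemma memLp_of_continuousOn {f : ℝ → E} (hf : ContinuousOn f (Icc 0 1)) :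
    MemLp f 2 unitMeasure := by
  obtain ⟨C, hC⟩ := isCompact_Icc.exists_bound_of_continuousOn hf
  refine MemLp.of_bound ((hf.mono Ioo_subset_Icc_self).aestronglyMeasurable measurableSet_Ioo) C ?_
  exact (ae_restrict_iff' measurableSet_Ioo).2
    (Eventually.of_forall fun x hx => hC x (Ioo_subset_Icc_self hx))

variable (E) in
/-- The eigenfunctions as elements of `L²`. -/
def modeLp (k : ℕ × Fin (Module.finrank ℝ E)) : Lp E 2 unitMeasure :=
  (memLp_of_continuousOn (continuous_mode k).continuousOn).toLp (mode E k)

lemma inner_modeLp (k : ℕ × Fin (Module.finrank ℝ E)) {f : ℝ → E} (hf : MemLp f 2 unitMeasure) :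
    inner ℝ (modeLp E k) (hf.toLp f) = √2 * inner ℝ (stdOrthonormalBasis ℝ E k.2) (coeff k.1 f) := by
  unfold coeff
  rw [L2.inner_def, ← integral_inner (integrable_cos_smul (hf.integrable one_le_two) _),
    ← integral_const_mul]
  refine integral_congr_ae ?_
  filter_upwards [hf.coeFn_toLp,
    (memLp_of_continuousOn (continuous_mode k).continuousOn).coeFn_toLp] with x h1 h2
  rw [modeLp, h1, h2, mode, inner_smul_left, inner_smul_right]
  simp; ring

lemma coeff_mode (n : ℕ) (k : ℕ × Fin (Module.finrank ℝ E)) :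
    coeff n (mode E k) = if n = k.1 then (√2 / 2) • stdOrthonormalBasis ℝ E k.2 else 0 := by
  have : ∀ x, Real.cos (freq n * x) • mode E k x =
      (√2 * (Real.cos (freq n * x) * Real.cos (freq k.1 * x))) • stdOrthonormalBasis ℝ E k.2 := by
    intro x; rw [mode, smul_smul]; congr 1; ring
  unfold coeff
  simp_rw [this]
  rw [integral_unitMeasure, intervalIntegral.integral_smul_const,
    intervalIntegral.integral_const_mul, integral_cos_freq_mul_cos_freq]
  split_ifs
  · congr 1; ring
  · simp

lemma orthonormal_modeLp : Orthonormal ℝ (modeLp E) := by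
  rw [orthonormal_iff_ite]
  rintro ⟨n, i⟩ ⟨m, j⟩
  rw [modeLp, ← modeLp, modeLp.eq_def (E := E) (m, j), inner_modeLp, coeff_mode]
  have h := orthonormal_iff_ite.1 (stdOrthonormalBasis ℝ E).orthonormal i j
  by_cases hnm : n = m
  · simp only [hnm, if_true, inner_smul_right, h, Prod.mk.injEq, true_and]
    rw [← mul_assoc, mul_div_assoc', Real.mul_self_sqrt (by norm_num)]
    norm_num
  · simp [hnm]

variable (E) in
/-- The Hilbert basis of `L²((0,1); E)` that consists of the eigenfunctions. -/
def modeBasis : HilbertBasis (ℕ × Fin (Module.finrank ℝ E)) ℝ (Lp E 2 unitMeasure) :=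
  HilbertBasis.mkOfOrthogonalEqBot orthonormal_modeLp <| by
    rw [Submodule.eq_bot_iff]
    intro f hf
    rw [Submodule.mem_orthogonal] at hf
    have hf1 : ∀ k, inner ℝ (modeLp E k) f = 0 := fun k => hf _ (Submodule.subset_span ⟨k, rfl⟩)
    have hc : ∀ n, coeff n f = 0 := by
      intro n
      refine InnerProductSpace.ext_inner_left_basis (stdOrthonormalBasis ℝ E).toBasis fun i => ?_
      have := hf1 (n, i)
      rw [← Lp.toLp_coeFn f (Lp.memLp f), inner_modeLp] at this
      simpa using this
    have := ae_eq_zero_of_coeff_eq_zero ((Lp.memLp f).integrable one_le_two) hc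
    exact (Lp.eq_zero_iff_ae_eq_zero).2 this

/-- Parseval, with the basis vectors of `E` summed for each frequency. The factor `2` is the inverse
of `∫ cos² = 1/2`. -/
lemma hasSum_norm_coeff_sq {f : ℝ → E} (hf : MemLp f 2 unitMeasure) :
    HasSum (fun n => 2 * ‖coeff n f‖ ^ 2) ((eLpNorm f 2 unitMeasure).toReal ^ 2) := by
  have h := (modeBasis E).hasSum_inner_mul_inner (hf.toLp f) (hf.toLp f)
  have hb : ∀ k, modeBasis E k = modeLp E k := fun k => by simp [modeBasis]
  have h2 : ∀ n : ℕ, HasSum (fun i => inner ℝ (hf.toLp f) (modeBasis E (n, i)) *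
      inner ℝ (modeBasis E (n, i)) (hf.toLp f)) (2 * ‖coeff n f‖ ^ 2) := by
    intro n
    convert! hasSum_fintype _ using 1
    rw [← (stdOrthonormalBasis ℝ E).sum_sq_norm_inner_right (coeff n f), Finset.mul_sum]
    refine Finset.sum_congr rfl fun i _ => ?_
    rw [real_inner_comm (modeBasis E (n, i)), hb, inner_modeLp, real_inner_comm (coeff n f), mul_mul_mul_comm, Real.mul_self_sqrt (by norm_num),
      Real.norm_eq_abs, sq_abs, sq]
  convert! h.prod_fiberwise h2 using 1
  rw [real_inner_self_eq_norm_sq, Lp.norm_toLp]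

/-- By Parseval, a multiplier on the cosine coefficients acts in `L²` with norm at most its
supremum; this converts decay of coefficients into decay of the norm. -/
lemma eLpNorm_le_of_coeff {f g : ℝ → E} (hf : MemLp f 2 unitMeasure) (hg : MemLp g 2 unitMeasure)
    {a : ℕ → ℝ} {C : ℝ} (hC : 0 ≤ C) (ha : ∀ n, |a n| ≤ C)
    (h : ∀ n, coeff n f = a n • coeff n g) :
    eLpNorm f 2 unitMeasure ≤ ENNReal.ofReal C * eLpNorm g 2 unitMeasure := by
  rw [← ENNReal.ofReal_toReal hf.2.ne, ← ENNReal.ofReal_toReal hg.2.ne, ← ENNReal.ofReal_mul hC]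
  apply ENNReal.ofReal_le_ofReal
  refine (pow_le_pow_iff_left₀ (by positivity) (by positivity) two_ne_zero).1 ?_
  rw [mul_pow]
  refine hasSum_le (fun n => ?_) (hasSum_norm_coeff_sq hf) ((hasSum_norm_coeff_sq hg).mul_left (C ^ 2))
  rw [h, norm_smul, mul_pow, Real.norm_eq_abs]
  have := pow_le_pow_left₀ (abs_nonneg _) (ha n) 2
  nlinarith [mul_le_mul_of_nonneg_right this (sq_nonneg ‖coeff n g‖)]

lemma ae_eq_of_coeff_eq {f g : ℝ → E} (hf : Integrable f unitMeasure)
    (hg : Integrable g unitMeasure) (h : ∀ n, coeff n f = coeff n g) : f =ᵐ[unitMeasure] g := by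
  have := ae_eq_zero_of_coeff_eq_zero (f := fun x => f x - g x) (hf.sub hg) fun n => by
    rw [coeff_sub hf hg, h, sub_self]
  filter_upwards [this] with x hx using sub_eq_zero.1 hx

/-- Dominated convergence in the Parseval sum: each multiplier tends to `1`, and the terms of `g`
itself dominate. -/
lemma tendsto_eLpNorm_sub_of_coeff {ι : Type*} {l : Filter ι} {f : ι → ℝ → E} {g : ℝ → E}
    (hf : ∀ᶠ t in l, MemLp (f t) 2 unitMeasure) (hg : MemLp g 2 unitMeasure) {a : ι → ℕ → ℝ}
    (ha : ∀ᶠ t in l, ∀ n, |a t n - 1| ≤ 1) (ha' : ∀ n, Tendsto (fun t => a t n) l (𝓝 1))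
    (h : ∀ᶠ t in l, ∀ n, coeff n (f t) = a t n • coeff n g) :
    Tendsto (fun t => eLpNorm (fun x => f t x - g x) 2 unitMeasure) l (𝓝 0) := by
  have hsum := hasSum_norm_coeff_sq hg
  have h1 : Tendsto (fun t => ∑' n, (a t n - 1) ^ 2 * (2 * ‖coeff n g‖ ^ 2)) l
      (𝓝 (∑' n : ℕ, (0 : ℝ))) := by
    refine tendsto_tsum_of_dominated_convergence hsum.summable (fun n => ?_) ?_
    · have := (((ha' n).sub_const 1).pow 2).mul_const (2 * ‖coeff n g‖ ^ 2)
      simpa using this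
    · filter_upwards [ha] with t ht n
      rw [norm_mul, norm_pow, Real.norm_eq_abs, Real.norm_of_nonneg (by positivity)]
      exact mul_le_of_le_one_left (by positivity) (pow_le_one₀ (abs_nonneg _) (ht n))
  rw [tsum_zero] at h1
  have h2 : Tendsto (fun t => ENNReal.ofReal
      √(∑' n, (a t n - 1) ^ 2 * (2 * ‖coeff n g‖ ^ 2))) l (𝓝 0) := by
    have := ENNReal.tendsto_ofReal ((Real.continuous_sqrt.tendsto 0).comp h1)
    simpa using this
  refine h2.congr' ?_
  filter_upwards [hf, h] with t hft ht
  have hs := hasSum_norm_coeff_sq (hft.sub hg)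
  have : ∀ n, (a t n - 1) ^ 2 * (2 * ‖coeff n g‖ ^ 2) = 2 * ‖coeff n (f t - g)‖ ^ 2 := by
    intro n
    have e : coeff n (f t - g) = (a t n - 1) • coeff n g := by
      rw [sub_smul, one_smul, ← ht]
      exact coeff_sub (hft.integrable one_le_two) (hg.integrable one_le_two)
    rw [e, norm_smul, mul_pow, Real.norm_eq_abs, sq_abs]; ring
  simp_rw [this]
  rw [hs.tsum_eq, Real.sqrt_sq ENNReal.toReal_nonneg, ENNReal.ofReal_toReal (hft.sub hg).2.ne]
  rfl

end

/-! ### The transformation on `L²` and its inverse. -/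

section

variable {E : Type*} [NormedAddCommGroup E] [InnerProductSpace ℝ E] [FiniteDimensional ℝ E]
  [Nontrivial E]

lemma ae_unitMeasure_of_forall {p : ℝ → Prop} (h : ∀ x ∈ Icc (0 : ℝ) 1, p x) :
    ∀ᵐ x ∂unitMeasure, p x :=
  (ae_restrict_iff' measurableSet_Ioo).2 (Eventually.of_forall fun x hx => h x (Ioo_subset_Icc_self hx))

lemma eqOn_Icc_of_ae_eq_unitMeasure {f g : ℝ → E} (h : f =ᵐ[unitMeasure] g)
    (hf : ContinuousOn f (Icc 0 1)) (hg : ContinuousOn g (Icc 0 1)) : EqOn f g (Icc 0 1) := by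
  refine Measure.eqOn_Icc_of_ae_eq volume zero_ne_one ?_ hf hg
  rwa [← restrict_Ioo_eq_restrict_Icc]

lemma exists_kernel_bound (S : E →L[ℝ] E) :
    ∃ C, 0 ≤ C ∧ ∀ p ∈ triangle, ‖kernel S p.1 p.2‖ ≤ C := by
  obtain ⟨C, hC⟩ := ((isCompact_Icc (a := (0 : ℝ)) (b := 1)).prod
    (isCompact_Icc (a := (0 : ℝ)) (b := 1))).exists_bound_of_continuousOn
      (continuous_kernel S).continuousOn
  refine ⟨C, (norm_nonneg _).trans (hC (0, 0) (by simp)), fun p hp => hC p ?_⟩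
  obtain ⟨h1, h2, h3⟩ := hp
  exact ⟨⟨h1.trans h2, h3⟩, ⟨h1, h2.trans h3⟩⟩

lemma intervalIntegrable_kernel (S : E →L[ℝ] E) {f : ℝ → E} (hf : Integrable f unitMeasure)
    {x : ℝ} (hx : x ∈ Icc (0 : ℝ) 1) :
    IntervalIntegrable (fun y => kernel S x y (f y)) volume 0 x := by
  obtain ⟨C, -, hC⟩ := exists_kernel_bound S
  rw [intervalIntegrable_iff_integrableOn_Ioo_of_le hx.1]
  have h1 : IntegrableOn f (Ioo 0 x) := IntegrableOn.mono_set hf (Ioo_subset_Ioo_right hx.2)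
  refine Integrable.mono' (h1.norm.const_mul C) ?_ ?_
  · exact (ContinuousLinearMap.id ℝ (E →L[ℝ] E)).aestronglyMeasurable_comp₂
      ((continuous_kernel S).comp (by fun_prop : Continuous fun y : ℝ => (x, y))).aestronglyMeasurable
      h1.1
  · refine (ae_restrict_iff' measurableSet_Ioo).2 (Eventually.of_forall fun y hy => ?_)
    exact (ContinuousLinearMap.le_opNorm _ _).trans
      (mul_le_mul_of_nonneg_right (hC (x, y) ⟨hy.1.le, hy.2.le, hx.2⟩) (norm_nonneg _))

lemma transform_congr (S : E →L[ℝ] E) {f g : ℝ → E} (h : EqOn f g (Icc 0 1)) :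
    EqOn (transform S f) (transform S g) (Icc 0 1) := by
  intro x hx
  unfold transform
  rw [h hx]
  congr 1
  refine intervalIntegral.integral_congr fun y hy => ?_
  rw [uIcc_of_le hx.1] at hy
  simp only [h (⟨hy.1, hy.2.trans hx.2⟩ : y ∈ Icc (0 : ℝ) 1)]

lemma transform_congr_ae (S : E →L[ℝ] E) {f g : ℝ → E} (h : f =ᵐ[unitMeasure] g) :
    transform S f =ᵐ[unitMeasure] transform S g := by
  filter_upwards [h, ae_restrict_mem measurableSet_Ioo] with x hx hx1
  unfold transform
  rw [hx]
  congr 1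
  rw [intervalIntegral.integral_of_le hx1.1.le, intervalIntegral.integral_of_le hx1.1.le,
    integral_Ioc_eq_integral_Ioo, integral_Ioc_eq_integral_Ioo]
  refine integral_congr_ae ?_
  filter_upwards [ae_restrict_of_ae_restrict_of_subset (Ioo_subset_Ioo_right hx1.2.le) h] with y hy
  rw [hy]

lemma transform_add (S : E →L[ℝ] E) {f g : ℝ → E} (hf : Integrable f unitMeasure)
    (hg : Integrable g unitMeasure) {x : ℝ} (hx : x ∈ Icc (0 : ℝ) 1) :
    transform S (fun x => f x + g x) x = transform S f x + transform S g x := by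
  simp only [transform, map_add]
  rw [intervalIntegral.integral_add (intervalIntegrable_kernel S hf hx)
    (intervalIntegrable_kernel S hg hx)]
  abel

lemma transform_sub (S : E →L[ℝ] E) {f g : ℝ → E} (hf : Integrable f unitMeasure)
    (hg : Integrable g unitMeasure) {x : ℝ} (hx : x ∈ Icc (0 : ℝ) 1) :
    transform S (fun x => f x - g x) x = transform S f x - transform S g x := by
  simp only [transform, map_sub]
  rw [intervalIntegral.integral_sub (intervalIntegrable_kernel S hf hx)
    (intervalIntegrable_kernel S hg hx)]
  abel

lemma transform_smul (S : E →L[ℝ] E) (c : ℝ) (f : ℝ → E) (x : ℝ) :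
    transform S (fun x => c • f x) x = c • transform S f x := by
  simp only [transform, map_smul, intervalIntegral.integral_smul, smul_add]

lemma transform_zero_right (S : E →L[ℝ] E) (f : ℝ → E) : transform S f 0 = f 0 := by
  simp [transform]

lemma kernel_comm_apply (S : E →L[ℝ] E) (x y : ℝ) (v : E) :
    kernel S x y (S v) = S (kernel S x y v) := by
  have := congrArg (fun A : E →L[ℝ] E => A v) (commute_kernel S x y).eq
  simpa using this.symm

lemma transform_comm (S : E →L[ℝ] E) {f : ℝ → E} (hf : Continuous f) (x : ℝ) :
    transform S (fun x => S (f x)) x = S (transform S f x) := by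
  simp only [transform, map_add, kernel_comm_apply]
  rw [ContinuousLinearMap.intervalIntegral_comp_comm]
  exact (((continuous_kernel S).comp (by fun_prop : Continuous fun y : ℝ => (x, y))).clm_apply
    hf).intervalIntegrable _ _

/-- Cutting the kernel off above the diagonal replaces the variable limit by a fixed domain, so that
measurability of partial integrals on a product applies. -/
lemma aestronglyMeasurable_transform (S : E →L[ℝ] E) {f : ℝ → E}
    (hf : Integrable f unitMeasure) : AEStronglyMeasurable (transform S f) unitMeasure := by
  refine hf.1.add ?_
  have h1 : AEStronglyMeasurable (fun p : ℝ × ℝ =>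
      {p : ℝ × ℝ | p.2 ≤ p.1}.indicator (fun p => kernel S p.1 p.2 (f p.2)) p)
      (unitMeasure.prod unitMeasure) := by
    refine AEStronglyMeasurable.indicator ?_ (measurableSet_le measurable_snd measurable_fst)
    exact (ContinuousLinearMap.id ℝ (E →L[ℝ] E)).aestronglyMeasurable_comp₂
      (continuous_kernel S).aestronglyMeasurable hf.1.comp_snd
  refine h1.integral_prod_right'.congr ?_
  filter_upwards [ae_restrict_mem measurableSet_Ioo] with x hx
  have : ∀ y, {p : ℝ × ℝ | p.2 ≤ p.1}.indicator (fun p => kernel S p.1 p.2 (f p.2)) (x, y)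
      = (Iic x).indicator (fun y => kernel S x y (f y)) y := by
    intro y; simp [indicator]
  simp_rw [this]
  rw [integral_indicator measurableSet_Iic, Measure.restrict_restrict measurableSet_Iic,
    intervalIntegral.integral_of_le hx.1.le]
  congr 2
  ext y
  simp only [mem_inter_iff, mem_Iic, mem_Ioo, mem_Ioc]
  exact ⟨fun h => ⟨h.2.1, h.1⟩, fun h => ⟨h.2, h.1, h.2.trans_lt hx.2⟩⟩

lemma norm_integral_kernel_le (S : E →L[ℝ] E) {C : ℝ}
    (hC : ∀ p ∈ triangle, ‖kernel S p.1 p.2‖ ≤ C) {f : ℝ → E} (hf : MemLp f 2 unitMeasure)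
    {x : ℝ} (hx : x ∈ Icc (0 : ℝ) 1) :
    ‖∫ y in (0 : ℝ)..x, kernel S x y (f y)‖ ≤ C * (eLpNorm f 2 unitMeasure).toReal := by
  have hi := hf.integrable one_le_two
  have hC0 : 0 ≤ C := (norm_nonneg _).trans (hC (0, 0) (by simp [triangle]))
  have h1 : ∫ x, ‖f x‖ ∂unitMeasure ≤ (eLpNorm f 2 unitMeasure).toReal := by
    rw [integral_norm_eq_lintegral_enorm hf.1, ← eLpNorm_one_eq_lintegral_enorm]
    exact ENNReal.toReal_mono hf.2.ne (eLpNorm_le_eLpNorm_of_exponent_le one_le_two hf.1)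
  have h2 : ∫ y in Ioo 0 x, ‖f y‖ ≤ ∫ x, ‖f x‖ ∂unitMeasure :=
    setIntegral_mono_set hi.norm (Eventually.of_forall fun _ => norm_nonneg _)
      (Ioo_subset_Ioo_right hx.2).eventuallyLE
  refine le_trans ?_ (mul_le_mul_of_nonneg_left (h2.trans h1) hC0)
  rw [intervalIntegral.integral_of_le hx.1, integral_Ioc_eq_integral_Ioo, ← integral_const_mul]
  refine norm_integral_le_of_norm_le
    ((IntegrableOn.mono_set hi (Ioo_subset_Ioo_right hx.2)).norm.const_mul C) ?_
  refine (ae_restrict_iff' measurableSet_Ioo).2 (Eventually.of_forall fun y hy => ?_)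
  exact (ContinuousLinearMap.le_opNorm _ _).trans
    (mul_le_mul_of_nonneg_right (hC (x, y) ⟨hy.1.le, hy.2.le, hx.2⟩) (norm_nonneg _))

/-- The source of the factors `1 + K_∞` and `1 + L_∞`: the integral term is bounded pointwise by `C
‖f‖`, and the interval has length one. -/
lemma eLpNorm_transform_le (S : E →L[ℝ] E) {C : ℝ}
    (hC : ∀ p ∈ triangle, ‖kernel S p.1 p.2‖ ≤ C) {f : ℝ → E} (hf : MemLp f 2 unitMeasure) :
    eLpNorm (transform S f) 2 unitMeasure
      ≤ ENNReal.ofReal (1 + C) * eLpNorm f 2 unitMeasure := by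
  have hC0 : 0 ≤ C := (norm_nonneg _).trans (hC (0, 0) (by simp [triangle]))
  have hm : AEStronglyMeasurable (fun x => ∫ y in (0 : ℝ)..x, kernel S x y (f y)) unitMeasure := by
    have := (aestronglyMeasurable_transform S (hf.integrable one_le_two)).sub hf.1
    refine this.congr (Eventually.of_forall fun x => ?_)
    simp [transform]
  have h1 : eLpNorm (fun x => ∫ y in (0 : ℝ)..x, kernel S x y (f y)) 2 unitMeasure
      ≤ ENNReal.ofReal C * eLpNorm f 2 unitMeasure := by
    have := eLpNorm_le_of_ae_bound (p := 2) (μ := unitMeasure)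
      (ae_unitMeasure_of_forall fun x hx => norm_integral_kernel_le S hC hf hx)
    simpa [ENNReal.ofReal_mul hC0, ENNReal.ofReal_toReal hf.2.ne] using this
  calc eLpNorm (transform S f) 2 unitMeasure
      ≤ eLpNorm f 2 unitMeasure
        + eLpNorm (fun x => ∫ y in (0 : ℝ)..x, kernel S x y (f y)) 2 unitMeasure :=
        eLpNorm_add_le hf.1 hm one_le_two
    _ ≤ eLpNorm f 2 unitMeasure + ENNReal.ofReal C * eLpNorm f 2 unitMeasure := by gcongr
    _ = _ := by rw [ENNReal.ofReal_add zero_le_one hC0, ENNReal.ofReal_one, add_mul, one_mul]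

lemma memLp_transform (S : E →L[ℝ] E) {f : ℝ → E} (hf : MemLp f 2 unitMeasure) :
    MemLp (transform S f) 2 unitMeasure := by
  obtain ⟨C, -, hC⟩ := exists_kernel_bound S
  exact ⟨aestronglyMeasurable_transform S (hf.integrable one_le_two),
    (eLpNorm_transform_le S hC hf).trans_lt (ENNReal.mul_lt_top ENNReal.ofReal_lt_top hf.2)⟩

/-- The transformation `transform S` as a bounded operator in `L²`. -/
def transformLp (S : E →L[ℝ] E) : Lp E 2 unitMeasure →L[ℝ] Lp E 2 unitMeasure :=
  LinearMap.mkContinuousOfExistsBound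
    { toFun := fun f => (memLp_transform S (Lp.memLp f)).toLp _
      map_add' := fun f g => by
        rw [← MemLp.toLp_add]
        refine MemLp.toLp_congr _ _ ((transform_congr_ae S (Lp.coeFn_add f g)).trans ?_)
        exact ae_unitMeasure_of_forall fun x hx => transform_add S
          ((Lp.memLp f).integrable one_le_two) ((Lp.memLp g).integrable one_le_two) hx
      map_smul' := fun c f => by
        rw [RingHom.id_apply, ← MemLp.toLp_const_smul]
        refine MemLp.toLp_congr _ _ ((transform_congr_ae S (Lp.coeFn_smul c f)).trans ?_)
        exact Eventually.of_forall fun x => transform_smul S c f x }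
    (by
      obtain ⟨C, hC0, hC⟩ := exists_kernel_bound S
      refine ⟨1 + C, fun f => ?_⟩
      simp only [LinearMap.coe_mk, AddHom.coe_mk, Lp.norm_toLp]
      rw [Lp.norm_def, ← ENNReal.toReal_ofReal (by positivity : 0 ≤ 1 + C), ← ENNReal.toReal_mul]
      exact ENNReal.toReal_mono (ENNReal.mul_lt_top ENNReal.ofReal_lt_top (Lp.memLp f).2).ne
        (eLpNorm_transform_le S hC (Lp.memLp f)))

lemma transformLp_toLp (S : E →L[ℝ] E) {f : ℝ → E} (hf : MemLp f 2 unitMeasure) :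
    transformLp S (hf.toLp f) = (memLp_transform S hf).toLp _ :=
  MemLp.toLp_congr (memLp_transform S (Lp.memLp _)) _ (transform_congr_ae S hf.coeFn_toLp)

/-- The only solution of `f'' = -μ² f`, `f 0 = v`, `f' 0 = 0` is `cos (μ x) v`. -/
lemma eq_cos_smul_of_isNeumannC2 {μ : ℝ} (hμ : μ ≠ 0) {f f' : ℝ → E}
    (h : IsNeumannC2 f f' fun x => -(μ ^ 2) • f x) (x : ℝ) :
    f x = Real.cos (μ * x) • f 0 := by
  have hc : ∀ x, HasDerivAt (fun x => Real.cos (μ * x)) (-Real.sin (μ * x) * μ) x := fun x => by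
    simpa using ((hasDerivAt_id' x).const_mul μ).cos
  have hs : ∀ x, HasDerivAt (fun x => Real.sin (μ * x)) (Real.cos (μ * x) * μ) x := fun x => by
    simpa using ((hasDerivAt_id' x).const_mul μ).sin
  -- Rotating the pair `(f', μ f)` by the angle `μ x` gives two first integrals, with values `0` and
  -- `μ f(0)` at the origin; rotating back yields `f`.
  have h1 : ∀ x, HasDerivAt (fun x => (Real.cos (μ * x)) • f' x + (μ * Real.sin (μ * x)) • f x) 0 x := by
    intro x
    have := ((hc x).smul (h.hasDerivAt' x)).add (((hs x).const_mul μ).smul (h.hasDerivAt x))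
    convert! this using 1
    module
  have h2 : ∀ x, HasDerivAt (fun x => (μ * Real.cos (μ * x)) • f x - (Real.sin (μ * x)) • f' x) 0 x := by
    intro x
    have := (((hc x).const_mul μ).smul (h.hasDerivAt x)).sub ((hs x).smul (h.hasDerivAt' x))
    convert! this using 1
    module
  have e1 := is_const_of_deriv_eq_zero (fun x => (h1 x).differentiableAt) (fun x => (h1 x).deriv) x 0
  have e2 := is_const_of_deriv_eq_zero (fun x => (h2 x).differentiableAt) (fun x => (h2 x).deriv) x 0
  simp only [mul_zero, Real.cos_zero, Real.sin_zero, h.zero, smul_zero, zero_smul, add_zero,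
    mul_one, sub_zero] at e1 e2
  have e3 : μ • f x = μ • Real.cos (μ * x) • f 0 := by
    have h5 := congrArg (fun v => Real.sin (μ * x) • v) e1
    have h6 := congrArg (fun v => Real.cos (μ * x) • v) e2
    simp only [smul_add, smul_sub, smul_zero, smul_smul] at h5 h6
    have h7 := Real.sin_sq_add_cos_sq (μ * x)
    calc μ • f x = (μ * (Real.sin (μ * x) ^ 2 + Real.cos (μ * x) ^ 2)) • f x := by rw [h7, mul_one]
      _ = ((Real.sin (μ * x) * Real.cos (μ * x)) • f' x
            + (Real.sin (μ * x) * (μ * Real.sin (μ * x))) • f x)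
          + ((Real.cos (μ * x) * (μ * Real.cos (μ * x))) • f x
            - (Real.cos (μ * x) * Real.sin (μ * x)) • f' x) := by module
      _ = _ := by rw [h5, h6, smul_smul, zero_add, mul_comm]
  exact smul_right_injective E hμ e3

lemma isNeumannC2_cos_smul (μ : ℝ) (v : E) :
    IsNeumannC2 (fun x => Real.cos (μ * x) • v) (fun x => (-Real.sin (μ * x) * μ) • v)
      (fun x => -(μ ^ 2) • Real.cos (μ * x) • v) := by
  refine ⟨fun x => ?_, fun x => ?_, by fun_prop, by simp⟩
  · have : HasDerivAt (fun x => Real.cos (μ * x)) (-Real.sin (μ * x) * μ) x := by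
      simpa using ((hasDerivAt_id' x).const_mul μ).cos
    exact this.smul_const v
  · have : HasDerivAt (fun x => Real.sin (μ * x)) (Real.cos (μ * x) * μ) x := by
      simpa using ((hasDerivAt_id' x).const_mul μ).sin
    convert! (this.neg.mul_const μ).smul_const v using 1
    module

/-- Unlike `transform_add`, this holds at every real `x`, as needed for identities between functions
satisfying `IsNeumannC2` on the whole line. -/
lemma transform_add_of_continuous (S : E →L[ℝ] E) {f g : ℝ → E} (hf : Continuous f)
    (hg : Continuous g) (x : ℝ) :
    transform S (fun x => f x + g x) x = transform S f x + transform S g x := by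
  have hi : ∀ {f : ℝ → E}, Continuous f →
      IntervalIntegrable (fun y => kernel S x y (f y)) volume 0 x := fun hf =>
    (((continuous_kernel S).comp (by fun_prop : Continuous fun y : ℝ => (x, y))).clm_apply
      hf).intervalIntegrable _ _
  simp only [transform, map_add]
  rw [intervalIntegral.integral_add (hi hf) (hi hg)]
  abel

/-- With `f = cos (μ x) v` and `g = T_{-S} f`, intertwining gives `g'' = -μ² g - S g`; a second use,
now with `+S`, gives `(T_S g)'' = -μ² T_S g`. Both transformations preserve the value and the zero
slope at `0`, so ODE uniqueness returns `f`. -/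
lemma transform_transform_neg_cos_smul (S : E →L[ℝ] E) {μ : ℝ} (hμ : μ ≠ 0) (v : E) (x : ℝ) :
    transform S (transform (-S) fun x => Real.cos (μ * x) • v) x = Real.cos (μ * x) • v := by
  set f : ℝ → E := fun x => Real.cos (μ * x) • v
  have hf := isNeumannC2_cos_smul μ v
  have hg := isNeumannC2_transform (-S) hf
  have hh := isNeumannC2_transform S hg
  have hfc : Continuous f := hf.continuous
  have key : (fun x => transform (-S) (fun x => -(μ ^ 2) • Real.cos (μ * x) • v + (-S) (f x)) x
      + S (transform (-S) f x)) = fun x => -(μ ^ 2) • transform (-S) f x := by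
    ext1 x
    rw [transform_add_of_continuous (-S) (by fun_prop) (by fun_prop), transform_comm (-S) hfc,
      transform_smul]
    simp [f]
  rw [key] at hh
  have e : (transform S fun x => -(μ ^ 2) • transform (-S) f x)
      = fun x => -(μ ^ 2) • transform S (transform (-S) f) x := by
    ext1 x; rw [transform_smul]
  rw [e] at hh
  rw [eq_cos_smul_of_isNeumannC2 hμ hh x, transform_zero_right, transform_zero_right]
  simp

/-- Both sides are bounded operators that agree on the cosine basis, whose span is dense. -/
lemma transformLp_comp_neg (S : E →L[ℝ] E) :
    (transformLp S).comp (transformLp (-S)) = ContinuousLinearMap.id ℝ _ := by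
  have hd : Dense (Submodule.span ℝ (range (modeBasis E)) : Set (Lp E 2 unitMeasure)) := by
    rw [Submodule.dense_iff_topologicalClosure_eq_top]
    exact (modeBasis E).dense_span
  refine ContinuousLinearMap.ext_on hd ?_
  rintro _ ⟨k, rfl⟩
  have hb : modeBasis E k = modeLp E k := by simp [modeBasis]
  rw [hb, ContinuousLinearMap.comp_apply, ContinuousLinearMap.id_apply, modeLp, transformLp_toLp,
    transformLp_toLp]
  refine MemLp.toLp_congr _ _ (Eventually.of_forall fun x => ?_)
  have := transform_transform_neg_cos_smul S (freq_pos k.1).ne' (√2 • stdOrthonormalBasis ℝ E k.2) x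
  have hm : mode E k = fun x => Real.cos (freq k.1 * x) • √2 • stdOrthonormalBasis ℝ E k.2 := by
    ext1 x; rw [mode, smul_smul, mul_comm]
  rw [← hm] at this
  rw [this, hm]

lemma transform_transform_neg_ae (S : E →L[ℝ] E) {f : ℝ → E} (hf : MemLp f 2 unitMeasure) :
    transform S (transform (-S) f) =ᵐ[unitMeasure] f := by
  have h := congrArg (fun A => A (hf.toLp f)) (transformLp_comp_neg S)
  simp only [ContinuousLinearMap.comp_apply, ContinuousLinearMap.id_apply, transformLp_toLp] at h
  exact (MemLp.toLp_eq_toLp_iff _ _).1 h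

lemma continuousOn_transform (S : E →L[ℝ] E) {f : ℝ → E} (hf : ContinuousOn f (Icc 0 1)) :
    ContinuousOn (transform S f) (Icc 0 1) := by
  have h1 : EqOn f (IccExtend zero_le_one ((Icc (0 : ℝ) 1).domRestrict f)) (Icc 0 1) := fun x hx => by
    rw [IccExtend_of_mem _ _ hx]; rfl
  have h2 : Continuous (IccExtend zero_le_one ((Icc (0 : ℝ) 1).domRestrict f)) :=
    (continuousOn_iff_continuous_domRestrict.1 hf).Icc_extend'
  exact (continuous_transform_apply S h2).continuousOn.congr (transform_congr S h1)

lemma transform_transform_neg (S : E →L[ℝ] E) {f : ℝ → E} (hf : ContinuousOn f (Icc 0 1)) :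
    EqOn (transform S (transform (-S) f)) f (Icc 0 1) :=
  eqOn_Icc_of_ae_eq_unitMeasure (transform_transform_neg_ae S (memLp_of_continuousOn hf))
    (continuousOn_transform S (continuousOn_transform (-S) hf)) hf

end

/-! ### Classical solutions: evolution of the transformed coefficients. -/

section

variable {E : Type*} [NormedAddCommGroup E] [InnerProductSpace ℝ E] [FiniteDimensional ℝ E]

lemma continuousOn_integral_param {V : Set ℝ} {s t : ℝ} (hst : s ≤ t) {F : ℝ → ℝ → E}
    (hF : ContinuousOn (fun p : ℝ × ℝ => F p.1 p.2) (V ×ˢ Icc s t)) :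
    ContinuousOn (fun x => ∫ τ in s..t, F x τ) V := by
  rw [continuousOn_iff_continuous_domRestrict]
  have h1 : Continuous fun p : V × ℝ => F p.1 (projIcc s t hst p.2) :=
    hF.comp_continuous (f := fun p : V × ℝ => ((p.1 : ℝ), (projIcc s t hst p.2 : ℝ)))
      (by fun_prop) fun p => ⟨p.1.2, (projIcc s t hst p.2).2⟩
  have h2 := intervalIntegral.continuous_parametric_intervalIntegral_of_continuous'
    (μ := volume) (f := fun (x : V) τ => F x (projIcc s t hst τ)) h1 s t
  refine h2.congr fun x => intervalIntegral.integral_congr fun τ hτ => ?_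
  rw [uIcc_of_le hst] at hτ
  simp only [projIcc_of_mem hst hτ]

lemma integral_swap_of_continuous {G : ℝ → ℝ → E} (hG : Continuous fun p : ℝ × ℝ => G p.1 p.2)
    (a b c d : ℝ) :
    ∫ x in a..b, ∫ y in c..d, G x y = ∫ y in c..d, ∫ x in a..b, G x y := by
  refine intervalIntegral_intervalIntegral_swap ?_
  exact (hG.continuousOn.integrableOn_compact (isCompact_uIcc.prod isCompact_uIcc)).mono_set
    (prod_mono uIoc_subset_uIcc uIoc_subset_uIcc)

/-- A function whose increments are integrals of `-m` times the function is an exponential. -/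
lemma eq_exp_smul_of_sub_eq_integral {c : ℝ → E} {c₀ : E} {m : ℝ}
    (hc : ∀ s t, 0 < s → s < t → ContinuousOn c (Icc s t))
    (h : ∀ s t, 0 < s → s < t → c t - c s = -m • ∫ τ in s..t, c τ)
    (h0 : Tendsto c (𝓝[>] 0) (𝓝 c₀)) {t : ℝ} (ht : 0 < t) : c t = Real.exp (-m * t) • c₀ := by
  have hcont : ContinuousOn c (Ioi 0) := fun t (ht : 0 < t) =>
    ((hc (t / 2) (2 * t) (by linarith) (by linarith)).continuousAt
      (Icc_mem_nhds (by linarith) (by linarith))).continuousWithinAt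
  have hd : ∀ t > 0, HasDerivAt c (-m • c t) t := by
    intro t ht
    have h1 : HasDerivAt (fun u => ∫ τ in (t / 2)..u, c τ) (c t) t := by
      refine intervalIntegral.integral_hasDerivAt_right ?_ ?_ (hcont.continuousAt (Ioi_mem_nhds ht))
      · exact (hc (t / 2) t (by linarith) (by linarith)).intervalIntegrable_of_Icc (by linarith)
      · exact hcont.stronglyMeasurableAtFilter isOpen_Ioi t ht
    refine ((h1.const_smul (-m)).const_add (c (t / 2))).congr_of_eventuallyEq ?_
    filter_upwards [Ioi_mem_nhds (show t / 2 < t by linarith)] with u hu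
    simp only [Pi.smul_apply]
    rw [← h (t / 2) u (by linarith) hu]; abel
  have hg : ∀ t > 0, HasDerivAt (fun t => Real.exp (m * t) • c t) 0 t := by
    intro t ht
    have h1 : HasDerivAt (fun t => Real.exp (m * t)) (Real.exp (m * t) * m) t := by
      simpa using ((hasDerivAt_id' t).const_mul m).exp
    convert! h1.smul (hd t ht) using 1
    module
  have hconst : ∀ s ∈ Ioi (0 : ℝ), Real.exp (m * s) • c s = Real.exp (m * t) • c t := fun s hs =>
    isOpen_Ioi.is_const_of_deriv_eq_zero isPreconnected_Ioi
      (fun s hs => (hg s hs).differentiableAt.differentiableWithinAt) (fun s hs => (hg s hs).deriv)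
      hs ht
  have hlim : Tendsto (fun s => Real.exp (m * s) • c s) (𝓝[>] 0) (𝓝 c₀) := by
    have : Tendsto (fun s => Real.exp (m * s)) (𝓝[>] 0) (𝓝 1) := by
      have := ((by fun_prop : Continuous fun s => Real.exp (m * s)).tendsto 0).mono_left
        (nhdsWithin_le_nhds (s := Ioi 0))
      simpa using this
    simpa using this.smul h0
  have hlim' : Tendsto (fun s => Real.exp (m * s) • c s) (𝓝[>] 0) (𝓝 (Real.exp (m * t) • c t)) :=
    tendsto_const_nhds.congr' (by
      filter_upwards [self_mem_nhdsWithin] with s hs using (hconst s hs).symm)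
  rw [tendsto_nhds_unique hlim hlim', smul_smul, ← Real.exp_add]
  simp

/-- Green's formula with `cos (μₙ x)`: the antiderivative `cos (μₙ x) f' + μₙ sin (μₙ x) f` vanishes
at `0` by the Neumann condition, and at `1` because `cos μₙ = 0` and `f(1) = 0`. No bound on `f'(1)`
enters the result. -/
lemma coeff_second_deriv {f f' f'' : ℝ → E} (h : IsNeumannC2 f f' f'') (h1 : f 1 = 0) (n : ℕ) :
    coeff n f'' = -(freq n ^ 2) • coeff n f := by
  have hf := h.continuous
  have hf'' := h.continuous''
  have hd : ∀ x, HasDerivAt (fun x => Real.cos (freq n * x) • f' x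
      + (freq n * Real.sin (freq n * x)) • f x)
      (Real.cos (freq n * x) • f'' x + (freq n ^ 2) • Real.cos (freq n * x) • f x) x := by
    intro x
    have hc : HasDerivAt (fun x => Real.cos (freq n * x)) (-Real.sin (freq n * x) * freq n) x := by
      simpa using ((hasDerivAt_id' x).const_mul (freq n)).cos
    have hs : HasDerivAt (fun x => Real.sin (freq n * x)) (Real.cos (freq n * x) * freq n) x := by
      simpa using ((hasDerivAt_id' x).const_mul (freq n)).sin
    convert! (hc.smul (h.hasDerivAt' x)).add ((hs.const_mul (freq n)).smul (h.hasDerivAt x)) using 1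
    module
  have key := intervalIntegral.integral_eq_sub_of_hasDerivAt (a := 0) (b := 1) (fun x _ => hd x)
    ((by fun_prop : Continuous _).intervalIntegrable _ _)
  rw [intervalIntegral.integral_add ((by fun_prop : Continuous _).intervalIntegrable _ _)
    ((by fun_prop : Continuous _).intervalIntegrable _ _), intervalIntegral.integral_smul] at key
  simp only [h1, h.zero, mul_one, mul_zero, cos_freq, Real.sin_zero, zero_smul, smul_zero,
    add_zero, sub_zero] at key
  simp only [coeff, integral_unitMeasure]
  rw [neg_smul]
  exact eq_neg_of_add_eq_zero_left key

variable [Nontrivial E]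

lemma transform_integral (S : E →L[ℝ] E) {w : ℝ → ℝ → E}
    (hw : Continuous fun p : ℝ × ℝ => w p.1 p.2) (s t x : ℝ) :
    transform S (fun x => ∫ τ in s..t, w x τ) x
      = ∫ τ in s..t, transform S (fun y => w y τ) x := by
  have hk : Continuous fun p : ℝ × ℝ => kernel S x p.1 (w p.1 p.2) :=
    ((continuous_kernel S).comp (by fun_prop : Continuous fun p : ℝ × ℝ => (x, p.1))).clm_apply hw
  have e1 : ∀ y, kernel S x y (∫ τ in s..t, w y τ) = ∫ τ in s..t, kernel S x y (w y τ) := fun y =>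
    (ContinuousLinearMap.intervalIntegral_comp_comm _
      ((hw.comp (by fun_prop : Continuous fun τ : ℝ => (y, τ))).intervalIntegrable _ _)).symm
  have h1 : IntervalIntegrable (fun τ => w x τ) volume s t :=
    (hw.comp (by fun_prop : Continuous fun τ : ℝ => (x, τ))).intervalIntegrable _ _
  have hk' : Continuous fun p : ℝ × ℝ => kernel S x p.2 (w p.2 p.1) :=
    ((continuous_kernel S).comp (by fun_prop : Continuous fun p : ℝ × ℝ => (x, p.2))).clm_apply
      (hw.comp (continuous_swap (X := ℝ) (Y := ℝ)))
  have h2 : IntervalIntegrable (fun τ => ∫ y in (0 : ℝ)..x, kernel S x y (w y τ)) volume s t :=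
    (intervalIntegral.continuous_parametric_intervalIntegral_of_continuous'
      (f := fun τ y => kernel S x y (w y τ)) hk' 0 x).intervalIntegrable s t
  simp only [transform, e1]
  rw [intervalIntegral.integral_add h1 h2, integral_swap_of_continuous hk]

/-- `w` solves `w_t = w_xx + S w` in `(0,1) × (0,∞)` with `w_x = 0` at `x = 0`. -/
structure IsReactionDiffusion (S : E →L[ℝ] E) (w wx wxx wt : ℝ → ℝ → E) : Prop where
  cont : ContinuousOn (fun p : ℝ × ℝ => w p.1 p.2) (Icc 0 1 ×ˢ Ioi 0)
  cont_x : ContinuousOn (fun p : ℝ × ℝ => wx p.1 p.2) (Ico 0 1 ×ˢ Ioi 0)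
  cont_xx : ContinuousOn (fun p : ℝ × ℝ => wxx p.1 p.2) (Ioo 0 1 ×ˢ Ioi 0)
  cont_t : ContinuousOn (fun p : ℝ × ℝ => wt p.1 p.2) (Ioo 0 1 ×ˢ Ioi 0)
  deriv_x : ∀ x ∈ Ico (0 : ℝ) 1, ∀ t > 0,
    HasDerivWithinAt (fun x' => w x' t) (wx x t) (Icc 0 1) x
  deriv_xx : ∀ x ∈ Ioo (0 : ℝ) 1, ∀ t > 0, HasDerivAt (fun x' => wx x' t) (wxx x t) x
  deriv_t : ∀ x ∈ Ioo (0 : ℝ) 1, ∀ t > 0, HasDerivAt (fun t' => w x t') (wt x t) t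
  pde : ∀ x ∈ Ioo (0 : ℝ) 1, ∀ t > 0, wt x t = wxx x t + S (w x t)
  neumann : ∀ t > 0, wx 0 t = 0

namespace IsReactionDiffusion

variable {S : E →L[ℝ] E} {w wx wxx wt : ℝ → ℝ → E}

lemma continuousOn_apply (h : IsReactionDiffusion S w wx wxx wt) {t : ℝ} (ht : 0 < t) :
    ContinuousOn (fun x => w x t) (Icc 0 1) :=
  h.cont.comp (f := fun x => (x, t)) (by fun_prop) fun _ hx => ⟨hx, ht⟩

/-- Time averages of a solution are `C²` up to the boundary. -/
lemma exists_isNeumannC2_integral (h : IsReactionDiffusion S w wx wxx wt) {s t : ℝ} (hs : 0 < s)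
    (hst : s < t) : ∃ f f' f'' : ℝ → E, IsNeumannC2 f f' f'' ∧
      (∀ x ∈ Icc (0 : ℝ) 1, f x = ∫ τ in s..t, w x τ) ∧
      (∀ x ∈ Icc (0 : ℝ) 1, f'' x + S (f x) = w x t - w x s) := by
  have hpos : ∀ {τ}, τ ∈ Icc s t → 0 < τ := fun hτ => hs.trans_le hτ.1
  set W : ℝ → E := fun x => ∫ τ in s..t, w x τ
  set W1 : ℝ → E := fun x => ∫ τ in s..t, wx x τ
  have sub1 : ∀ V : Set ℝ, V ×ˢ Icc s t ⊆ V ×ˢ Ioi 0 := fun V => Set.prod_mono_right fun _ hτ => mem_Ioi.2 (hpos hτ)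
  have hW : ContinuousOn W (Icc 0 1) := continuousOn_integral_param hst.le (h.cont.mono (sub1 _))
  have hW1 : ContinuousOn W1 (Ico 0 1) := continuousOn_integral_param hst.le (h.cont_x.mono (sub1 _))
  have hwI : ContinuousOn (fun p : ℝ × ℝ => w p.1 p.2) (Ioo 0 1 ×ˢ Icc s t) :=
    (h.cont.mono (sub1 _)).mono (Set.prod_mono_left Ioo_subset_Icc_self)
  have hwxI : ContinuousOn (fun p : ℝ × ℝ => wx p.1 p.2) (Ioo 0 1 ×ˢ Icc s t) :=
    (h.cont_x.mono (sub1 _)).mono (Set.prod_mono_left Ioo_subset_Ico_self)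
  have dW : ∀ x ∈ Ioo (0 : ℝ) 1, HasDerivAt W (W1 x) x := fun x hx =>
    hasDerivAt_integral_of_continuousOn isOpen_Ioo hst.le hwI hwxI (fun x hx τ hτ =>
      (h.deriv_x x (Ioo_subset_Ico_self hx) τ (hpos hτ)).hasDerivAt (Icc_mem_nhds hx.1 hx.2)) hx
  have dW1 : ∀ x ∈ Ioo (0 : ℝ) 1, HasDerivAt W1 (∫ τ in s..t, wxx x τ) x := fun x hx =>
    hasDerivAt_integral_of_continuousOn isOpen_Ioo hst.le hwxI (h.cont_xx.mono (sub1 _))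
      (fun x hx τ hτ => h.deriv_xx x hx τ (hpos hτ)) hx
  have hxx : ∀ x ∈ Ioo (0 : ℝ) 1, ∫ τ in s..t, wxx x τ = w x t - w x s - S (W x) := by
    intro x hx
    have cw : ContinuousOn (fun τ => w x τ) (Icc s t) :=
      hwI.comp (f := fun τ => (x, τ)) (by fun_prop) fun _ hτ => ⟨hx, hτ⟩
    have cwt : ContinuousOn (fun τ => wt x τ) (Icc s t) :=
      (h.cont_t.mono (sub1 _)).comp (f := fun τ => (x, τ)) (by fun_prop) fun _ hτ => ⟨hx, hτ⟩
    have e1 : ∫ τ in s..t, wt x τ = w x t - w x s := by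
      refine intervalIntegral.integral_eq_sub_of_hasDerivAt (fun τ hτ => ?_)
        (cwt.intervalIntegrable_of_Icc hst.le)
      rw [uIcc_of_le hst.le] at hτ
      exact h.deriv_t x hx τ (hpos hτ)
    have e2 : S (W x) = ∫ τ in s..t, S (w x τ) :=
      (ContinuousLinearMap.intervalIntegral_comp_comm _ (cw.intervalIntegrable_of_Icc hst.le)).symm
    rw [← e1, e2, ← intervalIntegral.integral_sub (cwt.intervalIntegrable_of_Icc hst.le)
      (ContinuousOn.intervalIntegrable_of_Icc hst.le (u := fun τ => S (w x τ))
        (S.continuous.comp_continuousOn cw))]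
    refine intervalIntegral.integral_congr fun τ hτ => ?_
    rw [uIcc_of_le hst.le] at hτ
    simp only [h.pde x hx τ (hpos hτ)]
    abel
  -- The equation integrated in time expresses `W''` through `w(t)`, `w(s)` and `S W`, which are
  -- continuous on the closed interval although `w_xx` need not be. Extending this expression to the
  -- line and integrating it twice gives a `C²` extension of `W`.
  set g : ℝ → E := IccExtend zero_le_one
    ((Icc (0 : ℝ) 1).domRestrict fun x => w x t - w x s - S (W x))
  have hg : ∀ x ∈ Icc (0 : ℝ) 1, g x = w x t - w x s - S (W x) := fun x hx => by
    simp only [g]; rw [IccExtend_of_mem _ _ hx]; rfl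
  have hgc : Continuous g := by
    refine Continuous.Icc_extend' ?_
    rw [← continuousOn_iff_continuous_domRestrict]
    exact ((h.continuousOn_apply (hs.trans hst)).sub (h.continuousOn_apply hs)).sub
      (S.continuous.comp_continuousOn hW)
  set f' : ℝ → E := fun x => ∫ y in (0 : ℝ)..x, g y
  have df' : ∀ x, HasDerivAt f' (g x) x := fun x =>
    intervalIntegral.integral_hasDerivAt_right (hgc.intervalIntegrable _ _)
      (hgc.stronglyMeasurableAtFilter _ _) hgc.continuousAt
  have hf'c : Continuous f' := continuous_iff_continuousAt.2 fun x => (df' x).continuousAt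
  have hf' : ∀ x ∈ Ico (0 : ℝ) 1, f' x = W1 x := by
    intro x hx
    have hW10 : W1 0 = 0 := by
      have : EqOn (fun τ => wx 0 τ) (fun _ => 0) (uIcc s t) := fun τ hτ => by
        rw [uIcc_of_le hst.le] at hτ
        exact h.neumann τ (hpos hτ)
      simp only [W1]
      rw [intervalIntegral.integral_congr this, intervalIntegral.integral_zero]
    have := intervalIntegral.integral_eq_sub_of_hasDerivAt_of_le hx.1
      (hW1.mono fun y hy => ⟨hy.1, hy.2.trans_lt hx.2⟩) (f' := g) (fun y hy => by
        have hy' : y ∈ Ioo (0 : ℝ) 1 := ⟨hy.1, hy.2.trans hx.2⟩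
        rw [hg y (Ioo_subset_Icc_self hy'), ← hxx y hy']
        exact dW1 y hy') (hgc.intervalIntegrable _ _)
    rw [hW10, sub_zero] at this
    exact this
  have hfW : ∀ x ∈ Icc (0 : ℝ) 1, W 0 + ∫ y in (0 : ℝ)..x, f' y = W x := by
    intro x hx
    have := intervalIntegral.integral_eq_sub_of_hasDerivAt_of_le hx.1
      (hW.mono (Icc_subset_Icc_right hx.2)) (f' := f') (fun y hy => by
        have hy' : y ∈ Ioo (0 : ℝ) 1 := ⟨hy.1, hy.2.trans_le hx.2⟩
        rw [hf' y (Ioo_subset_Ico_self hy')]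
        exact dW y hy') (hf'c.intervalIntegrable _ _)
    rw [this]; abel
  refine ⟨fun x => W 0 + ∫ y in (0 : ℝ)..x, f' y, f', g, ⟨fun x => ?_, df', hgc, by simp [f']⟩,
    hfW, fun x hx => ?_⟩
  · exact (intervalIntegral.integral_hasDerivAt_right (hf'c.intervalIntegrable _ _)
      (hf'c.stronglyMeasurableAtFilter _ _) hf'c.continuousAt).const_add _
  · beta_reduce
    rw [hfW x hx, hg x hx]; abel

/-- The equation `z_t = z_xx` for `z = T_S w`, in integrated form and tested against a cosine:
intertwining applied to the time average of `w`, followed by `coeff_second_deriv`. Only continuity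
of `w` up to the boundary is needed beyond the averaged regularity. -/
lemma coeff_transform_sub (h : IsReactionDiffusion S w wx wxx wt)
    (h1 : ∀ t > 0, transform S (fun x => w x t) 1 = 0) {s t : ℝ} (hs : 0 < s) (hst : s < t)
    (n : ℕ) :
    ContinuousOn (fun τ => coeff n (transform S fun x => w x τ)) (Icc s t) ∧
    coeff n (transform S fun x => w x t) - coeff n (transform S fun x => w x s)
      = -(freq n ^ 2) • ∫ τ in s..t, coeff n (transform S fun x => w x τ) := by
  -- Clamping both variables gives a function continuous on the plane that equals `w` on `[0,1] ×
  -- [s,t]`, so that the interchange of integrals for continuous functions applies.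
  set v : ℝ → ℝ → E := fun x τ => w (projIcc 0 1 zero_le_one x) (projIcc s t hst.le τ)
  have hv : Continuous fun p : ℝ × ℝ => v p.1 p.2 :=
    h.cont.comp_continuous (f := fun p : ℝ × ℝ =>
      ((projIcc 0 1 zero_le_one p.1 : ℝ), (projIcc s t hst.le p.2 : ℝ))) (by fun_prop)
      fun p => ⟨(projIcc 0 1 zero_le_one p.1).2, hs.trans_le (projIcc s t hst.le p.2).2.1⟩
  have hvw : ∀ τ ∈ Icc s t, EqOn (fun x => v x τ) (fun x => w x τ) (Icc 0 1) := fun τ hτ x hx => by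
    simp only [v, projIcc_of_mem _ hx, projIcc_of_mem _ hτ]
  have hc : ∀ τ ∈ Icc s t, coeff n (transform S fun x => w x τ)
      = coeff n (transform S fun x => v x τ) := fun τ hτ =>
    coeff_congr_ae (ae_unitMeasure_of_forall fun x hx => (transform_congr S (hvw τ hτ) hx).symm)
  have hz : Continuous fun p : ℝ × ℝ => transform S (fun x => v x p.1) p.2 :=
    continuous_transform S (f := fun τ x => v x τ) (hv.comp continuous_swap)
  have hzc : Continuous fun p : ℝ × ℝ =>
      Real.cos (freq n * p.2) • transform S (fun x => v x p.1) p.2 := by fun_prop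
  constructor
  · refine ContinuousOn.congr ?_ hc
    unfold coeff
    simp_rw [integral_unitMeasure]
    exact (intervalIntegral.continuous_parametric_intervalIntegral_of_continuous' hzc 0 1).continuousOn
  obtain ⟨f, f', f'', hf, hfW, hf''⟩ := h.exists_isNeumannC2_integral hs hst
  have hF := isNeumannC2_transform S hf
  have hFz : ∀ x ∈ Icc (0 : ℝ) 1,
      transform S f x = ∫ τ in s..t, transform S (fun x => v x τ) x := by
    intro x hx
    rw [← transform_integral S hv]
    refine transform_congr S (fun y hy => ?_) hx
    rw [hfW y hy]
    refine intervalIntegral.integral_congr fun τ hτ => ?_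
    rw [uIcc_of_le hst.le] at hτ
    exact (hvw τ hτ hy).symm
  have hF1 : transform S f 1 = 0 := by
    rw [hFz 1 (by simp)]
    have : EqOn (fun τ => transform S (fun x => v x τ) 1) (fun _ => 0) (uIcc s t) := fun τ hτ => by
      rw [uIcc_of_le hst.le] at hτ
      exact (transform_congr S (hvw τ hτ) (by simp)).trans (h1 τ (hs.trans_le hτ.1))
    rw [intervalIntegral.integral_congr this, intervalIntegral.integral_zero]
  have key := coeff_second_deriv hF hF1 n
  have hit : ∀ {τ}, 0 < τ → Integrable (fun x => w x τ) unitMeasure := fun hτ =>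
    (memLp_of_continuousOn (h.continuousOn_apply hτ)).integrable one_le_two
  have hiT : ∀ {τ}, 0 < τ → Integrable (transform S fun x => w x τ) unitMeasure := fun hτ =>
    (memLp_transform S (memLp_of_continuousOn (h.continuousOn_apply hτ))).integrable one_le_two
  rw [← coeff_sub (hiT (hs.trans hst)) (hiT hs)]
  have e1 : coeff n (fun x => transform S (fun x => w x t) x - transform S (fun x => w x s) x)
      = coeff n (transform S fun x => f'' x + S (f x)) := by
    refine coeff_congr_ae (ae_unitMeasure_of_forall fun x hx => ?_)
    beta_reduce
    rw [← transform_sub S (hit (hs.trans hst)) (hit hs) hx]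
    exact transform_congr S (fun y hy => (hf'' y hy).symm) hx
  rw [e1, key]
  congr 1
  have e2 : ∫ τ in s..t, coeff n (transform S fun x => w x τ)
      = ∫ τ in s..t, coeff n (transform S fun x => v x τ) := by
    refine intervalIntegral.integral_congr fun τ hτ => ?_
    rw [uIcc_of_le hst.le] at hτ
    exact hc τ hτ
  rw [e2]
  unfold coeff
  simp_rw [integral_unitMeasure]
  rw [integral_swap_of_continuous hzc]
  refine intervalIntegral.integral_congr fun x hx => ?_
  rw [uIcc_of_le zero_le_one] at hx
  simp only [hFz x hx, intervalIntegral.integral_smul]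

/-- The coefficients of the transformed solution decay exponentially. -/
lemma coeff_transform (h : IsReactionDiffusion S w wx wxx wt)
    (h1 : ∀ t > 0, transform S (fun x => w x t) 1 = 0) {w₀ : ℝ → E}
    (hw₀ : MemLp w₀ 2 unitMeasure)
    (h0 : Tendsto (fun t => eLpNorm (fun x => w x t - w₀ x) 2 unitMeasure) (𝓝[>] 0) (𝓝 0))
    (n : ℕ) {t : ℝ} (ht : 0 < t) :
    coeff n (transform S fun x => w x t)
      = Real.exp (-(freq n ^ 2) * t) • coeff n (transform S w₀) := by
  refine eq_exp_smul_of_sub_eq_integral (c := fun τ => coeff n (transform S fun x => w x τ))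
    (fun s t hs hst => (h.coeff_transform_sub h1 hs hst n).1)
    (fun s t hs hst => (h.coeff_transform_sub h1 hs hst n).2) ?_ ht
  obtain ⟨C, hC0, hC⟩ := exists_kernel_bound S
  rw [tendsto_iff_norm_sub_tendsto_zero]
  -- The coefficients and `T_S` are bounded on `L²`, so the `L²` initial condition passes to the
  -- coefficients of `T_S w`.
  have hlim : Tendsto (fun t => (1 + C) *
      (eLpNorm (fun x => w x t - w₀ x) 2 unitMeasure).toReal) (𝓝[>] 0) (𝓝 0) := by
    have := ((ENNReal.tendsto_toReal ENNReal.zero_ne_top).comp h0).const_mul (1 + C)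
    simpa using this
  refine squeeze_zero' (Eventually.of_forall fun _ => norm_nonneg _) ?_ hlim
  filter_upwards [self_mem_nhdsWithin] with τ hτ
  have hm := memLp_of_continuousOn (h.continuousOn_apply hτ)
  rw [← coeff_sub ((memLp_transform S hm).integrable one_le_two)
    ((memLp_transform S hw₀).integrable one_le_two)]
  have e : coeff n (fun x => transform S (fun x => w x τ) x - transform S w₀ x)
      = coeff n (transform S fun x => w x τ - w₀ x) :=
    coeff_congr_ae (ae_unitMeasure_of_forall fun x hx =>
      (transform_sub S (hm.integrable one_le_two) (hw₀.integrable one_le_two) hx).symm)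
  rw [e]
  have hd : MemLp (fun x => w x τ - w₀ x) 2 unitMeasure := hm.sub hw₀
  refine (norm_coeff_le (memLp_transform S hd)).trans ?_
  rw [← ENNReal.toReal_ofReal (by positivity : 0 ≤ 1 + C), ← ENNReal.toReal_mul]
  exact ENNReal.toReal_mono (ENNReal.mul_lt_top ENNReal.ofReal_lt_top hd.2).ne
    (eLpNorm_transform_le S hC hd)

end IsReactionDiffusion

end

/-! ### The heat semigroup as a cosine series, and existence for the closed loop. -/

section

/-- A summable majorant uniform for `t ≥ δ`, from `exp y ≥ y² / 2`. The weight `1 + μₙ²` covers the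
series and its derivatives in `x`, `xx` and `t` at once. -/
lemma freq_bound {δ t : ℝ} (hδ : 0 < δ) (ht : δ ≤ t) (n : ℕ) :
    (1 + freq n ^ 2) * Real.exp (-(freq n ^ 2) * t) ≤ 4 / δ ^ 2 * (1 / ((n + 1 : ℕ) : ℝ) ^ 2) := by
  have hn : ((n + 1 : ℕ) : ℝ) ≤ freq n := by
    have h3 := Real.pi_gt_three
    have : (0 : ℝ) ≤ n := Nat.cast_nonneg _
    unfold freq; push_cast
    nlinarith
  have h1 : (1 : ℝ) ≤ ((n + 1 : ℕ) : ℝ) := by push_cast; linarith [(Nat.cast_nonneg n : (0 : ℝ) ≤ n)]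
  set N : ℝ := ((n + 1 : ℕ) : ℝ)
  have hN2 : N ^ 2 ≤ freq n ^ 2 := pow_le_pow_left₀ (by linarith) hn 2
  set m := freq n ^ 2
  have hm1 : 1 ≤ m := (one_le_pow₀ h1).trans hN2
  have h4 : Real.exp (-m * t) ≤ 2 / (m * δ) ^ 2 := by
    have h5 : (m * δ) ^ 2 / 2 ≤ Real.exp (m * δ) := by
      have h6 : 0 ≤ m * δ := by positivity
      have := Real.quadratic_le_exp_of_nonneg h6
      linarith
    calc Real.exp (-m * t) ≤ Real.exp (-(m * δ)) := by
          apply Real.exp_le_exp.2; nlinarith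
      _ = (Real.exp (m * δ))⁻¹ := Real.exp_neg _
      _ ≤ ((m * δ) ^ 2 / 2)⁻¹ := inv_anti₀ (by positivity) h5
      _ = 2 / (m * δ) ^ 2 := by rw [inv_div]
  calc (1 + m) * Real.exp (-m * t) ≤ (2 * m) * (2 / (m * δ) ^ 2) := by
        gcongr; linarith
    _ = 4 / δ ^ 2 * (1 / m) := by field_simp; ring
    _ ≤ 4 / δ ^ 2 * (1 / N ^ 2) := by gcongr

lemma summable_freq_bound (c : ℝ) : Summable fun n : ℕ => c * (1 / ((n + 1 : ℕ) : ℝ) ^ 2) :=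
  ((summable_nat_add_iff 1).2 (Real.summable_one_div_nat_pow.2 one_lt_two)).mul_left c

variable {E : Type*} [NormedAddCommGroup E] [InnerProductSpace ℝ E] [FiniteDimensional ℝ E]

/-- The series `∑ exp (-μₙ² t) φₙ(x) aₙ` with the frequencies `μₙ = (n + 1/2) π`. -/
def heatSeries (φ : ℕ → ℝ → ℝ) (a : ℕ → E) (x t : ℝ) : E :=
  ∑' n, (Real.exp (-(freq n ^ 2) * t) * φ n x) • a n

section HeatSeries

variable {a : ℕ → E} {A : ℝ} {φ : ℕ → ℝ → ℝ}

lemma norm_heatSeries_term_le (ha : ∀ n, ‖a n‖ ≤ A) {n : ℕ} {x : ℝ} (hφ : |φ n x| ≤ 1 + freq n ^ 2)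
    {δ t : ℝ} (hδ : 0 < δ) (ht : δ ≤ t) :
    ‖(Real.exp (-(freq n ^ 2) * t) * φ n x) • a n‖
      ≤ A * (4 / δ ^ 2) * (1 / ((n + 1 : ℕ) : ℝ) ^ 2) := by
  rw [norm_smul, norm_mul, Real.norm_eq_abs, Real.norm_eq_abs, Real.abs_exp]
  have hA : 0 ≤ A := (norm_nonneg _).trans (ha n)
  calc Real.exp (-(freq n ^ 2) * t) * |φ n x| * ‖a n‖
      ≤ Real.exp (-(freq n ^ 2) * t) * (1 + freq n ^ 2) * A := by gcongr; exact ha n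
    _ = ((1 + freq n ^ 2) * Real.exp (-(freq n ^ 2) * t)) * A := by ring
    _ ≤ (4 / δ ^ 2 * (1 / ((n + 1 : ℕ) : ℝ) ^ 2)) * A := by
        exact mul_le_mul_of_nonneg_right (freq_bound hδ ht n) hA
    _ = _ := by ring

lemma summable_heatSeries (ha : ∀ n, ‖a n‖ ≤ A) (hφ : ∀ n x, |φ n x| ≤ 1 + freq n ^ 2)
    (x : ℝ) {t : ℝ} (ht : 0 < t) :
    Summable fun n => (Real.exp (-(freq n ^ 2) * t) * φ n x) • a n :=
  Summable.of_norm_bounded (summable_freq_bound (A * (4 / t ^ 2)))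
    fun _ => norm_heatSeries_term_le ha (hφ _ _) ht le_rfl

lemma continuousOn_heatSeries (ha : ∀ n, ‖a n‖ ≤ A) (hφ : ∀ n x, |φ n x| ≤ 1 + freq n ^ 2)
    (hc : ∀ n, Continuous (φ n)) :
    ContinuousOn (fun p : ℝ × ℝ => heatSeries φ a p.1 p.2) (univ ×ˢ Ioi 0) := by
  rintro ⟨x, t⟩ ⟨-, ht⟩
  have ht : 0 < t := ht
  have h1 : ContinuousOn (fun p : ℝ × ℝ => heatSeries φ a p.1 p.2) (univ ×ˢ Ioi (t / 2)) := by
    refine continuousOn_tsum (fun n => ?_) (summable_freq_bound (A * (4 / (t / 2) ^ 2))) ?_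
    · have := hc n
      fun_prop
    · rintro n ⟨y, s⟩ ⟨-, hs⟩
      exact norm_heatSeries_term_le ha (hφ _ _) (by linarith) (le_of_lt hs)
  refine (h1.continuousAt ?_).continuousWithinAt
  exact (isOpen_univ.prod isOpen_Ioi).mem_nhds ⟨mem_univ _, show t / 2 < t by linarith⟩

lemma hasDerivAt_heatSeries_left {φ' : ℕ → ℝ → ℝ} (ha : ∀ n, ‖a n‖ ≤ A)
    (hφ : ∀ n x, |φ n x| ≤ 1 + freq n ^ 2) (hφ' : ∀ n x, |φ' n x| ≤ 1 + freq n ^ 2)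
    (hd : ∀ n x, HasDerivAt (φ n) (φ' n x) x) (x : ℝ) {t : ℝ} (ht : 0 < t) :
    HasDerivAt (fun x => heatSeries φ a x t) (heatSeries φ' a x t) x := by
  unfold heatSeries
  refine hasDerivAt_tsum (𝕜 := ℝ) (F := E)
    (g := fun n x => (Real.exp (-(freq n ^ 2) * t) * φ n x) • a n)
    (g' := fun n x => (Real.exp (-(freq n ^ 2) * t) * φ' n x) • a n) (summable_freq_bound (A * (4 / t ^ 2))) (fun n y => ?_) (fun n y => ?_)
    (summable_heatSeries ha hφ x ht) x
  · exact ((hd n y).const_mul _).smul_const _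
  · exact norm_heatSeries_term_le ha (hφ' _ _) ht le_rfl

lemma hasDerivAt_heatSeries_right {ψ : ℕ → ℝ → ℝ} (ha : ∀ n, ‖a n‖ ≤ A)
    (hφ : ∀ n x, |φ n x| ≤ 1 + freq n ^ 2) (hψ : ∀ n x, |ψ n x| ≤ 1 + freq n ^ 2)
    (hd : ∀ n x, ψ n x = -(freq n ^ 2) * φ n x) (x : ℝ) {t : ℝ} (ht : 0 < t) :
    HasDerivAt (fun t => heatSeries φ a x t) (heatSeries ψ a x t) t := by
  unfold heatSeries
  refine hasDerivAt_tsum_of_isPreconnected (𝕜 := ℝ) (F := E) (t := Ioi (t / 2)) (y₀ := t)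
    (g := fun n t => (Real.exp (-(freq n ^ 2) * t) * φ n x) • a n)
    (g' := fun n t => (Real.exp (-(freq n ^ 2) * t) * ψ n x) • a n)
    (summable_freq_bound (A * (4 / (t / 2) ^ 2))) isOpen_Ioi isPreconnected_Ioi
    (fun n s _ => ?_) (fun n s hs => ?_) (by simpa using ht) (summable_heatSeries ha hφ x ht)
    (by simpa using ht)
  · have h1 : HasDerivAt (fun t => Real.exp (-(freq n ^ 2) * t))
        (Real.exp (-(freq n ^ 2) * s) * (-(freq n ^ 2))) s := by
      simpa using ((hasDerivAt_id' s).const_mul (-(freq n ^ 2))).exp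
    convert! (h1.mul_const (φ n x)).smul_const (a n) using 2
    rw [hd]; ring
  · exact norm_heatSeries_term_le ha (hψ _ _) (by linarith) (le_of_lt hs)

end HeatSeries

/-- The solution of the heat equation with a Neumann condition at `0`, a Dirichlet condition at
`1`, and the initial value `z₀`. -/
def heat (z₀ : ℝ → E) : ℝ → ℝ → E :=
  heatSeries (fun n x => Real.cos (freq n * x)) fun n => (2 : ℝ) • coeff n z₀

/-- The derivative of `heat z₀` in `x`. -/
def heatX (z₀ : ℝ → E) : ℝ → ℝ → E :=
  heatSeries (fun n x => -Real.sin (freq n * x) * freq n) fun n => (2 : ℝ) • coeff n z₀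

/-- The second derivative of `heat z₀` in `x`. -/
def heatXX (z₀ : ℝ → E) : ℝ → ℝ → E :=
  heatSeries (fun n x => -(freq n ^ 2) * Real.cos (freq n * x)) fun n => (2 : ℝ) • coeff n z₀

lemma abs_cos_freq_le (n : ℕ) (x : ℝ) : |Real.cos (freq n * x)| ≤ 1 + freq n ^ 2 :=
  (Real.abs_cos_le_one _).trans (by nlinarith [sq_nonneg (freq n)])

lemma abs_sin_freq_le (n : ℕ) (x : ℝ) : |-Real.sin (freq n * x) * freq n| ≤ 1 + freq n ^ 2 := by
  rw [abs_mul, abs_neg, abs_of_pos (freq_pos n)]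
  have := mul_le_mul_of_nonneg_right (Real.abs_sin_le_one (freq n * x)) (freq_pos n).le
  nlinarith [sq_nonneg (freq n - 1), freq_pos n]

lemma abs_sq_cos_freq_le (n : ℕ) (x : ℝ) :
    |-(freq n ^ 2) * Real.cos (freq n * x)| ≤ 1 + freq n ^ 2 := by
  rw [abs_mul, abs_neg, abs_of_nonneg (sq_nonneg _)]
  have := mul_le_mul_of_nonneg_left (Real.abs_cos_le_one (freq n * x)) (sq_nonneg (freq n))
  linarith

section Heat

variable {z₀ : ℝ → E}

lemma norm_two_smul_coeff_le (hz : MemLp z₀ 2 unitMeasure) (n : ℕ) :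
    ‖(2 : ℝ) • coeff n z₀‖ ≤ 2 * (eLpNorm z₀ 2 unitMeasure).toReal := by
  rw [norm_smul, Real.norm_of_nonneg zero_le_two]
  exact mul_le_mul_of_nonneg_left (norm_coeff_le hz) zero_le_two

lemma continuousOn_heat (hz : MemLp z₀ 2 unitMeasure) :
    ContinuousOn (fun p : ℝ × ℝ => heat z₀ p.1 p.2) (univ ×ˢ Ioi 0) :=
  continuousOn_heatSeries (norm_two_smul_coeff_le hz) abs_cos_freq_le (by fun_prop)

lemma continuousOn_heatX (hz : MemLp z₀ 2 unitMeasure) :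
    ContinuousOn (fun p : ℝ × ℝ => heatX z₀ p.1 p.2) (univ ×ˢ Ioi 0) :=
  continuousOn_heatSeries (norm_two_smul_coeff_le hz) abs_sin_freq_le (by fun_prop)

lemma continuousOn_heatXX (hz : MemLp z₀ 2 unitMeasure) :
    ContinuousOn (fun p : ℝ × ℝ => heatXX z₀ p.1 p.2) (univ ×ˢ Ioi 0) :=
  continuousOn_heatSeries (norm_two_smul_coeff_le hz) abs_sq_cos_freq_le (by fun_prop)

lemma isNeumannC2_heat (hz : MemLp z₀ 2 unitMeasure) {t : ℝ} (ht : 0 < t) :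
    IsNeumannC2 (fun x => heat z₀ x t) (fun x => heatX z₀ x t) (fun x => heatXX z₀ x t) := by
  refine ⟨fun x => ?_, fun x => ?_, ?_, by simp [heatX, heatSeries]⟩
  · refine hasDerivAt_heatSeries_left (norm_two_smul_coeff_le hz) abs_cos_freq_le abs_sin_freq_le
      (fun n x => ?_) x ht
    simpa using ((hasDerivAt_id' x).const_mul (freq n)).cos
  · refine hasDerivAt_heatSeries_left (norm_two_smul_coeff_le hz) abs_sin_freq_le
      abs_sq_cos_freq_le (fun n x => ?_) x ht
    have : HasDerivAt (fun x => Real.sin (freq n * x)) (Real.cos (freq n * x) * freq n) x := by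
      simpa using ((hasDerivAt_id' x).const_mul (freq n)).sin
    convert! this.neg.mul_const (freq n) using 1
    ring
  · exact (continuousOn_heatXX hz).comp_continuous (f := fun x : ℝ => (x, t)) (by fun_prop)
      fun x => ⟨mem_univ _, ht⟩

lemma hasDerivAt_heat_right (hz : MemLp z₀ 2 unitMeasure) (x : ℝ) {t : ℝ} (ht : 0 < t) :
    HasDerivAt (fun t => heat z₀ x t) (heatXX z₀ x t) t :=
  hasDerivAt_heatSeries_right (norm_two_smul_coeff_le hz) abs_cos_freq_le abs_sq_cos_freq_le
    (fun _ _ => rfl) x ht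

lemma heat_one (t : ℝ) : heat z₀ 1 t = 0 := by
  simp [heat, heatSeries, cos_freq]

/-- Uniform convergence for fixed `t > 0` allows termwise integration; orthogonality keeps one term,
where the `2` in the series cancels `∫ cos² = 1/2`. -/
lemma coeff_heat (hz : MemLp z₀ 2 unitMeasure) (m : ℕ) {t : ℝ} (ht : 0 < t) :
    coeff m (fun x => heat z₀ x t) = Real.exp (-(freq m ^ 2) * t) • coeff m z₀ := by
  set F : ℕ → ℝ → E := fun n x => Real.cos (freq m * x) •
    (Real.exp (-(freq n ^ 2) * t) * Real.cos (freq n * x)) • (2 : ℝ) • coeff n z₀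
  have hFc : ∀ n, Continuous (F n) := fun n => by fun_prop
  have hFb : ∀ n x, ‖F n x‖ ≤ 2 * (eLpNorm z₀ 2 unitMeasure).toReal * (4 / t ^ 2)
      * (1 / ((n + 1 : ℕ) : ℝ) ^ 2) := fun n x => by
    rw [norm_smul]
    exact (mul_le_of_le_one_left (norm_nonneg _) (Real.abs_cos_le_one _)).trans
      (norm_heatSeries_term_le (φ := fun n x => Real.cos (freq n * x)) (norm_two_smul_coeff_le hz)
        (abs_cos_freq_le _ _) ht le_rfl)
  have hFi : ∀ n, Integrable (F n) unitMeasure := fun n =>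
    (memLp_of_continuousOn (hFc n).continuousOn).integrable one_le_two
  have h1 : HasSum (fun n => ∫ x, F n x ∂unitMeasure) (∫ x, ∑' n, F n x ∂unitMeasure) := by
    refine hasSum_integral_of_summable_integral_norm hFi ?_
    refine Summable.of_nonneg_of_le (fun n => integral_nonneg fun _ => norm_nonneg _) (fun n => ?_)
      (summable_freq_bound (2 * (eLpNorm z₀ 2 unitMeasure).toReal * (4 / t ^ 2)))
    refine (integral_mono (hFi n).norm (integrable_const _) (hFb n)).trans ?_
    simp
  have h2 : ∀ n, ∫ x, F n x ∂unitMeasure =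
      if n = m then Real.exp (-(freq m ^ 2) * t) • coeff m z₀ else 0 := by
    intro n
    have : ∀ x, F n x = (Real.cos (freq m * x) * Real.cos (freq n * x)) •
        (Real.exp (-(freq n ^ 2) * t) * 2) • coeff n z₀ := by
      intro x; simp only [F, smul_smul]; congr 1; ring
    simp_rw [this]
    rw [integral_unitMeasure, intervalIntegral.integral_smul_const, integral_cos_freq_mul_cos_freq]
    by_cases hnm : n = m
    · rw [if_pos hnm.symm, if_pos hnm, hnm, smul_smul]
      congr 1; ring
    · rw [if_neg (Ne.symm hnm), if_neg hnm, zero_smul]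
  simp_rw [h2] at h1
  rw [← h1.unique (hasSum_ite_eq m _)]
  unfold coeff heat heatSeries
  congr 1
  ext x
  exact ((summable_heatSeries (norm_two_smul_coeff_le hz) abs_cos_freq_le x ht).tsum_const_smul
    (Real.cos (freq m * x))).symm

lemma memLp_heat (hz : MemLp z₀ 2 unitMeasure) {t : ℝ} (ht : 0 < t) :
    MemLp (fun x => heat z₀ x t) 2 unitMeasure :=
  memLp_of_continuousOn (isNeumannC2_heat hz ht).continuous.continuousOn

lemma abs_exp_neg_sub_one_le {y : ℝ} (hy : 0 ≤ y) : |Real.exp (-y) - 1| ≤ 1 := by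
  rw [abs_le]
  constructor <;> linarith [Real.exp_pos (-y), Real.exp_le_one_iff.2 (neg_nonpos.2 hy)]

lemma tendsto_heat (hz : MemLp z₀ 2 unitMeasure) :
    Tendsto (fun t => eLpNorm (fun x => heat z₀ x t - z₀ x) 2 unitMeasure) (𝓝[>] 0) (𝓝 0) := by
  refine tendsto_eLpNorm_sub_of_coeff (f := fun t x => heat z₀ x t)
    (a := fun t n => Real.exp (-(freq n ^ 2) * t)) ?_ hz ?_ (fun n => ?_) ?_
  · filter_upwards [self_mem_nhdsWithin] with t ht using memLp_heat hz ht
  · filter_upwards [self_mem_nhdsWithin] with t ht n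
    rw [neg_mul]
    exact abs_exp_neg_sub_one_le (mul_nonneg (sq_nonneg _) (le_of_lt ht))
  · have := ((by fun_prop : Continuous fun s => Real.exp (-(freq n ^ 2) * s)).tendsto 0).mono_left
      (nhdsWithin_le_nhds (s := Ioi 0))
    simpa using this
  · filter_upwards [self_mem_nhdsWithin] with t ht n using coeff_heat hz n ht

end Heat

variable [Nontrivial E]

/-- The series is continuous only for positive times, so time ranges over the subtype `Ioi 0`, on
which `continuous_transform` applies globally. -/
lemma continuousOn_transform_param (S : E →L[ℝ] E) {f : ℝ → ℝ → E}
    (hf : ContinuousOn (fun p : ℝ × ℝ => f p.1 p.2) (univ ×ˢ Ioi 0)) :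
    ContinuousOn (fun p : ℝ × ℝ => transform S (fun x => f x p.2) p.1) (univ ×ˢ Ioi 0) := by
  have h1 : Continuous fun p : Ioi (0 : ℝ) × ℝ => f p.2 p.1 :=
    hf.comp_continuous (f := fun p : Ioi (0 : ℝ) × ℝ => (p.2, (p.1 : ℝ))) (by fun_prop)
      fun p => ⟨mem_univ _, p.1.2⟩
  rw [continuousOn_iff_continuous_domRestrict]
  exact (continuous_transform S (f := fun (t : Ioi (0 : ℝ)) x => f x t) h1).comp
    (by fun_prop : Continuous fun p : (univ ×ˢ Ioi (0 : ℝ) : Set (ℝ × ℝ)) =>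
      ((⟨p.1.2, p.2.2⟩ : Ioi (0 : ℝ)), p.1.1))

lemma continuousOn_transformDeriv_param (S : E →L[ℝ] E) {f f' : ℝ → ℝ → E}
    (hf : ContinuousOn (fun p : ℝ × ℝ => f p.1 p.2) (univ ×ˢ Ioi 0))
    (hf' : ContinuousOn (fun p : ℝ × ℝ => f' p.1 p.2) (univ ×ˢ Ioi 0)) :
    ContinuousOn (fun p : ℝ × ℝ => transformDeriv S (fun x => f x p.2) (fun x => f' x p.2) p.1)
      (univ ×ˢ Ioi 0) := by
  unfold transformDeriv
  refine hf'.add (ContinuousOn.add ?_ ?_)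
  · exact ContinuousOn.clm_apply (((continuous_kernel S).comp
      (by fun_prop : Continuous fun p : ℝ × ℝ => (p.1, p.1))).continuousOn) hf
  · rw [continuousOn_iff_continuous_domRestrict]
    have h1 : Continuous fun q : (univ ×ˢ Ioi (0 : ℝ) : Set (ℝ × ℝ)) × ℝ => f q.2 q.1.1.2 :=
      hf.comp_continuous (f := fun q : (univ ×ˢ Ioi (0 : ℝ) : Set (ℝ × ℝ)) × ℝ => (q.2, q.1.1.2))
        (by fun_prop) fun q => ⟨mem_univ _, q.1.2.2⟩
    exact intervalIntegral.continuous_parametric_intervalIntegral_of_continuous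
      (f := fun (p : (univ ×ˢ Ioi (0 : ℝ) : Set (ℝ × ℝ))) y => kernelX S p.1.1 y (f y p.1.2))
      (((continuous_kernelX S).comp (by fun_prop : Continuous
        fun q : (univ ×ˢ Ioi (0 : ℝ) : Set (ℝ × ℝ)) × ℝ => (q.1.1.1, q.2))).clm_apply h1)
      (by fun_prop)

/-- For `w = T_{-S} z` intertwining gives `w_xx = T_{-S} (z_xx - S z)`, while `w_t = T_{-S} z_xx`;
since `T_{-S}` commutes with `S`, the difference is `S w`. -/
lemma isReactionDiffusion_transform_heat (S : E →L[ℝ] E) {z₀ : ℝ → E}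
    (hz : MemLp z₀ 2 unitMeasure) :
    IsReactionDiffusion S (fun x t => transform (-S) (fun x => heat z₀ x t) x)
      (fun x t => transformDeriv (-S) (fun x => heat z₀ x t) (fun x => heatX z₀ x t) x)
      (fun x t => transform (-S) (fun x => heatXX z₀ x t + (-S) (heat z₀ x t)) x)
      (fun x t => transform (-S) (fun x => heatXX z₀ x t) x) := by
  have hC2 := fun {t : ℝ} (ht : 0 < t) => isNeumannC2_transform (-S) (isNeumannC2_heat hz ht)
  have cz := continuousOn_heat hz
  have czxx := continuousOn_heatXX hz
  refine ⟨?_, ?_, ?_, ?_, fun x _ t ht => ((hC2 ht).hasDerivAt x).hasDerivWithinAt,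
    fun x _ t ht => (hC2 ht).hasDerivAt' x, fun x hx t ht => ?_, fun x hx t ht => ?_,
    fun t ht => (hC2 ht).zero⟩
  · exact (continuousOn_transform_param (-S) cz).mono (prod_mono_left (subset_univ _))
  · exact (continuousOn_transformDeriv_param (-S) cz (continuousOn_heatX hz)).mono
      (prod_mono_left (subset_univ _))
  · exact (continuousOn_transform_param (-S) (f := fun x t => heatXX z₀ x t + (-S) (heat z₀ x t))
      (czxx.add ((-S).continuous.comp_continuousOn cz))).mono (prod_mono_left (subset_univ _))
  · exact (continuousOn_transform_param (-S) czxx).mono (prod_mono_left (subset_univ _))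
  · refine (hasDerivAt_heat_right hz x ht).add ?_
    have hsw : ∀ {f : ℝ → ℝ → E}, ContinuousOn (fun p : ℝ × ℝ => f p.1 p.2) (univ ×ˢ Ioi 0) →
        ContinuousOn (fun p : ℝ × ℝ => kernel (-S) x p.2 (f p.2 p.1)) (Ioi 0 ×ˢ Icc 0 x) := by
      intro f hf
      refine ContinuousOn.clm_apply ((continuous_kernel (-S)).comp
        (by fun_prop : Continuous fun p : ℝ × ℝ => (x, p.2))).continuousOn ?_
      exact hf.comp (f := Prod.swap) continuous_swap.continuousOn fun p hp => ⟨mem_univ _, hp.1⟩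
    refine hasDerivAt_integral_of_continuousOn (U := Ioi 0)
      (F := fun t y => kernel (-S) x y (heat z₀ y t))
      (F' := fun t y => kernel (-S) x y (heatXX z₀ y t)) isOpen_Ioi hx.1.le (hsw cz) (hsw czxx)
      (fun t ht y _ => ?_) ht
    simpa using (hasDerivAt_const t (kernel (-S) x y)).clm_apply (hasDerivAt_heat_right hz y ht)
  · have h1 : Continuous fun x => heatXX z₀ x t := (isNeumannC2_heat hz ht).continuous''
    have h2 : Continuous fun x => heat z₀ x t := (isNeumannC2_heat hz ht).continuous
    rw [transform_add_of_continuous (-S) h1 (by fun_prop), transform_comm (-S) h2]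
    simp

/-- Existence for the closed loop: the transformed solution has the value `0` at `x = 1`, and the
initial value is attained in `L²`. -/
lemma exists_isReactionDiffusion (S : E →L[ℝ] E) {w₀ : ℝ → E} (hw₀ : MemLp w₀ 2 unitMeasure) :
    ∃ w wx wxx wt, IsReactionDiffusion S w wx wxx wt ∧
      (∀ t > 0, transform S (fun x => w x t) 1 = 0) ∧
      Tendsto (fun t => eLpNorm (fun x => w x t - w₀ x) 2 unitMeasure) (𝓝[>] 0) (𝓝 0) := by
  have hz := memLp_transform S hw₀
  refine ⟨_, _, _, _, isReactionDiffusion_transform_heat S hz, fun t ht => ?_, ?_⟩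
  · have h := transform_transform_neg S
      (f := fun x => heat (transform S w₀) x t) (isNeumannC2_heat hz ht).continuous.continuousOn
    exact (h (by simp : (1 : ℝ) ∈ Icc (0 : ℝ) 1)).trans (heat_one t)
  · obtain ⟨C, hC0, hC⟩ := exists_kernel_bound (-S)
    have hlim := ENNReal.Tendsto.const_mul (tendsto_heat hz)
      (Or.inr (ENNReal.ofReal_ne_top (r := 1 + C)))
    rw [mul_zero] at hlim
    refine tendsto_of_tendsto_of_tendsto_of_le_of_le' tendsto_const_nhds hlim
      (Eventually.of_forall fun _ => zero_le) ?_
    filter_upwards [self_mem_nhdsWithin] with t ht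
    have hd : MemLp (fun x => heat (transform S w₀) x t - transform S w₀ x) 2 unitMeasure :=
      (memLp_heat hz ht).sub hz
    refine le_of_eq_of_le (eLpNorm_congr_ae ?_) (eLpNorm_transform_le (-S) hC hd)
    -- Since `w₀ = T_{-S} T_S w₀` almost everywhere, `w - w₀` is `T_{-S}` of `z - T_S w₀`, which
    -- tends to zero.
    have h1 := transform_transform_neg_ae (-S) hw₀
    rw [neg_neg] at h1
    filter_upwards [h1, ae_restrict_mem measurableSet_Ioo] with x hx hx1
    rw [transform_sub (-S) ((memLp_heat hz ht).integrable one_le_two) (hz.integrable one_le_two)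
      (Ioo_subset_Icc_self hx1), hx]

end

/-! ### Uniqueness for the Goursat problem. -/

section

/-- Both `φ - g` and `φ + g` are monotone. This replaces integration along characteristics, since
second derivatives are controlled only inside the triangle. -/
lemma abs_sub_le_sub_of_abs_deriv_le {g g' φ φ' : ℝ → ℝ} {T : ℝ} (hT : 0 ≤ T)
    (hg : ContinuousOn g (Icc 0 T)) (hφ : ContinuousOn φ (Icc 0 T))
    (dg : ∀ τ ∈ Ioo 0 T, HasDerivAt g (g' τ) τ) (dφ : ∀ τ ∈ Ioo 0 T, HasDerivAt φ (φ' τ) τ)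
    (h : ∀ τ ∈ Ioo 0 T, |g' τ| ≤ φ' τ) : |g T - g 0| ≤ φ T - φ 0 := by
  have h1 : MonotoneOn (fun τ => φ τ - g τ) (Icc 0 T) := by
    refine monotoneOn_of_deriv_nonneg (convex_Icc _ _) (hφ.sub hg) ?_ ?_ <;> rw [interior_Icc]
    · exact fun τ hτ => ((dφ τ hτ).sub (dg τ hτ)).differentiableAt.differentiableWithinAt
    · intro τ hτ
      rw [((dφ τ hτ).fun_sub (dg τ hτ)).deriv]
      linarith [(abs_le.1 (h τ hτ)).2]
  have h2 : MonotoneOn (fun τ => φ τ + g τ) (Icc 0 T) := by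
    refine monotoneOn_of_deriv_nonneg (convex_Icc _ _) (hφ.add hg) ?_ ?_ <;> rw [interior_Icc]
    · exact fun τ hτ => ((dφ τ hτ).add (dg τ hτ)).differentiableAt.differentiableWithinAt
    · intro τ hτ
      rw [((dφ τ hτ).fun_add (dg τ hτ)).deriv]
      linarith [(abs_le.1 (h τ hτ)).1]
  have h3 := h1 (left_mem_Icc.2 hT) (right_mem_Icc.2 hT) hT
  have h4 := h2 (left_mem_Icc.2 hT) (right_mem_Icc.2 hT) hT
  simp only at h3 h4
  rw [abs_le]
  constructor <;> linarith

/-- The interior of the triangle. -/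
def openTriangle : Set (ℝ × ℝ) := {p | 0 < p.2 ∧ p.2 < p.1 ∧ p.1 < 1}

lemma isOpen_openTriangle : IsOpen openTriangle :=
  (isOpen_lt continuous_const continuous_snd).inter
    ((isOpen_lt continuous_snd continuous_fst).inter (isOpen_lt continuous_fst continuous_const))

lemma openTriangle_subset : openTriangle ⊆ triangle := fun _ h => ⟨h.1.le, h.2.1.le, h.2.2.le⟩

lemma triangle_mem_nhds {p : ℝ × ℝ} (hp : p ∈ openTriangle) : triangle ∈ 𝓝 p :=
  mem_of_superset (isOpen_openTriangle.mem_nhds hp) openTriangle_subset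

lemma isCompact_triangle : IsCompact triangle := by
  refine ((isCompact_Icc (a := (0 : ℝ)) (b := 1)).prod
    (isCompact_Icc (a := (0 : ℝ)) (b := 1))).of_isClosed_subset ?_ ?_
  · exact (isClosed_le continuous_const continuous_snd).inter
      ((isClosed_le continuous_snd continuous_fst).inter
        (isClosed_le continuous_fst continuous_const))
  · rintro p ⟨h1, h2, h3⟩
    exact ⟨⟨h1.trans h2, h3⟩, ⟨h1, h2.trans h3⟩⟩

/-- Needed for the within-derivative of a `C²(Υ)` function to be continuous up to the boundary,
where the data are read off. -/
lemma uniqueDiffOn_triangle : UniqueDiffOn ℝ triangle := by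
  refine uniqueDiffOn_convex ?_ ⟨(1 / 2, 1 / 4), mem_interior_iff_mem_nhds.2
    (triangle_mem_nhds (by norm_num [openTriangle]))⟩
  rintro ⟨x, y⟩ ⟨h1, h2, h3⟩ ⟨x', y'⟩ ⟨h1', h2', h3'⟩ a b ha hb hab
  simp only at h1 h2 h3 h1' h2' h3'
  refine ⟨?_, ?_, ?_⟩ <;> simp only [Prod.smul_mk, Prod.mk_add_mk, smul_eq_mul]
  · positivity
  · nlinarith
  · nlinarith

section Characteristics

variable {u : ℝ × ℝ → ℝ}

lemma hasFDerivAt_fderivWithin_triangle (hu : ContDiffOn ℝ 2 u triangle) {p : ℝ × ℝ}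
    (hp : p ∈ openTriangle) :
    HasFDerivAt (fderivWithin ℝ u triangle) (fderiv ℝ (fderiv ℝ u) p) p := by
  have h1 : ContDiffAt ℝ 2 u p := hu.contDiffAt (triangle_mem_nhds hp)
  have h2 : DifferentiableAt ℝ (fderiv ℝ u) p :=
    (h1.fderiv_right (m := 1) (by norm_num)).differentiableAt (by norm_num)
  refine h2.hasFDerivAt.congr_of_eventuallyEq ?_
  filter_upwards [isOpen_openTriangle.mem_nhds hp] with q hq
  exact fderivWithin_of_mem_nhds (triangle_mem_nhds hq)

lemma hasDerivAt_fderivWithin_line (hu : ContDiffOn ℝ 2 u triangle) {p v w : ℝ × ℝ} {τ : ℝ}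
    (hp : p + τ • v ∈ openTriangle) :
    HasDerivAt (fun τ : ℝ => fderivWithin ℝ u triangle (p + τ • v) w)
      (fderiv ℝ (fderiv ℝ u) (p + τ • v) v w) τ := by
  have h1 : HasDerivAt (fun τ : ℝ => p + τ • v) v τ := by
    simpa using ((hasDerivAt_id' τ).smul_const v).const_add p
  have h2 := (hasFDerivAt_fderivWithin_triangle hu hp).comp_hasDerivAt τ h1
  simpa using h2.clm_apply (hasDerivAt_const τ w)

lemma hasDerivAt_line (hu : ContDiffOn ℝ 2 u triangle) {p v : ℝ × ℝ} {τ : ℝ}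
    (hp : p + τ • v ∈ openTriangle) :
    HasDerivAt (fun τ : ℝ => u (p + τ • v)) (fderivWithin ℝ u triangle (p + τ • v) v) τ := by
  have h1 : HasDerivAt (fun τ : ℝ => p + τ • v) v τ := by
    simpa using ((hasDerivAt_id' τ).smul_const v).const_add p
  have h2 : HasFDerivAt u (fderivWithin ℝ u triangle (p + τ • v)) (p + τ • v) :=
    ((hu.differentiableOn (by norm_num)) _ (openTriangle_subset hp)).hasFDerivWithinAt.hasFDerivAt
      (triangle_mem_nhds hp)
  exact h2.comp_hasDerivAt τ h1

lemma iteratedDeriv_two_line (hu : ContDiffOn ℝ 2 u triangle) {p v : ℝ × ℝ} {τ : ℝ}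
    (hp : p + τ • v ∈ openTriangle) :
    iteratedDeriv 2 (fun τ : ℝ => u (p + τ • v)) τ
      = fderiv ℝ (fderiv ℝ u) (p + τ • v) v v := by
  rw [iteratedDeriv_succ, iteratedDeriv_one]
  have h1 : deriv (fun τ : ℝ => u (p + τ • v)) =ᶠ[𝓝 τ]
      fun τ => fderivWithin ℝ u triangle (p + τ • v) v := by
    have : ∀ᶠ τ in 𝓝 τ, p + τ • v ∈ openTriangle :=
      (by fun_prop : Continuous fun τ : ℝ => p + τ • v).continuousAt.eventually_mem
        (isOpen_openTriangle.mem_nhds hp)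
    filter_upwards [this] with σ hσ using (hasDerivAt_line hu hσ).deriv
  rw [h1.deriv_eq]
  exact (hasDerivAt_fderivWithin_line hu hp).deriv

/-- The wave operator in characteristic coordinates. -/
lemma fderiv_fderiv_characteristic (hu : ContDiffOn ℝ 2 u triangle) {x y : ℝ}
    (hp : (x, y) ∈ openTriangle) :
    fderiv ℝ (fderiv ℝ u) (x, y) (1, -1) (1, 1)
        = iteratedDeriv 2 (fun x' => u (x', y)) x - iteratedDeriv 2 (fun y' => u (x, y')) y ∧
    fderiv ℝ (fderiv ℝ u) (x, y) (1, 1) (1, -1)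
        = iteratedDeriv 2 (fun x' => u (x', y)) x - iteratedDeriv 2 (fun y' => u (x, y')) y := by
  have h1 := iteratedDeriv_two_line hu (p := (0, y)) (v := (1, 0)) (τ := x) (by simpa using hp)
  have h2 := iteratedDeriv_two_line hu (p := (x, 0)) (v := (0, 1)) (τ := y) (by simpa using hp)
  simp only [Prod.smul_mk, smul_eq_mul, mul_one, mul_zero, Prod.mk_add_mk, zero_add, add_zero]
    at h1 h2
  -- The mixed second derivatives cancel by symmetry.
  have hs : IsSymmSndFDerivAt ℝ u (x, y) :=
    (hu.contDiffAt (triangle_mem_nhds hp)).isSymmSndFDerivAt (by simp)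
  have hs' := hs.eq (1, 0) (0, 1)
  have e1 : ((1, -1) : ℝ × ℝ) = (1, 0) - (0, 1) := by simp
  have e2 : ((1, 1) : ℝ × ℝ) = (1, 0) + (0, 1) := by simp
  rw [h1, h2, e1, e2]
  simp only [map_sub, map_add, _root_.sub_apply, _root_.add_apply]
  constructor <;> linarith

lemma fderivWithin_triangle_diag (hu : ContDiffOn ℝ 2 u triangle)
    (hd : ∀ x ∈ Icc (0 : ℝ) 1, u (x, x) = 0) {x : ℝ} (hx : x ∈ Icc (0 : ℝ) 1) :
    fderivWithin ℝ u triangle (x, x) (1, 1) = 0 := by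
  have hm : MapsTo (fun τ : ℝ => (τ, τ)) (Icc 0 1) triangle := fun τ hτ => ⟨hτ.1, le_rfl, hτ.2⟩
  have h1 : HasDerivWithinAt (fun τ : ℝ => (τ, τ)) ((1, 1) : ℝ × ℝ) (Icc 0 1) x :=
    (hasDerivWithinAt_id x _).prodMk (hasDerivWithinAt_id x _)
  have h2 := HasFDerivWithinAt.comp_hasDerivWithinAt (f := fun τ : ℝ => (τ, τ)) x
    ((hu.differentiableOn (by norm_num)) (x, x) (hm hx)).hasFDerivWithinAt h1 hm
  have h3 : HasDerivWithinAt (u ∘ fun τ : ℝ => (τ, τ)) 0 (Icc 0 1) x :=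
    (hasDerivWithinAt_const x _ (0 : ℝ)).congr (fun τ hτ => hd τ hτ) (hd x hx)
  exact (uniqueDiffOn_Icc zero_lt_one x hx).eq_deriv _ h2 h3

lemma fderivWithin_triangle_bottom (hu : ContDiffOn ℝ 2 u triangle) {x : ℝ}
    (hx : x ∈ Ioc (0 : ℝ) 1) (hb : HasDerivWithinAt (fun y => u (x, y)) 0 (Icc 0 x) 0) :
    fderivWithin ℝ u triangle (x, 0) (0, 1) = 0 := by
  have hm : MapsTo (fun τ : ℝ => (x, τ)) (Icc 0 x) triangle := fun τ hτ => ⟨hτ.1, hτ.2, hx.2⟩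
  have h1 : HasDerivWithinAt (fun τ : ℝ => (x, τ)) ((0, 1) : ℝ × ℝ) (Icc 0 x) 0 :=
    (hasDerivWithinAt_const 0 _ x).prodMk (hasDerivWithinAt_id 0 _)
  have h0 : (0 : ℝ) ∈ Icc 0 x := ⟨le_rfl, hx.1.le⟩
  have h2 := ((hu.differentiableOn (by norm_num)) (x, 0) (hm h0)).hasFDerivWithinAt
    |>.comp_hasDerivWithinAt 0 h1 hm
  exact (uniqueDiffOn_Icc hx.1 0 h0).eq_deriv _ h2 hb

/-- One step of the Picard iteration for the Goursat problem. -/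
lemma abs_le_of_abs_wave_le (hu : ContDiffOn ℝ 2 u triangle)
    (hd : ∀ x ∈ Icc (0 : ℝ) 1, u (x, x) = 0)
    (hb : ∀ x ∈ Ioc (0 : ℝ) 1, HasDerivWithinAt (fun y => u (x, y)) 0 (Icc 0 x) 0)
    {c : ℝ} (hc : 0 ≤ c) {n : ℕ}
    (hw : ∀ x y : ℝ, (x, y) ∈ openTriangle →
      |iteratedDeriv 2 (fun x' => u (x', y)) x - iteratedDeriv 2 (fun y' => u (x, y')) y|
        ≤ c * x ^ n)
    {x y : ℝ} (hp : (x, y) ∈ triangle) : |u (x, y)| ≤ 2 * c / (n + 1) * x ^ (n + 1) := by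
  have hcont : ContinuousOn (fderivWithin ℝ u triangle) triangle :=
    hu.continuousOn_fderivWithin uniqueDiffOn_triangle (by norm_num)
  have hdline : ∀ {x y τ : ℝ}, (x, y) ∈ triangle → τ ∈ Icc 0 ((x - y) / 2) →
      (((x + y) / 2, (x + y) / 2) : ℝ × ℝ) + τ • ((1, -1) : ℝ × ℝ) ∈ triangle := by
    rintro x y τ ⟨h1, h2, h3⟩ ⟨h4, h5⟩
    simp only at h1 h2 h3
    refine ⟨?_, ?_, ?_⟩ <;> simp <;> linarith
  have hdline' : ∀ {x y τ : ℝ}, (x, y) ∈ triangle → τ ∈ Ioo 0 ((x - y) / 2) →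
      (((x + y) / 2, (x + y) / 2) : ℝ × ℝ) + τ • ((1, -1) : ℝ × ℝ) ∈ openTriangle := by
    rintro x y τ ⟨h1, h2, h3⟩ ⟨h4, h5⟩
    simp only at h1 h2 h3
    refine ⟨?_, ?_, ?_⟩ <;> simp <;> linarith
  have hend : ∀ x y : ℝ, (((x + y) / 2, (x + y) / 2) : ℝ × ℝ) + ((x - y) / 2) • ((1, -1) : ℝ × ℝ)
      = (x, y) := by
    intro x y; ext <;> simp <;> ring
  -- The derivative `u_x + u_y` is tangential on the diagonal, hence zero there; it is followed
  -- along `(1,-1)` from the diagonal point `((x+y)/2, (x+y)/2)`, where its rate of change is the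
  -- wave operator.
  have bound_p : ∀ {x y : ℝ}, (x, y) ∈ triangle →
      |fderivWithin ℝ u triangle (x, y) (1, 1)| ≤ c * x ^ n := by
    intro x y hp
    obtain ⟨h1, h2, h3⟩ := id hp
    simp only at h1 h2 h3
    have hx0 : 0 ≤ c * x ^ n := mul_nonneg hc (pow_nonneg (h1.trans h2) n)
    have key := abs_sub_le_sub_of_abs_deriv_le (T := (x - y) / 2)
      (g := fun τ => fderivWithin ℝ u triangle
        (((x + y) / 2, (x + y) / 2) + τ • ((1, -1) : ℝ × ℝ)) (1, 1))
      (φ := fun τ => c * x ^ n * τ) (by linarith)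
      ((hcont.comp (by fun_prop) fun τ hτ => hdline hp hτ).clm_apply continuousOn_const)
      (by fun_prop) (fun τ hτ => hasDerivAt_fderivWithin_line hu (hdline' hp hτ))
      (fun τ _ => (hasDerivAt_id' τ).const_mul (c * x ^ n)) (fun τ hτ => ?_)
    · simp only [hend, zero_smul, add_zero, mul_zero, sub_zero] at key
      rw [fderivWithin_triangle_diag hu hd ⟨by linarith, by linarith⟩, sub_zero] at key
      exact key.trans (mul_le_of_le_one_right hx0 (by linarith))
    · have hm := hdline' hp hτ
      simp only [Prod.smul_mk, smul_eq_mul, mul_one, mul_neg, Prod.mk_add_mk] at hm ⊢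
      rw [(fderiv_fderiv_characteristic hu hm).1]
      refine (hw _ _ hm).trans ?_
      gcongr
      · linarith [hτ.1]
      · linarith [hτ.2]
  -- The derivative `u_x - u_y` is followed along `(1,1)` from `(x - y, 0)`. There `u_y = 0`, so it
  -- coincides with `u_x + u_y` and starts within `c x ^ n`; the path adds at most as much again.
  have bound_q : ∀ {x y : ℝ}, (x, y) ∈ openTriangle →
      |fderivWithin ℝ u triangle (x, y) (1, -1)| ≤ 2 * c * x ^ n := by
    rintro x y ⟨h1, h2, h3⟩
    simp only at h1 h2 h3
    have hx0 : 0 ≤ c * x ^ n := mul_nonneg hc (pow_nonneg (h1.trans h2).le n)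
    have hm : ∀ τ ∈ Icc 0 y, (((x - y, 0) : ℝ × ℝ) + τ • ((1, 1) : ℝ × ℝ)) ∈ triangle := by
      rintro τ ⟨h4, h5⟩
      refine ⟨?_, ?_, ?_⟩ <;> simp <;> linarith
    have hm' : ∀ τ ∈ Ioo 0 y, (((x - y, 0) : ℝ × ℝ) + τ • ((1, 1) : ℝ × ℝ)) ∈ openTriangle := by
      rintro τ ⟨h4, h5⟩
      refine ⟨?_, ?_, ?_⟩ <;> simp <;> linarith
    have key := abs_sub_le_sub_of_abs_deriv_le (T := y)
      (g := fun τ => fderivWithin ℝ u triangle ((x - y, 0) + τ • ((1, 1) : ℝ × ℝ)) (1, -1))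
      (φ := fun τ => c * x ^ n * τ) h1.le
      ((hcont.comp (by fun_prop) hm).clm_apply continuousOn_const)
      (by fun_prop) (fun τ hτ => hasDerivAt_fderivWithin_line hu (hm' τ hτ))
      (fun τ _ => (hasDerivAt_id' τ).const_mul (c * x ^ n)) (fun τ hτ => ?_)
    · have e1 : (((x - y, 0) : ℝ × ℝ) + y • ((1, 1) : ℝ × ℝ)) = (x, y) := by ext <;> simp
      simp only [e1, zero_smul, add_zero, mul_zero, sub_zero] at key
      have e2 : fderivWithin ℝ u triangle (x - y, 0) (1, -1)
          = fderivWithin ℝ u triangle (x - y, 0) (1, 1) := by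
        have hx : x - y ∈ Ioc (0 : ℝ) 1 := ⟨by linarith, by linarith⟩
        have h0 := fderivWithin_triangle_bottom hu hx (hb _ hx)
        have e3 : ((1, -1) : ℝ × ℝ) = (1, 1) - (2 : ℝ) • (0, 1) := by
          ext <;> norm_num
        rw [e3, map_sub, map_smul, h0, smul_zero, sub_zero]
      have hq := bound_p (x := x - y) (y := 0) ⟨le_rfl, by simp; linarith, by simp; linarith⟩
      rw [← e2] at hq
      have h6 : c * (x - y) ^ n ≤ c * x ^ n := by gcongr; linarith
      have h7 : c * x ^ n * y ≤ c * x ^ n := mul_le_of_le_one_right hx0 (by linarith)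
      have h8 := abs_sub_abs_le_abs_sub (fderivWithin ℝ u triangle (x, y) (1, -1))
        (fderivWithin ℝ u triangle (x - y, 0) (1, -1))
      linarith
    · have hm'' := hm' τ hτ
      simp only [Prod.smul_mk, smul_eq_mul, mul_one, Prod.mk_add_mk] at hm'' ⊢
      rw [(fderiv_fderiv_characteristic hu hm'').2]
      refine (hw _ _ hm'').trans ?_
      gcongr
      · linarith [hτ.1]
      · linarith [hτ.2]
  obtain ⟨h1, h2, h3⟩ := id hp
  simp only at h1 h2 h3
  -- Integrating the bound on `u_x - u_y` from the diagonal, where `u = 0`, gains a power of `x` and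
  -- the divisor `n + 1`; these build up the factorial.
  have key := abs_sub_le_sub_of_abs_deriv_le (T := (x - y) / 2)
    (g := fun τ => u (((x + y) / 2, (x + y) / 2) + τ • ((1, -1) : ℝ × ℝ)))
    (φ := fun τ => 2 * c / (n + 1) * ((x + y) / 2 + τ) ^ (n + 1))
    (φ' := fun τ => 2 * c * ((x + y) / 2 + τ) ^ n) (by linarith)
    (hu.continuousOn.comp (by fun_prop) fun τ hτ => hdline hp hτ)
    (by fun_prop) (fun τ hτ => hasDerivAt_line hu (hdline' hp hτ))
    (fun τ _ => ?_) (fun τ hτ => ?_)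
  · simp only [hend, zero_smul, add_zero] at key
    rw [hd _ ⟨by linarith, by linarith⟩, sub_zero] at key
    refine key.trans ?_
    have e : (x + y) / 2 + (x - y) / 2 = x := by ring
    rw [e]
    have : 0 ≤ 2 * c / (n + 1) * ((x + y) / 2) ^ (n + 1) := by
      have : 0 ≤ (x + y) / 2 := by linarith
      positivity
    linarith
  · have := (((hasDerivAt_id' τ).const_add ((x + y) / 2)).pow (n + 1)).const_mul (2 * c / (n + 1))
    convert! this using 1
    push_cast
    have : (n : ℝ) + 1 ≠ 0 := by positivity
    field_simp
  · have hm := hdline' hp hτ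
    simp only [Prod.smul_mk, smul_eq_mul, mul_one, mul_neg, Prod.mk_add_mk] at hm ⊢
    exact bound_q hm

end Characteristics

/-- The difference of two solutions has zero data, and iterating `abs_le_of_abs_wave_le` from a sup
bound `B` gives `B (2 C x)ⁿ / n!` for every `n`, which tends to zero. The matrix `A` is arbitrary,
so both kernels are covered. -/
lemma IsGoursatSolution.eqOn {A : Matrix (Fin 4) (Fin 4) ℝ} {lam₁ lam₂ : ℝ}
    {K K' : ℝ → ℝ → Matrix (Fin 2) (Fin 2) ℝ} (hK : IsGoursatSolution A lam₁ lam₂ K)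
    (hK' : IsGoursatSolution A lam₁ lam₂ K') {x y : ℝ} (hp : (x, y) ∈ triangle) :
    K x y = K' x y := by
  set u : Fin 4 → ℝ × ℝ → ℝ := fun i p => vec (K p.1 p.2) i - vec (K' p.1 p.2) i
  have hu : ∀ i, ContDiffOn ℝ 2 (u i) triangle := fun i => (hK.contDiff i).sub (hK'.contDiff i)
  have hd : ∀ i, ∀ x ∈ Icc (0 : ℝ) 1, u i (x, x) = 0 := fun i x hx => by
    simp only [u, hK.diag x hx, hK'.diag x hx, sub_self]
  have hb : ∀ i, ∀ x ∈ Ioc (0 : ℝ) 1,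
      HasDerivWithinAt (fun y => u i (x, y)) 0 (Icc 0 x) 0 := fun i x hx => by
    convert! (hK.bottom x hx i).fun_sub (hK'.bottom x hx i) using 1
    simp
  have hw : ∀ i, ∀ x y : ℝ, (x, y) ∈ openTriangle →
      iteratedDeriv 2 (fun x' => u i (x', y)) x - iteratedDeriv 2 (fun y' => u i (x, y')) y
        = ∑ j, A i j * u j (x, y) := by
    intro i x y hp
    have c1 : ∀ {K : ℝ → ℝ → Matrix (Fin 2) (Fin 2) ℝ}, IsGoursatSolution A lam₁ lam₂ K →
        ContDiffAt ℝ 2 (fun x' => vec (K x' y) i) x := fun hK =>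
      ((hK.contDiff i).contDiffAt (triangle_mem_nhds hp)).comp x
        (f := fun x' : ℝ => (x', y)) (by fun_prop)
    have c2 : ∀ {K : ℝ → ℝ → Matrix (Fin 2) (Fin 2) ℝ}, IsGoursatSolution A lam₁ lam₂ K →
        ContDiffAt ℝ 2 (fun y' => vec (K x y') i) y := fun hK =>
      ((hK.contDiff i).contDiffAt (triangle_mem_nhds hp)).comp y
        (f := fun y' : ℝ => (x, y')) (by fun_prop)
    simp only [u]
    rw [iteratedDeriv_fun_sub (c1 hK) (c1 hK'), iteratedDeriv_fun_sub (c2 hK) (c2 hK')]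
    have e1 := hK.pde x y hp.1 hp.2.1 hp.2.2 i
    have e2 := hK'.pde x y hp.1 hp.2.1 hp.2.2 i
    simp only [Matrix.mulVec, dotProduct] at e1 e2
    simp_rw [mul_sub, Finset.sum_sub_distrib]
    linarith
  have hB : ∃ B, 0 ≤ B ∧ ∀ i, ∀ p ∈ triangle, |u i p| ≤ B := by
    choose B hB using fun i => isCompact_triangle.exists_bound_of_continuousOn (hu i).continuousOn
    have h0 : ∀ i, 0 ≤ B i := fun i =>
      (norm_nonneg _).trans (hB i (0, 0) (by simp [triangle]))
    exact ⟨∑ i, B i, Finset.sum_nonneg fun i _ => h0 i, fun i p hp => (hB i p hp).trans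
      (Finset.single_le_sum (fun i _ => h0 i) (Finset.mem_univ i))⟩
  obtain ⟨B, hB0, hB⟩ := hB
  set C : ℝ := ∑ i, ∑ j, |A i j|
  have hC0 : 0 ≤ C := Finset.sum_nonneg fun i _ => Finset.sum_nonneg fun j _ => abs_nonneg _
  have iter : ∀ n : ℕ, ∀ i, ∀ x y : ℝ, (x, y) ∈ triangle →
      |u i (x, y)| ≤ B * (2 * C) ^ n / n.factorial * x ^ n := by
    intro n
    induction n with
    | zero => intro i x y hp; simpa using hB i (x, y) hp
    | succ n ih =>
      intro i x y hp
      have := abs_le_of_abs_wave_le (hu i) (hd i) (hb i)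
        (c := C * (B * (2 * C) ^ n / n.factorial)) (by positivity) (n := n) (fun x y hp => ?_) hp
      · refine this.trans (le_of_eq ?_)
        rw [Nat.factorial_succ]
        push_cast
        field_simp
        ring
      · rw [hw i x y hp]
        calc |∑ j, A i j * u j (x, y)| ≤ ∑ j, |A i j| * (B * (2 * C) ^ n / n.factorial * x ^ n) := by
              refine (Finset.abs_sum_le_sum_abs _ _).trans (Finset.sum_le_sum fun j _ => ?_)
              rw [abs_mul]
              exact mul_le_mul_of_nonneg_left (ih j x y (openTriangle_subset hp)) (abs_nonneg _)
          _ = (∑ j, |A i j|) * (B * (2 * C) ^ n / n.factorial * x ^ n) := by rw [Finset.sum_mul]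
          _ ≤ C * (B * (2 * C) ^ n / n.factorial * x ^ n) := by
              have hx : 0 ≤ x := (hp.1.trans hp.2.1).le
              refine mul_le_mul_of_nonneg_right ?_ (by positivity)
              exact Finset.single_le_sum (f := fun i => ∑ j, |A i j|)
                (fun i _ => Finset.sum_nonneg fun j _ => abs_nonneg _) (Finset.mem_univ i)
          _ = _ := by ring
  have hzero : ∀ i, vec (K x y) i = vec (K' x y) i := by
    intro i
    have hlim : Tendsto (fun n : ℕ => B * ((2 * C * x) ^ n / n.factorial)) atTop (𝓝 (B * 0)) :=
      (FloorSemiring.tendsto_pow_div_factorial_atTop (2 * C * x)).const_mul B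
    have h0 : |u i (x, y)| ≤ B * 0 := ge_of_tendsto' hlim fun n => (iter n i x y hp).trans
      (le_of_eq (by rw [mul_pow (2 * C) x]; ring))
    rw [mul_zero] at h0
    exact sub_eq_zero.1 (abs_nonpos_iff.1 h0)
  have h0 := hzero 0
  have h1 := hzero 1
  have h2 := hzero 2
  have h3 := hzero 3
  simp only [vec, Matrix.cons_val] at h0 h1 h2 h3
  ext i j
  fin_cases i <;> fin_cases j <;> assumption

end

/-! ### Decay and uniqueness for the closed loop; identification of `K` and `L`. -/

section

section Abstract

variable {E : Type*} [NormedAddCommGroup E] [InnerProductSpace ℝ E] [FiniteDimensional ℝ E]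
  [Nontrivial E]

lemma transform_neg_transform (S : E →L[ℝ] E) {f : ℝ → E} (hf : ContinuousOn f (Icc 0 1)) :
    EqOn (transform (-S) (transform S f)) f (Icc 0 1) := by
  have := transform_transform_neg (-S) hf
  rwa [neg_neg] at this

namespace IsReactionDiffusion

variable {S : E →L[ℝ] E} {w wx wxx wt w' wx' wxx' wt' : ℝ → ℝ → E} {w₀ : ℝ → E}

/-- Three factors: `T_S` on the initial value costs `1 + C`, the slowest mode gives the exponential,
and the return by `T_{-S}` costs `1 + D`. -/
lemma eLpNorm_le (h : IsReactionDiffusion S w wx wxx wt)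
    (h1 : ∀ t > 0, transform S (fun x => w x t) 1 = 0) (hw₀ : MemLp w₀ 2 unitMeasure)
    (h0 : Tendsto (fun t => eLpNorm (fun x => w x t - w₀ x) 2 unitMeasure) (𝓝[>] 0) (𝓝 0))
    {C D : ℝ} (hC : ∀ p ∈ triangle, ‖kernel S p.1 p.2‖ ≤ C)
    (hD : ∀ p ∈ triangle, ‖kernel (-S) p.1 p.2‖ ≤ D) {t : ℝ} (ht : 0 < t) :
    eLpNorm (fun x => w x t) 2 unitMeasure ≤
      ENNReal.ofReal ((1 + D) * (1 + C) * Real.exp (-(freq 0 ^ 2) * t))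
        * eLpNorm w₀ 2 unitMeasure := by
  have hC0 : 0 ≤ C := (norm_nonneg _).trans (hC (0, 0) (by simp [triangle]))
  have hD0 : 0 ≤ D := (norm_nonneg _).trans (hD (0, 0) (by simp [triangle]))
  have hc := h.continuousOn_apply ht
  have hz := memLp_transform S (memLp_of_continuousOn hc)
  have e1 : eLpNorm (fun x => w x t) 2 unitMeasure
      = eLpNorm (transform (-S) (transform S fun x => w x t)) 2 unitMeasure :=
    eLpNorm_congr_ae (ae_unitMeasure_of_forall fun x hx => (transform_neg_transform S hc hx).symm)
  have e2 : eLpNorm (transform S fun x => w x t) 2 unitMeasure ≤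
      ENNReal.ofReal (Real.exp (-(freq 0 ^ 2) * t)) * eLpNorm (transform S w₀) 2 unitMeasure := by
    refine eLpNorm_le_of_coeff hz (memLp_transform S hw₀) (Real.exp_pos _).le (fun n => ?_)
      fun n => h.coeff_transform h1 hw₀ h0 n ht
    rw [Real.abs_exp]
    apply Real.exp_le_exp.2
    have : freq 0 ≤ freq n := by
      unfold freq
      gcongr
      simp
    have := pow_le_pow_left₀ (freq_pos 0).le this 2
    nlinarith
  rw [e1]
  calc _ ≤ ENNReal.ofReal (1 + D) * eLpNorm (transform S fun x => w x t) 2 unitMeasure :=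
        eLpNorm_transform_le (-S) hD hz
    _ ≤ ENNReal.ofReal (1 + D) * (ENNReal.ofReal (Real.exp (-(freq 0 ^ 2) * t)) *
          (ENNReal.ofReal (1 + C) * eLpNorm w₀ 2 unitMeasure)) := by
        gcongr
        refine e2.trans ?_
        gcongr
        exact eLpNorm_transform_le S hC hw₀
    _ = _ := by
        rw [ENNReal.ofReal_mul (by positivity), ENNReal.ofReal_mul (by positivity)]
        ring

/-- The initial value determines all cosine coefficients of the transformed solution, hence `T_S w`,
and `T_{-S}` recovers `w`. -/
lemma eq_of_tendsto (h : IsReactionDiffusion S w wx wxx wt)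
    (h1 : ∀ t > 0, transform S (fun x => w x t) 1 = 0)
    (h0 : Tendsto (fun t => eLpNorm (fun x => w x t - w₀ x) 2 unitMeasure) (𝓝[>] 0) (𝓝 0))
    (h' : IsReactionDiffusion S w' wx' wxx' wt')
    (h1' : ∀ t > 0, transform S (fun x => w' x t) 1 = 0)
    (h0' : Tendsto (fun t => eLpNorm (fun x => w' x t - w₀ x) 2 unitMeasure) (𝓝[>] 0) (𝓝 0))
    (hw₀ : MemLp w₀ 2 unitMeasure) {x t : ℝ} (hx : x ∈ Icc (0 : ℝ) 1) (ht : 0 < t) :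
    w x t = w' x t := by
  have hc := h.continuousOn_apply ht
  have hc' := h'.continuousOn_apply ht
  have hz := memLp_transform S (memLp_of_continuousOn hc)
  have hz' := memLp_transform S (memLp_of_continuousOn hc')
  have hae := ae_eq_of_coeff_eq (hz.integrable one_le_two) (hz'.integrable one_le_two) fun n => by
    rw [h.coeff_transform h1 hw₀ h0 n ht, h'.coeff_transform h1' hw₀ h0' n ht]
  have heq := eqOn_Icc_of_ae_eq_unitMeasure hae (continuousOn_transform S hc)
    (continuousOn_transform S hc')
  have h2 := transform_congr (-S) heq hx
  rwa [transform_neg_transform S hc hx, transform_neg_transform S hc' hx] at h2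

end IsReactionDiffusion

variable (S : E →L[ℝ] E) (ℓ : (E →L[ℝ] E) →L[ℝ] ℝ)

lemma iteratedDeriv_two_of_hasDerivAt {f f' f'' : ℝ → ℝ} (h : ∀ x, HasDerivAt f (f' x) x)
    (h' : ∀ x, HasDerivAt f' (f'' x) x) (x : ℝ) : iteratedDeriv 2 f x = f'' x := by
  rw [iteratedDeriv_succ, iteratedDeriv_one, show deriv f = f' from funext fun x => (h x).deriv]
  exact (h' x).deriv

lemma iteratedDeriv_kernel_left (x y : ℝ) :
    iteratedDeriv 2 (fun x => ℓ (kernel S x y)) x = ℓ (kernelXX S x y) :=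
  iteratedDeriv_two_of_hasDerivAt
    (fun x => ℓ.hasFDerivAt.comp_hasDerivAt x (hasDerivAt_kernel_left S x y))
    (f'' := fun x => ℓ (kernelXX S x y))
    (fun x => ℓ.hasFDerivAt.comp_hasDerivAt x (hasDerivAt_kernelX S x y)) x

lemma iteratedDeriv_kernel_right (x y : ℝ) :
    iteratedDeriv 2 (fun y => ℓ (kernel S x y)) y = ℓ (kernelYY S x y) :=
  iteratedDeriv_two_of_hasDerivAt
    (fun y => ℓ.hasFDerivAt.comp_hasDerivAt y (hasDerivAt_kernel_right S x y))
    (f'' := fun y => ℓ (kernelYY S x y))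
    (fun y => ℓ.hasFDerivAt.comp_hasDerivAt y (hasDerivAt_kernelY S x y)) y

lemma iteratedDeriv_kernel_sub (x y : ℝ) :
    iteratedDeriv 2 (fun x => ℓ (kernel S x y)) x - iteratedDeriv 2 (fun y => ℓ (kernel S x y)) y
      = ℓ (S * kernel S x y) := by
  rw [iteratedDeriv_kernel_left, iteratedDeriv_kernel_right, ← map_sub, kernelXX_sub_kernelYY]

lemma contDiff_clm_kernel : ContDiff ℝ 2 fun p : ℝ × ℝ => ℓ (kernel S p.1 p.2) :=
  ℓ.contDiff.comp (contDiff_kernel S)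

lemma hasDerivAt_clm_kernel_bottom (x : ℝ) : HasDerivAt (fun y => ℓ (kernel S x y)) 0 0 := by
  have := ℓ.hasFDerivAt.comp_hasDerivAt 0 (hasDerivAt_kernel_right S x 0)
  rwa [kernelY_zero_right, map_zero] at this

end Abstract

/-- The matrix of an endomorphism of the state space. -/
def toMat (A : State →L[ℝ] State) : Matrix (Fin 2) (Fin 2) ℝ :=
  (Matrix.toEuclideanCLM (𝕜 := ℝ) (n := Fin 2)).symm A

lemma act_toMat (A : State →L[ℝ] State) : act (toMat A) = A :=
  (Matrix.toEuclideanCLM (𝕜 := ℝ) (n := Fin 2)).apply_symm_apply A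

lemma toMat_act (M : Matrix (Fin 2) (Fin 2) ℝ) : toMat (act M) = M :=
  (Matrix.toEuclideanCLM (𝕜 := ℝ) (n := Fin 2)).symm_apply_apply M

lemma toMat_mul (A B : State →L[ℝ] State) : toMat (A * B) = toMat A * toMat B := map_mul _ _ _

lemma toMat_neg (A : State →L[ℝ] State) : toMat (-A) = -toMat A := map_neg _ _

lemma toMat_smul (c : ℝ) (A : State →L[ℝ] State) : toMat (c • A) = c • toMat A := map_smul _ _ _

lemma toMat_add (A B : State →L[ℝ] State) : toMat (A + B) = toMat A + toMat B := map_add _ _ _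

lemma vec_add (M N : Matrix (Fin 2) (Fin 2) ℝ) : vec (M + N) = vec M + vec N := by
  ext i; fin_cases i <;> simp [vec]

lemma vec_smul (c : ℝ) (M : Matrix (Fin 2) (Fin 2) ℝ) : vec (c • M) = c • vec M := by
  ext i; fin_cases i <;> simp [vec]

lemma vec_neg (M : Matrix (Fin 2) (Fin 2) ℝ) : vec (-M) = -vec M := by
  ext i; fin_cases i <;> simp [vec]

/-- The entries of the matrix of an endomorphism of the state space. -/
def entry (i : Fin 4) : (State →L[ℝ] State) →L[ℝ] ℝ :=
  LinearMap.toContinuousLinearMap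
    { toFun := fun A => vec (toMat A) i
      map_add' := fun A B => by rw [toMat_add, vec_add, Pi.add_apply]
      map_smul' := fun c A => by rw [toMat_smul, vec_smul, Pi.smul_apply, RingHom.id_apply] }

lemma entry_apply (i : Fin 4) (A : State →L[ℝ] State) : entry i A = vec (toMat A) i := rfl

lemma bigLambda_mulVec (lam₁ lam₂ : ℝ) (M : Matrix (Fin 2) (Fin 2) ℝ) :
    (bigLambda lam₁ lam₂).mulVec (vec M) = vec (M * coupling lam₁ lam₂) := by
  ext i
  fin_cases i <;>
    simp [bigLambda, vec, coupling, Matrix.mulVec, dotProduct, Fin.sum_univ_four,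
      Matrix.mul_apply, Fin.sum_univ_two, mul_comm]

lemma bigPsi_mulVec (lam₁ lam₂ : ℝ) (M : Matrix (Fin 2) (Fin 2) ℝ) :
    (bigPsi lam₁ lam₂).mulVec (vec M) = vec (coupling lam₁ lam₂ * M) := by
  ext i
  fin_cases i <;>
    simp [bigPsi, vec, coupling, Matrix.mulVec, dotProduct, Fin.sum_univ_four,
      Matrix.mul_apply, Fin.sum_univ_two]

lemma vec_coupling (lam₁ lam₂ x : ℝ) :
    vec (-((x / 2) • coupling lam₁ lam₂)) = ![0, -(lam₁ / 2) * x, -(lam₂ / 2) * x, 0] := by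
  ext i
  fin_cases i <;> simp [vec, coupling] <;> ring

/-- `bigLambda` encodes multiplication by `Σ` on the right, whereas `kernelXX_sub_kernelYY` puts it
on the left; the kernel commutes with `Σ`. -/
lemma isKernel_kernel (lam₁ lam₂ : ℝ) :
    IsKernel lam₁ lam₂ fun x y => toMat (-kernel (act (coupling lam₁ lam₂)) x y) := by
  set S := act (coupling lam₁ lam₂)
  have he : ∀ i x y, vec (toMat (-kernel S x y)) i = (-entry i) (kernel S x y) := fun i x y => by
    rw [toMat_neg, vec_neg, Pi.neg_apply]; rfl
  refine ⟨fun i => ?_, fun x y _ _ _ i => ?_, fun x _ => ?_, fun x _ i => ?_⟩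
  · simp_rw [he]
    exact (contDiff_clm_kernel S (-entry i)).contDiffOn
  · simp_rw [he]
    rw [iteratedDeriv_kernel_sub, bigLambda_mulVec, toMat_neg, Matrix.neg_mul, vec_neg,
      ← toMat_act (coupling lam₁ lam₂), ← toMat_mul]
    exact congrArg (fun A => -(vec (toMat A) i)) (commute_kernel S x y).eq
  · rw [kernel_diag, toMat_neg, toMat_smul, toMat_act, vec_coupling]
  · simp_rw [he]
    exact (hasDerivAt_clm_kernel_bottom S (-entry i) x).hasDerivWithinAt

/-- `bigPsi` encodes multiplication by `Σ` on the left, and its minus sign is that of `-Σ` in the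
kernel, so no commutation is needed. -/
lemma isInverseKernel_kernel (lam₁ lam₂ : ℝ) :
    IsInverseKernel lam₁ lam₂ fun x y => toMat (kernel (-act (coupling lam₁ lam₂)) x y) := by
  set S := act (coupling lam₁ lam₂)
  have he : ∀ i x y, vec (toMat (kernel (-S) x y)) i = entry i (kernel (-S) x y) :=
    fun _ _ _ => rfl
  refine ⟨fun i => ?_, fun x y _ _ _ i => ?_, fun x _ => ?_, fun x _ i => ?_⟩
  · simp_rw [he]
    exact (contDiff_clm_kernel (-S) (entry i)).contDiffOn
  · simp_rw [he]
    rw [iteratedDeriv_kernel_sub, Matrix.neg_mulVec, bigPsi_mulVec, neg_mul, map_neg, entry_apply,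
      toMat_mul, toMat_act]
    rfl
  · rw [kernel_diag, smul_neg, toMat_neg, toMat_smul, toMat_act, vec_coupling]
  · simp_rw [he]
    exact (hasDerivAt_clm_kernel_bottom (-S) (entry i) x).hasDerivWithinAt

section ClosedLoop

variable {lam₁ lam₂ : ℝ} {K L : ℝ → ℝ → Matrix (Fin 2) (Fin 2) ℝ}

lemma IsKernel.act_eq (hK : IsKernel lam₁ lam₂ K) {x y : ℝ} (hp : (x, y) ∈ triangle) :
    act (K x y) = -kernel (act (coupling lam₁ lam₂)) x y := by
  rw [hK.eqOn (isKernel_kernel lam₁ lam₂) hp, act_toMat]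

lemma IsInverseKernel.act_eq (hL : IsInverseKernel lam₁ lam₂ L) {x y : ℝ}
    (hp : (x, y) ∈ triangle) : act (L x y) = kernel (-act (coupling lam₁ lam₂)) x y := by
  rw [hL.eqOn (isInverseKernel_kernel lam₁ lam₂) hp, act_toMat]

lemma norm_act_le_kernelBound {S : State →L[ℝ] State}
    (h : ∀ x y, (x, y) ∈ triangle → ‖act (K x y)‖ = ‖kernel S x y‖) :
    ∀ p ∈ triangle, ‖kernel S p.1 p.2‖ ≤ kernelBound K := by
  obtain ⟨C, -, hC⟩ := exists_kernel_bound S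
  intro p hp
  rw [← h p.1 p.2 hp]
  refine le_csSup ⟨C, ?_⟩ ⟨p, hp, rfl⟩
  rintro _ ⟨q, hq, rfl⟩
  exact (h q.1 q.2 hq).le.trans (hC q hq)

/-- The feedback law is exactly the Dirichlet condition `(T_Σ w)(1) = 0`. -/
lemma IsKernel.transform_one (hK : IsKernel lam₁ lam₂ K) (w : ℝ → ℝ → State) (t : ℝ) :
    transform (act (coupling lam₁ lam₂)) (fun x => w x t) 1 = w 1 t - feedback K w t := by
  unfold transform feedback
  rw [sub_eq_add_neg, ← intervalIntegral.integral_neg]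
  congr 1
  refine intervalIntegral.integral_congr fun y hy => ?_
  rw [uIcc_of_le zero_le_one] at hy
  simp only [hK.act_eq (show ((1 : ℝ), y) ∈ triangle from ⟨hy.1, hy.2, le_rfl⟩), _root_.neg_apply,
    neg_neg]

lemma IsKernel.isClassicalSolution_iff (hK : IsKernel lam₁ lam₂ K) {w₀ : ℝ → State}
    {w : ℝ → ℝ → State} :
    IsClassicalSolution lam₁ lam₂ K w₀ w ↔ ∃ wx wxx wt,
      IsReactionDiffusion (act (coupling lam₁ lam₂)) w wx wxx wt ∧
      (∀ t > 0, transform (act (coupling lam₁ lam₂)) (fun x => w x t) 1 = 0) ∧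
      Tendsto (fun t => eLpNorm (fun x => w x t - w₀ x) 2 unitMeasure) (𝓝[>] 0) (𝓝 0) := by
  simp_rw [hK.transform_one, sub_eq_zero]
  constructor
  · rintro ⟨wx, wxx, wt, h1, h2, h3, h4, h5, h6, h7, h8, h9, h10, h11⟩
    exact ⟨wx, wxx, wt, ⟨h1, h2, h3, h4, h5, h6, h7, h8, h9⟩, h10, h11⟩
  · rintro ⟨wx, wxx, wt, ⟨h1, h2, h3, h4, h5, h6, h7, h8, h9⟩, h10, h11⟩
    exact ⟨wx, wxx, wt, h1, h2, h3, h4, h5, h6, h7, h8, h9, h10, h11⟩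

end ClosedLoop

end

end

end Backstepping

theorem theorem1 :
    ∃ κ ε : ℝ, 0 < κ ∧ 0 < ε ∧ ∀ lam₁ lam₂ : ℝ,
      -- the kernel equations have a unique solution on the triangle
      (∃ K, Backstepping.IsKernel lam₁ lam₂ K) ∧
      (∀ K K', Backstepping.IsKernel lam₁ lam₂ K → Backstepping.IsKernel lam₁ lam₂ K' →
        ∀ x y : ℝ, (x, y) ∈ Backstepping.triangle → K x y = K' x y) ∧
      -- and so do the inverse kernel equations
      (∃ L, Backstepping.IsInverseKernel lam₁ lam₂ L) ∧
      (∀ L L', Backstepping.IsInverseKernel lam₁ lam₂ L → Backstepping.IsInverseKernel lam₁ lam₂ L' →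
        ∀ x y : ℝ, (x, y) ∈ Backstepping.triangle → L x y = L' x y) ∧
      -- the closed loop
      ∀ K L, Backstepping.IsKernel lam₁ lam₂ K → Backstepping.IsInverseKernel lam₁ lam₂ L →
        ∀ w₀ : ℝ → Backstepping.State, MemLp w₀ 2 Backstepping.unitMeasure →
          (∃ w, Backstepping.IsClassicalSolution lam₁ lam₂ K w₀ w) ∧
          (∀ w w', Backstepping.IsClassicalSolution lam₁ lam₂ K w₀ w →
            Backstepping.IsClassicalSolution lam₁ lam₂ K w₀ w' →
            ∀ x ∈ Set.Icc (0 : ℝ) 1, ∀ t > 0, w x t = w' x t) ∧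
          (∀ w, Backstepping.IsClassicalSolution lam₁ lam₂ K w₀ w → ∀ t > 0,
            Backstepping.l2norm (fun x => w x t) ≤
              ENNReal.ofReal (κ * (1 + Backstepping.kernelBound L) *
                (1 + Backstepping.kernelBound K) * Real.exp (-ε * t)) *
              Backstepping.l2norm w₀) := by
  -- Here `κ = 1`, and `ε = (π/2)²` is the lowest eigenvalue of the Neumann–Dirichlet problem.
  refine ⟨1, Backstepping.freq 0 ^ 2, one_pos, pow_pos (Backstepping.freq_pos 0) 2,
    fun lam₁ lam₂ => ⟨⟨_, Backstepping.isKernel_kernel lam₁ lam₂⟩,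
      fun K K' hK hK' x y hp => hK.eqOn hK' hp,
      ⟨_, Backstepping.isInverseKernel_kernel lam₁ lam₂⟩,
      fun L L' hL hL' x y hp => hL.eqOn hL' hp, fun K L hK hL w₀ hw₀ => ⟨?_, ?_, ?_⟩⟩⟩
  · obtain ⟨w, wx, wxx, wt, h⟩ := Backstepping.exists_isReactionDiffusion
      (Backstepping.act (Backstepping.coupling lam₁ lam₂)) hw₀
    exact ⟨w, hK.isClassicalSolution_iff.2 ⟨wx, wxx, wt, h⟩⟩
  · intro w w' hw hw' x hx t ht
    obtain ⟨_, _, _, h, h1, h0⟩ := hK.isClassicalSolution_iff.1 hw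
    obtain ⟨_, _, _, h', h1', h0'⟩ := hK.isClassicalSolution_iff.1 hw'
    exact h.eq_of_tendsto h1 h0 h' h1' h0' hw₀ hx ht
  · intro w hw t ht
    obtain ⟨_, _, _, h, h1, h0⟩ := hK.isClassicalSolution_iff.1 hw
    rw [one_mul]
    refine h.eLpNorm_le h1 hw₀ h0 (Backstepping.norm_act_le_kernelBound fun x y hp => ?_)
      (Backstepping.norm_act_le_kernelBound fun x y hp => ?_) ht
    · rw [hK.act_eq hp, norm_neg]
    · rw [hL.act_eq hp]
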